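/- **Setting.** A *hyperbolic polyhedron* is a compact intersection of finitely many half-spaces of $\mathbb H^3$; using the projective (Klein) model, $\mathbb H^3$ is the open unit ball of $\mathbb R^3$ and half-spaces of $\mathbb H^3$ are traces of half-spaces of $\mathbb R^3$. Let $\mathcal H\cong S^2\times\mathbb R$ be the manifold of closed half-spaces of $\mathbb R^3$. Let $\Gamma'$ be a finite simple $3$-connected planar graph (more than three vertices, not disconnected by removing at most two vertices), embedded in the sphere, and let $\Gamma$ be the embedded graph obtained from $\Gamma'$ by adding an edge $e=uw$, drawn across a face of $\Gamma'$, between two distinct non-adjacent vertices $u,w$ of that face (which is therefore not a triangle). Write $F(\Gamma)$ and $F(\Gamma')$ for the sets of faces, and $c\colon F(\Gamma)\to F(\Gamma')$ for the map sending the two faces adjacent to $e$ to the face of $\Gamma'$ that $e$ subdivides, and every other face to itself. A polyhedron $P$ *has $1$-skeleton* $\Gamma$, via a bijection $\varphi$ from the vertices of $\Gamma$ to the vertices of $P$, if $\varphi(a),\varphi(b)$ span an edge of $P$ exactly when $ab$ is an edge of $\Gamma$. It *has weak $1$-skeleton* $(\Gamma,e)$ via $\varphi$ if this holds for all pairs $ab\neq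 e$, and the segment from $\varphi(u)$ to $\varphi(w)$ lies in a proper face of $P$. Let $\mathcal P_\Gamma\subset\mathcal H^{F(\Gamma)}$ (respectively $\mathcal P_\Gamma^e\subset\mathcal H^{F(\Gamma)}$) be the set of families $(\Pi_f)_{f\in F(\Gamma)}$ such that $P=\mathbb H^3\cap\bigcap_f\Pi_f$ is compact and has $1$-skeleton $\Gamma$ (respectively weak $1$-skeleton $(\Gamma,e)$) via some $\varphi$ with $\varphi(v)\in\partial\Pi_f$ for every face $f$ and every vertex $v$ of $f$. Define $\mathcal P_{\Gamma'}\subset\mathcal H^{F(\Gamma')}$ in the same way. All these sets carry the subspace topology. **Proposition.** There is an integer $n\ge 0$ such that: 1. $\mathcal P_\Gamma$ is a smooth $(n+1)$-dimensional manifold, smoothly embedded in $\mathcal H^{F(\Gamma)}$; 2. $\mathcal P_\Gamma^e$ is a smooth $(n+1)$-dimensional manifold with boundary, smoothly embedded in $\mathcal H^{F(\Gamma)}$; its interior is $\mathcal P_\Gamma$, and its boundary is $\mathcal P_{\Gamma'}$, embedded in $\mathcal H^{F(\Gamma)}$ by $(\Pi_{f'})_{f'\in F(\Gamma')}\mapsto(\Pi_{c(f)})_{f\in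 F(\Gamma)}$. -/

import Mathlib

open scoped Manifold ContDiff

/-! ### Plane graphs -/

/-- A finite graph is 3-connected: it has more than three vertices, and it stays connected when
at most two vertices are removed. -/
def SimpleGraph.IsThreeConnected {V : Type*} (G : SimpleGraph V) : Prop :=
  4 ≤ Nat.card V ∧ ∀ S : Set V, S.ncard ≤ 2 → (G.induce Sᶜ).Connected

/-- A rotation system: a cyclic ordering of the neighbours around every vertex. It describes a
cellular embedding of a connected graph in a closed oriented surface, up to isotopy. -/
structure RotationSystem {V : Type*} (G : SimpleGraph V) where
  rot : V → Equiv.Perm V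
  isCycleOn : ∀ v, (rot v).IsCycleOn (G.neighborSet v)
  fixes : ∀ v x, ¬ G.Adj v x → rot v x = x

namespace RotationSystem

variable {V : Type*} {G : SimpleGraph V} (M : RotationSystem G)

/-- Walking around a face: the directed edge `x → v` is followed by `v → rot v x`. -/
def FaceStep (d d' : G.Dart) : Prop :=
  d'.fst = d.snd ∧ d'.snd = M.rot d.snd d.fst

/-- The faces of the embedding: orbits of directed edges under `FaceStep`. -/
def Face : Type _ := Quot M.FaceStep

/-- The face to which a directed edge belongs. -/
def face (d : G.Dart) : M.Face := Quot.mk _ d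

/-- The vertices lying on a face. -/
def faceVerts (f : M.Face) : Set V := {v | ∃ d : G.Dart, M.face d = f ∧ d.fst = v}

/-- The surface is the sphere: the graph is connected and `|V| - |E| + |F| = 2`. -/
def IsPlanar : Prop :=
  G.Connected ∧ Nat.card V + Nat.card M.Face = Nat.card G.edgeSet + 2

instance [Finite V] : Finite M.Face := by
  have : Finite G.Dart :=
    Finite.of_injective (fun d : G.Dart => d.toProd) SimpleGraph.Dart.toProd_injective
  exact inferInstanceAs (Finite (Quot M.FaceStep))

noncomputable instance [Finite V] : Fintype M.Face := Fintype.ofFinite _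

end RotationSystem

/-- Inserting a fixed point `x` into a cycle, right after `a`, gives a cycle. -/
theorem Equiv.Perm.IsCycleOn.mul_swap_insert {α : Type*} [Finite α] [DecidableEq α]
    {σ : Equiv.Perm α} {s : Set α} (h : σ.IsCycleOn s) {a x : α} (ha : a ∈ s) (hx : x ∉ s)
    (hfix : σ x = x) : (σ * Equiv.swap a x).IsCycleOn (insert x s) := by
  have hax : a ≠ x := fun h => hx (h ▸ ha)
  have τa : (σ * Equiv.swap a x) a = x := by simp [hfix]
  have τx : (σ * Equiv.swap a x) x = σ a := by simp
  have τo : ∀ z, z ≠ a → z ≠ x → (σ * Equiv.swap a x) z = σ z := fun z h1 h2 => by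
    simp [Equiv.swap_apply_of_ne_of_ne h1 h2]
  generalize hτ : σ * Equiv.swap a x = τ at *
  have hmaps : Set.MapsTo τ (insert x s) (insert x s) := by
    intro z hz
    by_cases h1 : z = a
    · subst h1; rw [τa]; exact Set.mem_insert _ _
    by_cases h2 : z = x
    · subst h2; rw [τx]; exact Set.mem_insert_of_mem _ (h.1.mapsTo ha)
    · rw [τo z h1 h2]
      exact Set.mem_insert_of_mem _ (h.1.mapsTo (Set.mem_of_mem_insert_of_ne hz h2))
  have hstep : ∀ z ∈ s, τ.SameCycle z (σ z) := by
    intro z hz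
    have hzx : z ≠ x := fun h => hx (h ▸ hz)
    by_cases h1 : z = a
    · subst h1
      refine ⟨2, ?_⟩
      rw [zpow_ofNat, pow_two, Equiv.Perm.mul_apply, τa, τx]
    · exact ⟨1, by rw [zpow_one, τo z h1 hzx]⟩
  have hpow : ∀ k : ℕ, τ.SameCycle a ((σ ^ k) a) ∧ (σ ^ k) a ∈ s := by
    intro k
    induction k with
    | zero => exact ⟨Equiv.Perm.SameCycle.refl _ _, ha⟩
    | succ k ih =>
      rw [pow_succ', Equiv.Perm.mul_apply]
      exact ⟨ih.1.trans (hstep _ ih.2), h.1.mapsTo ih.2⟩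
  have hall : ∀ z ∈ insert x s, τ.SameCycle a z := by
    intro z hz
    rcases hz with rfl | hz
    · exact ⟨1, by rw [zpow_one, τa]⟩
    · obtain ⟨k, -, rfl⟩ := (h.2 ha hz).exists_pow_eq'
      exact (hpow k).1
  exact ⟨((Set.toFinite _).injOn_iff_bijOn_of_mapsTo hmaps).1 τ.injective.injOn,
    fun y hy z hz => (hall y hy).symm.trans (hall z hz)⟩

namespace RotationSystem

/-- The graph obtained by adding the edge joining the heads of two directed edges. -/
abbrev chordGraph {V : Type*} {G : SimpleGraph V} (d₁ d₂ : G.Dart) : SimpleGraph V :=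
  G ⊔ SimpleGraph.edge d₁.snd d₂.snd

/-- Add the edge `e` joining the heads `u`, `w` of two directed edges `p → u` and `q → w`, placing
it right after `p` in the cyclic order at `u` and right after `q` in the cyclic order at `w`.
When both directed edges belong to the same face, this draws `e` as a chord across that face. -/
def addChord {V : Type*} [Finite V] [DecidableEq V] {G : SimpleGraph V} (M : RotationSystem G)
    (d₁ d₂ : G.Dart) (hne : d₁.snd ≠ d₂.snd) (hadj : ¬ G.Adj d₁.snd d₂.snd) :
    RotationSystem (chordGraph d₁ d₂) where
  rot v :=
    if v = d₁.snd then M.rot v * Equiv.swap d₁.fst d₂.snd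
    else if v = d₂.snd then M.rot v * Equiv.swap d₂.fst d₁.snd
    else M.rot v
  isCycleOn v := by
    by_cases h1 : v = d₁.snd
    · subst h1
      have hN : (chordGraph d₁ d₂).neighborSet d₁.snd
          = insert d₂.snd (G.neighborSet d₁.snd) := by
        ext x
        simp only [SimpleGraph.mem_neighborSet, SimpleGraph.sup_adj, SimpleGraph.edge_adj,
          Set.mem_insert_iff]
        grind
      rw [hN, if_pos rfl]
      exact (M.isCycleOn _).mul_swap_insert d₁.adj.symm hadj (M.fixes _ _ hadj)
    by_cases h2 : v = d₂.snd
    · subst h2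
      have hN : (chordGraph d₁ d₂).neighborSet d₂.snd
          = insert d₁.snd (G.neighborSet d₂.snd) := by
        ext x
        simp only [SimpleGraph.mem_neighborSet, SimpleGraph.sup_adj, SimpleGraph.edge_adj,
          Set.mem_insert_iff]
        grind
      have hadj' : ¬ G.Adj d₂.snd d₁.snd := fun h => hadj h.symm
      rw [hN, if_neg h1, if_pos rfl]
      exact (M.isCycleOn _).mul_swap_insert d₂.adj.symm hadj' (M.fixes _ _ hadj')
    · have hN : (chordGraph d₁ d₂).neighborSet v = G.neighborSet v := by
        ext x
        simp only [SimpleGraph.mem_neighborSet, SimpleGraph.sup_adj, SimpleGraph.edge_adj]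
        grind
      rw [hN, if_neg h1, if_neg h2]
      exact M.isCycleOn v
  fixes v x hx := by
    have hG : ¬ G.Adj v x := fun h => hx (Or.inl h)
    have hE : ¬ (SimpleGraph.edge d₁.snd d₂.snd).Adj v x := fun h => hx (Or.inr h)
    rw [SimpleGraph.edge_adj] at hE
    have a1 := d₁.adj
    have a2 := d₂.adj
    split_ifs with h1 h2
    · subst h1
      have : x ≠ d₁.fst := by rintro rfl; exact hG a1.symm
      have : x ≠ d₂.snd := by rintro rfl; exact hE ⟨Or.inl ⟨rfl, rfl⟩, hne⟩
      rw [Equiv.Perm.mul_apply, Equiv.swap_apply_of_ne_of_ne ‹_› ‹_›, M.fixes _ _ hG]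
    · subst h2
      have : x ≠ d₂.fst := by rintro rfl; exact hG a2.symm
      have : x ≠ d₁.snd := by rintro rfl; exact hE ⟨Or.inr ⟨rfl, rfl⟩, hne.symm⟩
      rw [Equiv.Perm.mul_apply, Equiv.swap_apply_of_ne_of_ne ‹_› ‹_›, M.fixes _ _ hG]
    · exact M.fixes _ _ hG

/-- A directed edge of a graph, seen in the graph with the chord added. -/
def oldDart {V : Type*} {G : SimpleGraph V} {d₁ d₂ : G.Dart} (d : G.Dart) :
    (chordGraph d₁ d₂).Dart :=
  ⟨d.toProd, Or.inl d.adj⟩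

end RotationSystem

/-! ### Half-spaces and hyperbolic polyhedra -/

/-- Euclidean three-space. -/
abbrev Space3 : Type := EuclideanSpace ℝ (Fin 3)

/-- Hyperbolic three-space in the projective (Klein) model, the open unit ball: geodesics are the
straight segments, half-spaces are the traces of the Euclidean half-spaces. -/
def hyperbolicSpace3 : Set Space3 := Metric.ball 0 1

/-- The space of closed half-spaces of Euclidean three-space, as the product of the unit sphere
(outer unit normals) and the line (offsets). -/
abbrev HalfSpace : Type := Metric.sphere (0 : Space3) 1 × ℝ

namespace HalfSpace

/-- The points of a half-space. -/
def carrier (H : HalfSpace) : Set Space3 := {x | inner ℝ (H.1 : Space3) x ≤ H.2}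

/-- The plane bounding a half-space. -/
def boundaryPlane (H : HalfSpace) : Set Space3 := {x | inner ℝ (H.1 : Space3) x = H.2}

end HalfSpace

/-- The coordinates of a family of half-spaces in a vector space. They embed the manifold of
families of half-spaces (a power of `S² × ℝ`) as a closed smooth submanifold, so that a map into
that manifold is a smooth embedding if and only if it is one in these coordinates. -/
def halfSpaceCoords {F : Type*} (T : F → HalfSpace) : F → Space3 × ℝ :=
  fun f => ((T f).1, (T f).2)

/-- The intersection, in hyperbolic space, of a family of half-spaces. -/
def polyhedron {F : Type*} (T : F → HalfSpace) : Set Space3 :=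
  hyperbolicSpace3 ∩ ⋂ f, (T f).carrier

/-- The segment joining `x` and `y` is an edge of the polyhedron `P`, that is, a one-dimensional
face. -/
def IsPolyhedronEdge (P : Set Space3) (x y : Space3) : Prop :=
  x ≠ y ∧ IsExtreme ℝ P (segment ℝ x y)

/-- `Q` is a proper face of the polyhedron `P`. -/
def IsProperFace (P Q : Set Space3) : Prop :=
  Q ≠ P ∧ Convex ℝ Q ∧ IsExtreme ℝ P Q

/-- `φ` identifies the graph `G` with the 1-skeleton of `P`. -/
structure IsOneSkeleton {V : Type*} (G : SimpleGraph V) (P : Set Space3) (φ : V → Space3) :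
    Prop where
  vertices : Set.BijOn φ Set.univ (P.extremePoints ℝ)
  edges : ∀ a b, G.Adj a b ↔ IsPolyhedronEdge P (φ a) (φ b)

/-- `φ` shows that `P` has weak 1-skeleton `(G, e)`, where `e` is the edge joining `u` and `w`:
vertices correspond to vertices, edges other than `e` correspond to edges, and `e` is sent into a
face. -/
structure IsWeakOneSkeleton {V : Type*} (G : SimpleGraph V) (u w : V) (P : Set Space3)
    (φ : V → Space3) : Prop where
  vertices : Set.BijOn φ Set.univ (P.extremePoints ℝ)
  edges : ∀ a b, s(a, b) ≠ s(u, w) → (G.Adj a b ↔ IsPolyhedronEdge P (φ a) (φ b))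
  chord : ∃ Q, IsProperFace P Q ∧ segment ℝ (φ u) (φ w) ⊆ Q

/-- The space of compact hyperbolic polyhedra with 1-skeleton the plane graph `G`, as a subset of
the families of half-spaces indexed by the faces of `G`: the half-space labelled by a face is the
one supporting the polyhedron along that face. -/
def polyhedronSpace {V : Type*} {G : SimpleGraph V} (M : RotationSystem G) :
    Set (M.Face → HalfSpace) :=
  {T | IsCompact (polyhedron T) ∧ ∃ φ : V → Space3, IsOneSkeleton G (polyhedron T) φ ∧
    ∀ f, ∀ v ∈ M.faceVerts f, φ v ∈ (T f).boundaryPlane}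

/-- The space of compact hyperbolic polyhedra with weak 1-skeleton `(G, e)`, where `e` joins `u`
and `w`, as a subset of the families of half-spaces indexed by the faces of `G`. -/
def weakPolyhedronSpace {V : Type*} {G : SimpleGraph V} (M : RotationSystem G) (u w : V) :
    Set (M.Face → HalfSpace) :=
  {T | IsCompact (polyhedron T) ∧ ∃ φ : V → Space3, IsWeakOneSkeleton G u w (polyhedron T) φ ∧
    ∀ f, ∀ v ∈ M.faceVerts f, φ v ∈ (T f).boundaryPlane}

/-! ### Smooth submanifolds -/

/-- With the subspace topology, `S` carries a structure of smooth `n`-manifold (without boundary)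
for which its inclusion, read in the coordinates `ι`, is a smooth embedding. -/
def IsSmoothSubmanifold {X E : Type*} [TopologicalSpace X] [NormedAddCommGroup E]
    [NormedSpace ℝ E] (n : ℕ) (ι : X → E) (S : Set X) : Prop :=
  ∃ _ : ChartedSpace (EuclideanSpace ℝ (Fin n)) S,
    IsManifold (𝓡 n) ∞ S ∧
    Manifold.IsSmoothEmbedding (𝓡 n) 𝓘(ℝ, E) ∞ (fun x : S => ι x)

/-- With the subspace topology, `S` carries a structure of smooth `n`-manifold with boundary for
which its inclusion, read in the coordinates `ι`, is a smooth embedding, and whose interior and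
boundary are the sets `A` and `B`. -/
def IsSmoothSubmanifoldWithBoundary {X E : Type*} [TopologicalSpace X] [NormedAddCommGroup E]
    [NormedSpace ℝ E] (n : ℕ) [NeZero n] (ι : X → E) (S A B : Set X) : Prop :=
  ∃ _ : ChartedSpace (EuclideanHalfSpace n) S,
    IsManifold (𝓡∂ n) ∞ S ∧
    Manifold.IsSmoothEmbedding (𝓡∂ n) 𝓘(ℝ, E) ∞ (fun x : S => ι x) ∧
    Subtype.val '' (𝓡∂ n).interior S = A ∧
    Subtype.val '' (𝓡∂ n).boundary S = B

/-! Describe a polyhedron by its planes (unit normals `n_f`, offsets `h_f`) together with its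
vertices `φ_v`. They satisfy |n_f|² = 1 and ⟨n_f, φ_v⟩ = h_f for every incident pair (v, f). The
other requirements are open: a vertex not on f lies strictly inside the half-space of f, and all
vertices lie in the unit ball. Conversely, a solution meeting these open conditions bounds a compact
polyhedron with the prescribed skeleton (`IsExactIncidence.mem_polyhedronSpace`). The normals at a
vertex span space, so the planes determine the vertices, and the solution set projects to the space
of planes without loss. The space of polyhedra is therefore a submanifold as soon as the equations
are independent.

Independence is the main point. A linear relation among the differentials is a stress: coefficients
on incident pairs balancing the normals at each vertex, and the points (affinely) on each face.
Three normals at a vertex are independent, and so are three vertices affinely. Hence each vertex in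
the support of a stress carries at least four of its incidences, and so does each face. Sweeping a
plane across the polyhedron shows that a set A of at least two vertices and a set B of faces have at
most 2#A + 2#B - 4 incidences, which excludes a nonzero stress
(`IsExactIncidence.eq_zero_of_stress`).

A weak polyhedron either has the chord as an edge, or is a polyhedron for the smaller graph whose
cut face is labelled twice (`weakPolyhedronSpace_addChord`). At a point of the second kind let f₁,
f₂ be the two sides of the chord uw and z the neighbour of u on f₂. The system for the larger graph,
even with the extra incidence (z, f₁), is still free of stresses: merging f₁ and f₂ gives a stress
of the smaller graph, which vanishes, and what remains lives on u, w, z (`stressFree_insert`). Hence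
the solutions form a manifold on which g = h_{f₁} - ⟨n_{f₁}, φ_z⟩ is a coordinate. Nearby, g > 0
means that the planes of f₁ and f₂ fold convexly along the chord, g = 0 that they coincide, and g <
0 that the fold is not convex. So g ≥ 0 cuts out the weak space, with boundary g = 0. -/

section

/-! ### Submanifold structures from ambient slice charts -/

section SliceCharts

open Set Topology

variable {X E EM F H : Type*} [TopologicalSpace X] [NormedAddCommGroup E] [NormedSpace ℝ E]
  [NormedAddCommGroup EM] [NormedSpace ℝ EM] [NormedAddCommGroup F] [NormedSpace ℝ F]
  [TopologicalSpace H]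

/-- A chart of the ambient space `E` around `e` in which the set `S` becomes the model of `I`. -/
structure IsSliceChart (I : ModelWithCorners ℝ EM H) (S : Set E)
    (Ψ : OpenPartialHomeomorph E (EM × F)) (e : E) : Prop where
  mem_source : e ∈ Ψ.source
  contDiffOn : ContDiffOn ℝ ∞ Ψ Ψ.source
  contDiffOn_symm : ContDiffOn ℝ ∞ Ψ.symm Ψ.target
  mem_iff : ∀ y ∈ Ψ.source, y ∈ S ↔ (Ψ y).1 ∈ range I ∧ (Ψ y).2 = 0

namespace IsSliceChart

variable {I : ModelWithCorners ℝ EM H} {ι : X → E} {S : Set X}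
  {Ψ Ψ' : OpenPartialHomeomorph E (EM × F)} {x x' : S}

omit [TopologicalSpace X] in
theorem exists_preimage (h : IsSliceChart I (ι '' S) Ψ (ι x)) {a : H} (ha : (I a, 0) ∈ Ψ.target) :
    ∃ y : S, ι y = Ψ.symm (I a, 0) := by
  have := (h.mem_iff _ (Ψ.map_target ha)).2 (by rw [Ψ.right_inv ha]; simp)
  obtain ⟨y, hy, hy'⟩ := this
  exact ⟨⟨y, hy⟩, hy'⟩

open Classical in
/-- The chart of `S` induced by a slice chart of the ambient space. -/
noncomputable def chart (h : IsSliceChart I (ι '' S) Ψ (ι x)) (hι : IsEmbedding ι) :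
    OpenPartialHomeomorph S H where
  toFun y := I.symm (Ψ (ι y)).1
  -- Outside the target the value does not matter; `x` is a default.
  invFun a := if ha : (I a, 0) ∈ Ψ.target then (h.exists_preimage ha).choose else x
  source := {y | ι y ∈ Ψ.source}
  target := {a | (I a, 0) ∈ Ψ.target}
  map_source' y hy := by
    obtain ⟨h1, h2⟩ := (h.mem_iff _ hy).1 (mem_image_of_mem _ y.2)
    have : ((Ψ (ι y)).1, (0 : F)) = Ψ (ι y) := Prod.ext rfl h2.symm
    simp only [mem_ofPred_eq, I.right_inv h1, this]
    exact Ψ.map_source hy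
  map_target' a ha := by
    simp only [mem_ofPred_eq] at ha ⊢
    rw [dif_pos ha, (h.exists_preimage ha).choose_spec]
    exact Ψ.map_target ha
  left_inv' y hy := by
    obtain ⟨h1, h2⟩ := (h.mem_iff _ hy).1 (mem_image_of_mem _ y.2)
    have e : ((Ψ (ι y)).1, (0 : F)) = Ψ (ι y) := Prod.ext rfl h2.symm
    have ha : (I (I.symm (Ψ (ι y)).1), 0) ∈ Ψ.target := by
      rw [I.right_inv h1, e]; exact Ψ.map_source hy
    rw [dif_pos ha]
    apply Subtype.ext
    apply hι.injective
    rw [(h.exists_preimage ha).choose_spec, I.right_inv h1, e, Ψ.left_inv hy]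
  right_inv' a ha := by
    simp only [mem_ofPred_eq] at ha
    rw [dif_pos ha, (h.exists_preimage ha).choose_spec, Ψ.right_inv ha, I.left_inv]
  open_source := Ψ.open_source.preimage (hι.continuous.comp continuous_subtype_val)
  open_target := Ψ.open_target.preimage (I.continuous.prodMk continuous_const)
  continuousOn_toFun := by
    refine I.continuous_symm.comp_continuousOn (continuous_fst.comp_continuousOn ?_)
    exact Ψ.continuousOn.comp (hι.continuous.comp continuous_subtype_val).continuousOn
      fun _ h => h
  continuousOn_invFun := by
    have hind := (hι.comp IsEmbedding.subtypeVal (X := S)).isInducing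
    rw [hind.continuousOn_iff]
    have : ContinuousOn (fun a : H => Ψ.symm (I a, 0)) {a | (I a, 0) ∈ Ψ.target} :=
      Ψ.continuousOn_symm.comp (I.continuous.prodMk continuous_const).continuousOn fun _ h => h
    refine this.congr fun a ha => ?_
    simp only [mem_ofPred_eq] at ha
    simp only [Function.comp_apply, dif_pos ha, (h.exists_preimage ha).choose_spec]

theorem chart_apply (h : IsSliceChart I (ι '' S) Ψ (ι x)) (hι : IsEmbedding ι) (y : S) :
    h.chart hι y = I.symm (Ψ (ι y)).1 := rfl

theorem chart_symm_apply (h : IsSliceChart I (ι '' S) Ψ (ι x)) (hι : IsEmbedding ι) {a : H}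
    (ha : (I a, 0) ∈ Ψ.target) : ι ((h.chart hι).symm a) = Ψ.symm (I a, 0) := by
  classical
  change ι ((if ha : (I a, 0) ∈ Ψ.target then (h.exists_preimage ha).choose else x : S) : X) = _
  rw [dif_pos ha, (h.exists_preimage ha).choose_spec]

theorem model_chart_apply (h : IsSliceChart I (ι '' S) Ψ (ι x)) (hι : IsEmbedding ι) {y : S}
    (hy : ι y ∈ Ψ.source) : I (h.chart hι y) = (Ψ (ι y)).1 := by
  rw [chart_apply, I.right_inv ((h.mem_iff _ hy).1 (mem_image_of_mem _ y.2)).1]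

/-- A change of charts is z ↦ (Ψ' (Ψ⁻¹ (z, 0))).1, the restriction of a smooth map between open sets
of the ambient models. This gives smoothness at boundary points of `range I` as well. -/
theorem contDiffOn_transition (h : IsSliceChart I (ι '' S) Ψ (ι x))
    (h' : IsSliceChart I (ι '' S) Ψ' (ι x')) (hι : IsEmbedding ι) :
    ContDiffOn ℝ ∞ (I ∘ ((h.chart hι).symm ≫ₕ h'.chart hι) ∘ I.symm)
      (I.symm ⁻¹' ((h.chart hι).symm ≫ₕ h'.chart hι).source ∩ range I) := by
  have key : ∀ z ∈ I.symm ⁻¹' ((h.chart hι).symm ≫ₕ h'.chart hι).source ∩ range I,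
      (z, 0) ∈ Ψ.target ∧ Ψ.symm (z, 0) ∈ Ψ'.source ∧
      ι ((h.chart hι).symm (I.symm z)) = Ψ.symm (z, 0) := by
    rintro z ⟨hz, hzr⟩
    rw [mem_preimage, OpenPartialHomeomorph.trans_source] at hz
    obtain ⟨h1, h2⟩ := hz
    have h1' : (I (I.symm z), 0) ∈ Ψ.target := h1
    have e := h.chart_symm_apply hι h1'
    rw [I.right_inv hzr] at h1' e
    refine ⟨h1', ?_, e⟩
    rw [← e]; exact h2
  have : ContDiffOn ℝ ∞ (fun z : EM => (Ψ' (Ψ.symm (z, 0))).1)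
      (I.symm ⁻¹' ((h.chart hι).symm ≫ₕ h'.chart hι).source ∩ range I) := by
    refine contDiff_fst.comp_contDiffOn (h'.contDiffOn.comp (h.contDiffOn_symm.comp ?_ ?_) ?_)
    · exact (contDiff_id.prodMk contDiff_const).contDiffOn
    · exact fun z hz => (key z hz).1
    · exact fun z hz => (key z hz).2.1
  refine this.congr fun z hz => ?_
  obtain ⟨-, k2, k3⟩ := key z hz
  change I (h'.chart hι ((h.chart hι).symm (I.symm z))) = _
  rw [h'.model_chart_apply hι (by rw [k3]; exact k2), k3]

end IsSliceChart

/-- A subset with slice charts around all of its points is a smoothly embedded submanifold, whose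
charts are the restrictions of the slice charts. -/
theorem exists_chartedSpace_of_isSliceChart (I : ModelWithCorners ℝ EM H) {ι : X → E}
    (hι : IsEmbedding ι) (S : Set X)
    (L : (EM × F) ≃L[ℝ] E) (Ψ : S → OpenPartialHomeomorph E (EM × F))
    (hΨ : ∀ x : S, IsSliceChart I (ι '' S) (Ψ x) (ι x)) :
    ∃ _ : ChartedSpace H S, IsManifold I ∞ S ∧
      Manifold.IsSmoothEmbedding I 𝓘(ℝ, E) ∞ (fun x : S => ι x) ∧
      ∀ x : S, extChartAt I x x = (Ψ x (ι x)).1 := by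
  let C : ChartedSpace H S :=
    { atlas := range fun x : S => (hΨ x).chart hι
      chartAt := fun x => (hΨ x).chart hι
      mem_chart_source := fun x => (hΨ x).mem_source
      chart_mem_atlas := fun x => mem_range_self x }
  have hM : IsManifold I ∞ S := by
    apply isManifold_of_contDiffOn
    rintro _ _ ⟨x, rfl⟩ ⟨x', rfl⟩
    exact (hΨ x).contDiffOn_transition (hΨ x') hι
  refine ⟨C, hM, ⟨?_, hι.comp IsEmbedding.subtypeVal⟩, fun x => ?_⟩
  · refine Manifold.IsImmersionOfComplement.isImmersion (F := F) fun x => ?_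
    -- Between the induced chart and the slice chart followed by `L`, the inclusion reads z ↦ L (z,
    -- 0), which is the normal form of an immersion.
    refine Manifold.IsImmersionAtOfComplement.mk_of_charts L (chartAt H x)
      ((Ψ x).trans L.toHomeomorph.toOpenPartialHomeomorph) (mem_chart_source H x) ?_
      (IsManifold.chart_mem_maximalAtlas x) ?_ ?_ ?_
    · simpa using (hΨ x).mem_source
    · apply StructureGroupoid.mem_maximalAtlas_of_mem_groupoid
      rw [contDiffGroupoid, mem_groupoid_of_pregroupoid]
      constructor
      · simp only [contDiffPregroupoid, modelWithCornersSelf_coe, modelWithCornersSelf_coe_symm,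
          Function.comp_def, id]
        refine (L.contDiff.comp_contDiffOn (hΨ x).contDiffOn).mono ?_
        simp
      · simp only [contDiffPregroupoid, modelWithCornersSelf_coe, modelWithCornersSelf_coe_symm,
          Function.comp_def, id]
        refine ((hΨ x).contDiffOn_symm.comp L.symm.contDiff.contDiffOn
          (s := L.symm ⁻¹' (Ψ x).target) fun _ h => h).mono ?_
        intro y hy
        simpa using hy
    · intro y hy
      have : ι y ∈ (Ψ x).source := hy
      simpa using this
    · intro z hz
      rw [OpenPartialHomeomorph.extend_target] at hz
      obtain ⟨h1, h2⟩ := hz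
      have h1' : (I (I.symm z), 0) ∈ (Ψ x).target := h1
      have e := (hΨ x).chart_symm_apply hι h1'
      rw [I.right_inv h2] at e h1'
      change L (Ψ x (ι (((hΨ x).chart hι).symm (I.symm z)))) = L (z, 0)
      rw [e, (Ψ x).right_inv h1']
  · exact (hΨ x).model_chart_apply hι (hΨ x).mem_source

end SliceCharts

end

section

/-! ### Slice charts from submersions -/

section SliceConstruction

open Set Topology Module

/-- The smooth inverse function theorem, with smoothness on a neighbourhood. -/
theorem ContDiffOn.exists_openPartialHomeomorph {E F : Type*} [NormedAddCommGroup E]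
    [NormedSpace ℝ E] [CompleteSpace E] [NormedAddCommGroup F] [NormedSpace ℝ F] {f : E → F}
    {U : Set E} {x : E} (hf : ContDiffOn ℝ ∞ f U) (hU : IsOpen U) (hx : x ∈ U) (f' : E ≃L[ℝ] F)
    (hf' : HasFDerivAt f (f' : E →L[ℝ] F) x) :
    ∃ Ψ : OpenPartialHomeomorph E F, x ∈ Ψ.source ∧ Ψ.source ⊆ U ∧ ⇑Ψ = f ∧
      ContDiffOn ℝ ∞ Ψ.symm Ψ.target := by
  have hfx : ContDiffAt ℝ ∞ f x := hf.contDiffAt (hU.mem_nhds hx)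
  let Ψ₀ := hfx.toOpenPartialHomeomorph f hf' (by simp)
  -- Invertibility of the derivative is an open condition. Restricting to the points where it holds
  -- makes the inverse smooth on its whole domain and not only at the image of `x`.
  let U' : Set E := U ∩ fderiv ℝ f ⁻¹' range ((↑) : (E ≃L[ℝ] F) → E →L[ℝ] F)
  have hU' : IsOpen U' :=
    (hf.continuousOn_fderiv_of_isOpen hU (by simp)).isOpen_inter_preimage hU
      ContinuousLinearEquiv.isOpen
  refine ⟨Ψ₀.restr U', ?_, ?_, rfl, ?_⟩
  · rw [OpenPartialHomeomorph.restr_source, hU'.interior_eq]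
    exact ⟨hfx.mem_toOpenPartialHomeomorph_source hf' (by simp), hx, by
      rw [mem_preimage, hf'.fderiv]; exact mem_range_self _⟩
  · rw [OpenPartialHomeomorph.restr_source, hU'.interior_eq]
    exact fun y hy => hy.2.1
  · intro y hy
    have hs := (Ψ₀.restr U').map_target hy
    rw [OpenPartialHomeomorph.restr_source, hU'.interior_eq] at hs
    obtain ⟨-, h1, e, he⟩ := hs
    have hc : ContDiffAt ℝ ∞ f ((Ψ₀.restr U').symm y) := hf.contDiffAt (hU.mem_nhds h1)
    refine ((Ψ₀.restr U').contDiffAt_symm hy (f₀' := e) ?_ hc).contDiffWithinAt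
    rw [he]
    exact (hc.differentiableAt (by simp)).hasFDerivAt

/-- A nonzero functional is the first coordinate of an injective linear map. -/
theorem LinearMap.exists_injective_euclidean_apply_zero {V : Type*} [AddCommGroup V] [Module ℝ V]
    [FiniteDimensional ℝ V] {n : ℕ} (hV : finrank ℝ V = n + 1) (l : V →ₗ[ℝ] ℝ) (hl : l ≠ 0) :
    ∃ B : V →ₗ[ℝ] EuclideanSpace ℝ (Fin (n + 1)), Function.Injective B ∧ ∀ v, B v 0 = l v := by
  have hk : finrank ℝ (LinearMap.ker l) = n := by
    have := l.finrank_range_add_finrank_ker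
    rw [LinearMap.range_eq_top.2 (LinearMap.surjective_of_ne_zero hl), finrank_top, hV] at this
    simp at this; omega
  -- `C` retracts `V` onto the kernel of `l`, so that v ↦ (l v, C v) is injective.
  obtain ⟨C, hC⟩ := LinearMap.exists_leftInverse_of_injective (LinearMap.ker l).subtype
    (Submodule.ker_subtype _)
  let c : LinearMap.ker l ≃ₗ[ℝ] (Fin n → ℝ) := LinearEquiv.ofFinrankEq _ _ (by simp [hk])
  let B₀ : V →ₗ[ℝ] (Fin (n + 1) → ℝ) :=
    LinearMap.pi (Fin.cons l fun i => LinearMap.proj i ∘ₗ c.toLinearMap ∘ₗ C)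
  refine ⟨(WithLp.linearEquiv 2 ℝ (Fin (n + 1) → ℝ)).symm.toLinearMap ∘ₗ B₀, ?_, fun v => ?_⟩
  · rw [injective_iff_map_eq_zero]
    intro v hv
    have h : ∀ i, B₀ v i = 0 := fun i => by
      have := congrArg (fun w : EuclideanSpace ℝ (Fin (n + 1)) => w i) hv
      simpa using this
    have h0 : l v = 0 := by simpa [B₀] using h 0
    have h1 : c (C v) = 0 := by
      ext i
      simpa [B₀] using h i.succ
    have h2 : C v = 0 := by simpa using h1
    have h3 := LinearMap.congr_fun hC ⟨v, h0⟩
    simp only [LinearMap.comp_apply, Submodule.subtype_apply, LinearMap.id_apply] at h3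
    rw [h2] at h3
    exact (congrArg Subtype.val h3).symm
  · simp [B₀]

variable {E W Z : Type*} [NormedAddCommGroup E] [NormedSpace ℝ E] [FiniteDimensional ℝ E]
  [NormedAddCommGroup W] [NormedSpace ℝ W] [FiniteDimensional ℝ W]
  [NormedAddCommGroup Z] [NormedSpace ℝ Z] [FiniteDimensional ℝ Z]

/-- Coordinates on `E` in which the projection to `E` of the solutions of `Θ = 0` in `E × W` is a
linear subspace, when `Θ` is a submersion whose differential is injective on the fibres. -/
theorem exists_slice_of_submersion {n k : ℕ} (hdim : finrank ℝ E + finrank ℝ W = n + 1 + finrank ℝ Z)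
    (hk : finrank ℝ E = n + 1 + k) {Θ : E × W → Z} (hΘ : ContDiff ℝ ∞ Θ) {y₀ : E × W}
    (h0 : Θ y₀ = 0) (hsurj : Function.Surjective (fderiv ℝ Θ y₀))
    (hvert : ∀ w, fderiv ℝ Θ y₀ (0, w) = 0 → w = 0) {g : E × W → ℝ} (hg : ContDiff ℝ ∞ g)
    (hgn : ∃ y, fderiv ℝ Θ y₀ y = 0 ∧ fderiv ℝ g y₀ y ≠ 0) :
    ∃ (Ψ : OpenPartialHomeomorph E (EuclideanSpace ℝ (Fin (n + 1)) × EuclideanSpace ℝ (Fin k)))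
      (Φ : E → W), y₀.1 ∈ Ψ.source ∧ ContDiffOn ℝ ∞ Ψ Ψ.source ∧
        ContDiffOn ℝ ∞ Ψ.symm Ψ.target ∧ ContinuousAt Φ y₀.1 ∧ Φ y₀.1 = y₀.2 ∧
        (∀ e ∈ Ψ.source, (Ψ e).1 0 = g (e, Φ e)) ∧
        (∀ e ∈ Ψ.source, (Ψ e).2 = 0 ↔ Θ (e, Φ e) = 0) ∧
        ∀ᶠ y in 𝓝 y₀, Θ y = 0 → y.2 = Φ y.1 := by
  set D := fderiv ℝ Θ y₀ with hD
  have hDΘ : HasFDerivAt Θ D y₀ := (hΘ.differentiable (by simp) y₀).hasFDerivAt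
  have hDg : HasFDerivAt g (fderiv ℝ g y₀) y₀ := (hg.differentiable (by simp) y₀).hasFDerivAt
  -- splitting of `Z` along the vertical directions
  let DW : W →ₗ[ℝ] Z := D.toLinearMap ∘ₗ LinearMap.inr ℝ E W
  obtain ⟨r₀, hr₀⟩ := LinearMap.exists_leftInverse_of_injective DW
    (LinearMap.ker_eq_bot'.2 fun w hw => hvert w hw)
  have hr₀' : ∀ w, r₀ (D (0, w)) = w := fun w => LinearMap.congr_fun hr₀ w
  have hNdim : finrank ℝ (LinearMap.ker r₀) = k := by
    have h1 := r₀.finrank_range_add_finrank_ker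
    rw [LinearMap.range_eq_top.2 (fun w => ⟨_, hr₀' w⟩), finrank_top] at h1
    omega
  let L : LinearMap.ker r₀ ≃ₗ[ℝ] EuclideanSpace ℝ (Fin k) :=
    LinearEquiv.ofFinrankEq _ _ (by simp [hNdim])
  -- `q₀` is the projection along the vertical image onto the complement `ker r₀`, of dimension dim
  -- Z - dim W = k. The pair (`r₀`, `q₀`) is jointly injective: `r₀` serves to solve for the
  -- `W`-coordinate, and `q₀` keeps the equations that remain on `E`.
  let q₀ : Z →ₗ[ℝ] EuclideanSpace ℝ (Fin k) := L.toLinearMap ∘ₗ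
    LinearMap.codRestrict (LinearMap.ker r₀) (LinearMap.id - DW ∘ₗ r₀) (fun z => by
      have := hr₀' (r₀ z)
      simp [DW, this])
  have hq₀ : ∀ z, r₀ z = 0 → q₀ z = 0 → z = 0 := by
    intro z hz hqz
    have h1 : (⟨z - DW (r₀ z), _⟩ : LinearMap.ker r₀) = 0 := (LinearEquiv.map_eq_zero_iff L).1 hqz
    have h2 := congrArg Subtype.val h1
    simpa [hz] using h2
  let r : Z →L[ℝ] W := LinearMap.toContinuousLinearMap r₀
  let q : Z →L[ℝ] EuclideanSpace ℝ (Fin k) := LinearMap.toContinuousLinearMap q₀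
  have hr' : ∀ w, r (D (0, w)) = w := hr₀'
  have hrq : ∀ z, r z = 0 → q z = 0 → z = 0 := hq₀
  -- solving for the vertical coordinate
  let f₁ : E × W → E × W := fun y => (y.1, r (Θ y))
  have hf₁ : ContDiff ℝ ∞ f₁ := contDiff_fst.prodMk (r.contDiff.comp hΘ)
  let f₁' : E × W →L[ℝ] E × W := (ContinuousLinearMap.fst ℝ E W).prod (r.comp D)
  have hf₁' : HasFDerivAt f₁ f₁' y₀ := hasFDerivAt_fst.prodMk (r.hasFDerivAt.comp y₀ hDΘ)
  have hinj₁ : Function.Injective f₁'.toLinearMap := by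
    rw [injective_iff_map_eq_zero]
    rintro ⟨a, b⟩ h
    have h1 : a = 0 := congrArg Prod.fst h
    have h2 : r (D (a, b)) = 0 := congrArg Prod.snd h
    subst h1
    rw [hr'] at h2
    rw [h2]; rfl
  obtain ⟨Ψ₁, hΨ₁s, -, hΨ₁, hΨ₁c⟩ := hf₁.contDiffOn.exists_openPartialHomeomorph isOpen_univ
    (mem_univ y₀) (LinearEquiv.ofInjectiveEndo f₁'.toLinearMap hinj₁).toContinuousLinearEquiv
    (hf₁'.congr_fderiv (ContinuousLinearMap.ext fun _ => rfl))
  have hΨ₁0 : Ψ₁ y₀ = (y₀.1, 0) := by simp [hΨ₁, f₁, h0]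
  let O : Set E := (fun e => (e, (0 : W))) ⁻¹' Ψ₁.target
  have hO : IsOpen O := Ψ₁.open_target.preimage (by fun_prop)
  have hO0 : y₀.1 ∈ O := by
    change (y₀.1, (0 : W)) ∈ Ψ₁.target
    rw [← hΨ₁0]; exact Ψ₁.map_source hΨ₁s
  let Φ : E → W := fun e => (Ψ₁.symm (e, 0)).2
  have hΦc : ContDiffOn ℝ ∞ Φ O := contDiff_snd.comp_contDiffOn
    (hΨ₁c.comp (by fun_prop : ContDiff ℝ ∞ fun e : E => (e, (0 : W))).contDiffOn fun _ h => h)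
  have hΦ : ∀ e ∈ O, Ψ₁.symm (e, 0) = (e, Φ e) ∧ r (Θ (e, Φ e)) = 0 := by
    intro e he
    have h1 : f₁ (Ψ₁.symm (e, 0)) = (e, 0) := by rw [← hΨ₁]; exact Ψ₁.right_inv he
    have h2 : Ψ₁.symm (e, 0) = (e, Φ e) := Prod.ext (congrArg Prod.fst h1 :) rfl
    exact ⟨h2, by rw [← h2]; exact congrArg Prod.snd h1⟩
  have hΦ0 : Φ y₀.1 = y₀.2 := by
    change (Ψ₁.symm (y₀.1, 0)).2 = _
    rw [← hΨ₁0, Ψ₁.left_inv hΨ₁s]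
  have hy₀ : (y₀.1, Φ y₀.1) = y₀ := by rw [hΦ0]
  have hΦd := ((hΦc.contDiffAt (hO.mem_nhds hO0)).differentiableAt (by simp)).hasFDerivAt
  set Φ' := fderiv ℝ Φ y₀.1
  let s' : E →L[ℝ] E × W := (ContinuousLinearMap.id ℝ E).prod Φ'
  have hs' : HasFDerivAt (fun e => (e, Φ e)) s' y₀.1 := (hasFDerivAt_id _).prodMk hΦd
  have hΘs : HasFDerivAt (fun e => Θ (e, Φ e)) (D.comp s') y₀.1 := by
    refine HasFDerivAt.comp y₀.1 (g := Θ) ?_ hs'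
    rw [hy₀]; exact hDΘ
  -- Since r ∘ Θ vanishes along the graph of `Φ`, the derivative of e ↦ Θ (e, Φ e) has values in the
  -- kernel of `r` and is detected by `q` alone.
  have hrD : ∀ δ, r (D (s' δ)) = 0 := by
    intro δ
    have h1 : HasFDerivAt (fun e => r (Θ (e, Φ e))) (r.comp (D.comp s')) y₀.1 :=
      r.hasFDerivAt.comp y₀.1 hΘs
    have h2 : HasFDerivAt (fun e => r (Θ (e, Φ e))) (0 : E →L[ℝ] W) y₀.1 :=
      (hasFDerivAt_const (0 : W) y₀.1).congr_of_eventuallyEq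
        (by filter_upwards [hO.mem_nhds hO0] with e he using (hΦ e he).2)
    exact DFunLike.congr_fun (h1.unique h2) δ
  -- coordinates along the solution set
  have hker : finrank ℝ (LinearMap.ker D.toLinearMap) = n + 1 := by
    have h1 := D.toLinearMap.finrank_range_add_finrank_ker
    rw [LinearMap.range_eq_top.2 hsurj, finrank_top, finrank_prod] at h1
    omega
  let l := (fderiv ℝ g y₀).toLinearMap ∘ₗ (LinearMap.ker D.toLinearMap).subtype
  have hl : l ≠ 0 := by
    obtain ⟨y, hy, hy'⟩ := hgn
    intro h
    exact hy' (LinearMap.congr_fun h ⟨y, hy⟩)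
  obtain ⟨B, hB, hB0⟩ := LinearMap.exists_injective_euclidean_apply_zero hker l hl
  obtain ⟨A₀, hA₀⟩ := B.exists_extend
  let A : E × W →L[ℝ] EuclideanSpace ℝ (Fin (n + 1)) := LinearMap.toContinuousLinearMap A₀
  have hA : ∀ (y) (hy : D y = 0), A y = B ⟨y, hy⟩ := fun y hy =>
    LinearMap.congr_fun hA₀ ⟨y, hy⟩
  let p₀ : EuclideanSpace ℝ (Fin (n + 1)) →L[ℝ] ℝ := EuclideanSpace.proj 0
  let e₀ : EuclideanSpace ℝ (Fin (n + 1)) := EuclideanSpace.single 0 1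
  -- The first coordinate of `A` is replaced by `g` itself. On `ker D` this leaves the derivative
  -- unchanged, because there the first coordinate of `A` is already the differential of `g`.
  let a : E × W → EuclideanSpace ℝ (Fin (n + 1)) := fun y => A y + (g y - p₀ (A y)) • e₀
  have ha0 : ∀ y, a y 0 = g y := fun y => by simp [a, e₀, p₀]
  have hac : ContDiff ℝ ∞ a :=
    A.contDiff.add ((hg.sub (p₀.contDiff.comp A.contDiff)).smul contDiff_const)
  let a' : E × W →L[ℝ] EuclideanSpace ℝ (Fin (n + 1)) :=
    A + (fderiv ℝ g y₀ - p₀.comp A).smulRight e₀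
  have ha' : HasFDerivAt a a' y₀ := by
    refine A.hasFDerivAt.add ?_
    exact (hDg.sub (p₀.hasFDerivAt.comp y₀ A.hasFDerivAt)).smul_const e₀
  have ha'k : ∀ y, D y = 0 → a' y = 0 → y = 0 := by
    intro y hy hay
    have h1 : p₀ (A y) = fderiv ℝ g y₀ y := by
      change A y 0 = _
      rw [hA y hy, hB0]; rfl
    have h2 : a' y = A y := by simp [a', h1]
    rw [h2, hA y hy] at hay
    exact congrArg Subtype.val ((injective_iff_map_eq_zero B).1 hB _ hay)
  -- the chart
  let f₂ : E → EuclideanSpace ℝ (Fin (n + 1)) × EuclideanSpace ℝ (Fin k) :=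
    fun e => (a (e, Φ e), q (Θ (e, Φ e)))
  have hsc : ContDiffOn ℝ ∞ (fun e => (e, Φ e)) O := contDiffOn_id.prodMk hΦc
  have hf₂ : ContDiffOn ℝ ∞ f₂ O :=
    (hac.comp_contDiffOn hsc).prodMk (q.contDiff.comp_contDiffOn (hΘ.comp_contDiffOn hsc))
  let f₂' : E →L[ℝ] EuclideanSpace ℝ (Fin (n + 1)) × EuclideanSpace ℝ (Fin k) :=
    (a'.comp s').prod (q.comp (D.comp s'))
  have hf₂' : HasFDerivAt f₂ f₂' y₀.1 := by
    refine HasFDerivAt.prodMk ?_ (q.hasFDerivAt.comp y₀.1 hΘs)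
    refine HasFDerivAt.comp y₀.1 (g := a) ?_ hs'
    rw [hy₀]; exact ha'
  have hinj₂ : Function.Injective f₂'.toLinearMap := by
    rw [injective_iff_map_eq_zero]
    intro δ h
    have h1 : a' (s' δ) = 0 := congrArg Prod.fst h
    have h2 : q (D (s' δ)) = 0 := congrArg Prod.snd h
    exact congrArg Prod.fst (ha'k _ (hrq _ (hrD δ) h2) h1)
  obtain ⟨Ψ, hΨs, hΨU, hΨ, hΨc⟩ := hf₂.exists_openPartialHomeomorph hO hO0
    (LinearMap.linearEquivOfInjective f₂'.toLinearMap hinj₂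
      (by simp [hk])).toContinuousLinearEquiv (hf₂'.congr_fderiv (ContinuousLinearMap.ext fun _ => rfl))
  refine ⟨Ψ, Φ, hΨs, ?_, hΨc, hΦd.continuousAt, hΦ0, ?_, ?_, ?_⟩
  · rw [hΨ]; exact hf₂.mono hΨU
  · intro e _
    rw [hΨ]; exact ha0 _
  · intro e he
    rw [hΨ]
    refine ⟨fun h => hrq _ (hΦ e (hΨU he)).2 h, fun h => ?_⟩
    change q (Θ (e, Φ e)) = 0
    rw [h, map_zero]
  · filter_upwards [Ψ₁.open_source.mem_nhds hΨ₁s] with y hy hΘy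
    have h1 : Ψ₁ y = (y.1, 0) := by simp [hΨ₁, f₁, hΘy]
    change y.2 = (Ψ₁.symm (y.1, 0)).2
    rw [← h1, Ψ₁.left_inv hy]

/-- A set which near a point is the projection of the solutions of `Θ = 0`, `g ∈ range I` has a
slice chart there, with first coordinate `g`. -/
theorem exists_isSliceChart_of_submersion {n k : ℕ} {H : Type*} [TopologicalSpace H]
    (I : ModelWithCorners ℝ (EuclideanSpace ℝ (Fin (n + 1))) H) (hI : Set ℝ)
    (hIr : ∀ y, y ∈ range I ↔ y 0 ∈ hI)
    (hdim : finrank ℝ E + finrank ℝ W = n + 1 + finrank ℝ Z)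
    (hk : finrank ℝ E = n + 1 + k) {Θ : E × W → Z} (hΘ : ContDiff ℝ ∞ Θ) {y₀ : E × W}
    (h0 : Θ y₀ = 0) (hsurj : Function.Surjective (fderiv ℝ Θ y₀))
    (hvert : ∀ w, fderiv ℝ Θ y₀ (0, w) = 0 → w = 0) {g : E × W → ℝ} (hg : ContDiff ℝ ∞ g)
    (hgn : ∃ y, fderiv ℝ Θ y₀ y = 0 ∧ fderiv ℝ g y₀ y ≠ 0)
    (S : Set E) {K : Set W} (hK : IsCompact K) (h1 : ∀ e ∈ S, ∃ w ∈ K, Θ (e, w) = 0)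
    (h2 : ∀ w ∈ K, Θ (y₀.1, w) = 0 → w = y₀.2)
    (h3 : ∀ᶠ y in 𝓝 y₀, Θ y = 0 → (y.1 ∈ S ↔ g y ∈ hI)) :
    ∃ Ψ : OpenPartialHomeomorph E (EuclideanSpace ℝ (Fin (n + 1)) × EuclideanSpace ℝ (Fin k)),
      IsSliceChart I S Ψ y₀.1 ∧ (Ψ y₀.1).1 0 = g y₀ := by
  obtain ⟨Ψ, Φ, m1, m2, m3, m4, m5, m6, m7, m8⟩ :=
    exists_slice_of_submersion hdim hk hΘ h0 hsurj hvert hg hgn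
  have hy₀ : (y₀.1, Φ y₀.1) = y₀ := by rw [m5]
  obtain ⟨N, hN, hNo, hN0⟩ := mem_nhds_iff.1 (h3.and m8)
  -- Compactness of `K` and uniqueness of the solution in `K` over `y₀.1` force every solution in
  -- `K` over a nearby point to be close to `y₀`. No distant sheet of solutions can contribute
  -- points of `S`.
  have hnear : ∀ᶠ e in 𝓝 y₀.1, ∀ w ∈ K, Θ (e, w) = 0 → (e, w) ∈ N := by
    refine hK.eventually_forall_of_forall_eventually fun w hw => ?_
    by_cases h : Θ (y₀.1, w) = 0
    · have hw' := h2 w hw h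
      have : (y₀.1, w) ∈ N := by rw [hw']; exact hN0
      filter_upwards [hNo.mem_nhds this] with z hz _ using hz
    · filter_upwards [(hΘ.continuous.continuousAt (x := (y₀.1, w))).eventually_ne h] with z hz h
      exact absurd h hz
  have hgraph : ∀ᶠ e in 𝓝 y₀.1, (e, Φ e) ∈ N := by
    have : ContinuousAt (fun e => (e, Φ e)) y₀.1 := continuousAt_id.prodMk m4
    refine this.eventually_mem (hNo.mem_nhds ?_)
    rw [hy₀]; exact hN0
  obtain ⟨U, hU, hUo, hU0⟩ := mem_nhds_iff.1 (hnear.and hgraph)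
  have hsrc : (Ψ.restr U).source = Ψ.source ∩ U := by
    rw [OpenPartialHomeomorph.restr_source, hUo.interior_eq]
  refine ⟨Ψ.restr U, ⟨?_, ?_, ?_, ?_⟩, ?_⟩
  · rw [hsrc]; exact ⟨m1, hU0⟩
  · rw [hsrc]; exact m2.mono inter_subset_left
  · refine m3.mono ?_
    intro z hz
    rw [OpenPartialHomeomorph.restr_target] at hz
    exact hz.1
  · intro e he
    rw [hsrc] at he
    obtain ⟨u1, u2⟩ := hU he.2
    change e ∈ S ↔ (Ψ e).1 ∈ range I ∧ (Ψ e).2 = 0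
    rw [hIr, m6 e he.1, m7 e he.1]
    constructor
    · intro heS
      obtain ⟨w, hw, hΘw⟩ := h1 e heS
      have hN1 := u1 w hw hΘw
      obtain ⟨v1, v2⟩ := hN hN1
      have hwe : w = Φ e := v2 hΘw
      subst hwe
      exact ⟨(v1 hΘw).1 heS, hΘw⟩
    · rintro ⟨hge, hΘe⟩
      exact ((hN u2).1 hΘe).2 hge
  · change (Ψ y₀.1).1 0 = _
    rw [m6 _ m1, hy₀]

end SliceConstruction

end

section

/-! ### Stresses of convex polyhedra -/

section Incidence

open Finset Module

/-- Among at most three nonzero numbers one of the two signs occurs at most once. Take `v` to be the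
index with that sign, or any index with a nonzero value if the sign does not occur. -/
theorem exists_sign_except_one {α : Type*} [Fintype α] {c : α → ℝ} (hc : c ≠ 0)
    (h3 : #{v | c v ≠ 0} ≤ 3) :
    ∃ v, c v ≠ 0 ∧ ((∀ x, x ≠ v → c x ≤ 0) ∨ ∀ x, x ≠ v → 0 ≤ c x) := by
  classical
  have hcard : #{v | 0 < c v} + #{v | c v < 0} ≤ 3 := by
    rw [← card_union_of_disjoint]
    · refine (card_le_card fun v hv => ?_).trans h3
      simp only [mem_union, mem_filter, mem_univ, true_and] at hv ⊢
      rcases hv with h | h <;> [exact h.ne'; exact h.ne]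
    · rw [disjoint_filter]
      intro v _ h; exact not_lt.2 h.le
  obtain ⟨w, hw⟩ := Function.ne_iff.1 hc
  have aux : ∀ d : α → ℝ, #{v | 0 < d v} ≤ 1 → d w ≠ 0 →
      ∃ v, d v ≠ 0 ∧ ∀ x, x ≠ v → d x ≤ 0 := by
    intro d hd hdw
    by_cases h : ∃ v, 0 < d v
    · obtain ⟨v, hv⟩ := h
      refine ⟨v, hv.ne', fun x hx => not_lt.1 fun hx' => hx ?_⟩
      exact card_le_one.1 hd x (by simpa using hx') v (by simpa using hv)
    · push Not at h
      exact ⟨w, hdw, fun x _ => h x⟩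
  by_cases h1 : #{v | 0 < c v} ≤ 1
  · obtain ⟨v, hv, h⟩ := aux c h1 hw
    exact ⟨v, hv, Or.inl h⟩
  · obtain ⟨v, hv, h⟩ := aux (-c) (by simp only [Pi.neg_apply, Left.neg_pos_iff]; omega)
      (by simpa using hw)
    exact ⟨v, by simpa using hv, Or.inr fun x hx => by simpa using h x hx⟩

/-- Three points of a convexly independent family are affinely independent. -/
theorem ConvexIndependent.eq_zero_of_card_le_three {V E : Type*} [Fintype V] [AddCommGroup E]
    [Module ℝ E] {φ : V → E} (hφ : ConvexIndependent ℝ φ) {c : V → ℝ} (h0 : ∑ v, c v = 0)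
    (h1 : ∑ v, c v • φ v = 0) (h3 : #{v | c v ≠ 0} ≤ 3) : c = 0 := by
  classical
  by_contra hc
  obtain ⟨v, hv, h⟩ := exists_sign_except_one hc h3
  have aux : ∀ d : V → ℝ, ∑ v, d v = 0 → ∑ v, d v • φ v = 0 → d v ≠ 0 →
      (∀ x, x ≠ v → d x ≤ 0) → False := by
    intro d d0 d1 dv dx
    rw [← add_sum_erase _ _ (mem_univ v)] at d0 d1
    have hpos : 0 < d v := by
      refine lt_of_le_of_ne ?_ dv.symm
      have : ∑ x ∈ univ.erase v, d x ≤ 0 := sum_nonpos fun x hx => dx x (ne_of_mem_erase hx)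
      linarith
    -- All other coefficients have the sign opposite to that of `d v`, so the affine relation writes
    -- `φ v` as a convex combination of the other points.
    have hmem : φ v ∈ convexHull ℝ (φ '' {x | x ≠ v}) := by
      have e : φ v = ∑ x ∈ univ.erase v, (-(d v)⁻¹ * d x) • φ x := by
        have : ∑ x ∈ univ.erase v, d x • φ x = -(d v • φ v) := by
          rw [eq_neg_iff_add_eq_zero, add_comm]; exact d1
        simp_rw [mul_smul]
        rw [← smul_sum, this, smul_neg, neg_smul, neg_neg, smul_smul, inv_mul_cancel₀ dv, one_smul]
      rw [e]
      refine (convex_convexHull ℝ _).sum_mem (fun x hx => ?_) ?_ fun x hx => ?_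
      · have := dx x (ne_of_mem_erase hx)
        have := inv_pos.2 hpos
        nlinarith
      · rw [← mul_sum, show ∑ x ∈ univ.erase v, d x = -d v by linarith]
        field_simp
      · exact subset_convexHull _ _ ⟨x, ne_of_mem_erase hx, rfl⟩
    exact hφ _ _ hmem rfl
  rcases h with h | h
  · exact aux c h0 h1 hv h
  · exact aux (-c) (by simp [h0]) (by simp [h1]) (by simpa using hv)
      fun x hx => by simpa using h x hx

/-- The points `φ v` lie in the half-spaces `⟪n, x⟫ ≤ h` given by the pairs `e f = (n, h)`, and on
their boundary exactly when `v` is incident to `f`. -/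
structure IsExactIncidence {V F : Type*} (inc : V → F → Prop) (e : F → Space3 × ℝ)
    (φ : V → Space3) : Prop where
  eq : ∀ v f, inc v f → inner ℝ (e f).1 (φ v) = (e f).2
  lt : ∀ v f, ¬ inc v f → inner ℝ (e f).1 (φ v) < (e f).2

namespace IsExactIncidence

variable {V F : Type*} {inc : V → F → Prop} {e : F → Space3 × ℝ} {φ : V → Space3}
  (h : IsExactIncidence inc e φ)
include h

theorem le (v : V) (f : F) : inner ℝ (e f).1 (φ v) ≤ (e f).2 := by
  by_cases hv : inc v f
  · exact (h.eq v f hv).le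
  · exact (h.lt v f hv).le

theorem inner_sub_eq {v x : V} {f : F} (hv : inc v f) (hx : inc x f) :
    inner ℝ (e f).1 (φ x - φ v) = 0 := by
  rw [inner_sub_right, h.eq v f hv, h.eq x f hx, sub_self]

theorem inner_sub_le {v x : V} {f : F} (hv : inc v f) : inner ℝ (e f).1 (φ x - φ v) ≤ 0 := by
  rw [inner_sub_right, h.eq v f hv, sub_nonpos]
  exact h.le x f

theorem inner_sub_lt {v x : V} {f : F} (hv : inc v f) (hx : ¬ inc x f) :
    inner ℝ (e f).1 (φ x - φ v) < 0 := by
  rw [inner_sub_right, h.eq v f hv, sub_neg]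
  exact h.lt x f hx

/-- Any three faces at a vertex have linearly independent normals. -/
theorem eq_zero_of_normals [Fintype V] [Fintype F] (hn : ∀ f, (e f).1 ≠ 0)
    (hsub : ∀ f g, f ≠ g → ∃ x, inc x f ∧ ¬ inc x g) {v : V} {c : F → ℝ}
    (hc : ∀ f, c f ≠ 0 → inc v f) (h0 : ∑ f, c f • (e f).1 = 0) (h3 : #{f | c f ≠ 0} ≤ 3) :
    c = 0 := by
  classical
  by_contra hc0
  obtain ⟨f, hf, hs⟩ := exists_sign_except_one hc0 h3
  have hvf := hc f hf
  -- `p` points from the vertex into the relative interior of the face `f`: it is orthogonal to the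
  -- normal of `f` and strictly negative on the other normals at `v`. Pairing the relation with `p`
  -- gives a zero sum of terms of one sign, which kills all coefficients except that of `f`.
  set p : Space3 := ∑ x with inc x f, (φ x - φ v) with hp
  have hpf : inner ℝ (e f).1 p = 0 := by
    rw [hp, inner_sum]
    exact sum_eq_zero fun x hx => h.inner_sub_eq hvf (mem_filter.1 hx).2
  have hpg : ∀ g, g ≠ f → inc v g → inner ℝ (e g).1 p < 0 := by
    intro g hg hvg
    rw [hp, inner_sum]
    obtain ⟨x, hx, hx'⟩ := hsub f g hg.symm
    exact sum_neg' (fun x _ => h.inner_sub_le hvg) ⟨x, by simpa using hx, h.inner_sub_lt hvg hx'⟩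
  have hsum : ∑ g, c g * inner ℝ (e g).1 p = 0 := by
    have := congrArg (fun z => inner ℝ z p) h0
    simpa [sum_inner, inner_smul_left] using this
  have hother : ∀ g, g ≠ f → c g = 0 := by
    have key : ∀ g, c g * inner ℝ (e g).1 p = 0 := by
      rcases hs with hs | hs
      · have := (sum_eq_zero_iff_of_nonneg (s := univ) (f := fun g => c g * inner ℝ (e g).1 p)
          fun g _ => ?_).1 hsum
        · simpa using this
        · by_cases hg : g = f
          · simp [hg, hpf]
          by_cases hcg : c g = 0
          · simp [hcg]
          · exact mul_nonneg_of_nonpos_of_nonpos (hs g hg) (hpg g hg (hc g hcg)).le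
      · have := (sum_eq_zero_iff_of_nonpos (s := univ) (f := fun g => c g * inner ℝ (e g).1 p)
          fun g _ => ?_).1 hsum
        · simpa using this
        · by_cases hg : g = f
          · simp [hg, hpf]
          by_cases hcg : c g = 0
          · simp [hcg]
          · exact mul_nonpos_of_nonneg_of_nonpos (hs g hg) (hpg g hg (hc g hcg)).le
    intro g hg
    by_contra hcg
    rcases mul_eq_zero.1 (key g) with h1 | h1
    · exact hcg h1
    · exact (hpg g hg (hc g hcg)).ne h1
  rw [sum_eq_single f (fun g _ hg => by rw [hother g hg, zero_smul]) (by simp)] at h0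
  exact (smul_ne_zero hf (hn f)) h0

end IsExactIncidence

/-- Pairing a relation among the three vectors with each `N j` shows that any two of its
coefficients have opposite signs or both vanish. Three numbers cannot have pairwise opposite signs,
so the vectors are independent, although they lie in the plane `ker l`. -/
theorem not_three_functionals {l : Space3 →ₗ[ℝ] ℝ} (hl : l ≠ 0) {u N : Fin 3 → Space3}
    (hu : ∀ i, l (u i) = 0) (h0 : ∀ i, inner ℝ (N i) (u i) = 0)
    (hneg : ∀ i j, i ≠ j → inner ℝ (N j) (u i) < 0) : False := by
  have hli : LinearIndependent ℝ (fun i => (⟨u i, hu i⟩ : LinearMap.ker l)) := by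
    apply LinearIndependent.of_comp (LinearMap.ker l).subtype
    rw [Fintype.linearIndependent_iff]
    intro g hg
    have key : ∀ j, g 0 * inner ℝ (N j) (u 0) + g 1 * inner ℝ (N j) (u 1) +
        g 2 * inner ℝ (N j) (u 2) = 0 := by
      intro j
      have := congrArg (fun z => inner ℝ (N j) z) hg
      simpa [Fin.sum_univ_three, inner_add_right, inner_smul_right] using this
    have k0 := key 0
    have k1 := key 1
    have k2 := key 2
    rw [h0, mul_zero, zero_add] at k0
    rw [h0, mul_zero, add_zero] at k1
    rw [h0, mul_zero, add_zero] at k2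
    have a01 := hneg 0 1 (by decide)
    have a02 := hneg 0 2 (by decide)
    have a10 := hneg 1 0 (by decide)
    have a12 := hneg 1 2 (by decide)
    have a20 := hneg 2 0 (by decide)
    have a21 := hneg 2 1 (by decide)
    have opp : ∀ {x y p q : ℝ}, p < 0 → q < 0 → x * p + y * q = 0 →
        (0 < x → y < 0) ∧ (x < 0 → 0 < y) ∧ (x = 0 → y = 0) := by
      intro x y p q hp hq hxy
      refine ⟨fun hx => ?_, fun hx => ?_, fun hx => ?_⟩
      · by_contra hy
        nlinarith
      · by_contra hy
        nlinarith
      · rw [hx, zero_mul, zero_add] at hxy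
        exact (mul_eq_zero.1 hxy).resolve_right hq.ne
    have o0 := opp a10 a20 k0
    have o1 := opp a01 a21 k1
    have o2 := opp a02 a12 k2
    have z0 : g 0 = 0 := by
      rcases lt_trichotomy (g 0) 0 with h | h | h
      · have := o0.1 (o2.2.1 h)
        have := o1.2.1 h
        linarith
      · exact h
      · have := o0.2.1 (o2.1 h)
        have := o1.1 h
        linarith
    intro i
    fin_cases i
    · exact z0
    · exact o2.2.2 z0
    · exact o1.2.2 z0
  have h1 := hli.fintype_card_le_finrank
  have h2 := l.finrank_range_add_finrank_ker
  rw [LinearMap.range_eq_top.2 (LinearMap.surjective_of_ne_zero hl), finrank_top] at h2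
  simp at h1 h2
  omega

/-- Finitely many nonzero differences can be avoided by one functional. It serves as the height
function of the sweep. -/
theorem exists_linear_injective_comp {V : Type*} [Finite V] {φ : V → Space3}
    (hφ : Function.Injective φ) : ∃ l : Space3 →ₗ[ℝ] ℝ, Function.Injective (l ∘ φ) := by
  obtain ⟨l, hl⟩ := Module.exists_dual_forall_apply_ne_zero (K := ℝ) (M := Space3)
    (fun p : {p : V × V // p.1 ≠ p.2} => φ p.1.1 - φ p.1.2)
    (fun p => sub_ne_zero.2 (hφ.ne p.2))
  refine ⟨l, fun a b hab => ?_⟩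
  by_contra hne
  have := hl ⟨(a, b), hne⟩
  rw [map_sub] at this
  exact this (sub_eq_zero.2 hab)

/-- Two faces have at most two common vertices. -/
def FacesMeetInPairs {V F : Type*} (inc : V → F → Prop) : Prop :=
  ∀ f g, f ≠ g → ∀ a b z, a ≠ b → inc a f → inc b f → inc z f → inc a g → inc b g → inc z g →
    z = a ∨ z = b

namespace IsExactIncidence

variable {V F : Type*} {inc : V → F → Prop} {e : F → Space3 × ℝ} {φ : V → Space3}

/-- Sweeping a plane across a vertex, at most two faces at that vertex are cut in their middle. -/
theorem card_middle_le_two (h : IsExactIncidence inc e φ) (h2 : FacesMeetInPairs inc)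
    {l : Space3 →ₗ[ℝ] ℝ} (B : Finset F) (v : V)
    (hB : ∀ f ∈ B, inc v f ∧ ∃ a b, inc a f ∧ inc b f ∧ l (φ a) < l (φ v) ∧ l (φ v) < l (φ b)) :
    #B ≤ 2 := by
  by_contra! hcard
  obtain ⟨f₀, hf₀, f₁, hf₁, f₂, hf₂, h01, h02, h12⟩ := two_lt_card.1 hcard
  let f : Fin 3 → F := ![f₀, f₁, f₂]
  have hfB : ∀ i, f i ∈ B := by intro i; fin_cases i <;> assumption
  have hfne : ∀ i j, i ≠ j → f i ≠ f j := by
    intro i j hij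
    fin_cases i <;> fin_cases j <;> simp_all [f, eq_comm]
  have hvf : ∀ i, inc v (f i) := fun i => (hB _ (hfB i)).1
  choose a b ha hb hav hvb using fun i => (hB _ (hfB i)).2
  have hl : l ≠ 0 := by
    rintro rfl
    exact lt_irrefl _ (hav 0)
  let p : Fin 3 → ℝ := fun i => l (φ (b i)) - l (φ v)
  let q : Fin 3 → ℝ := fun i => l (φ v) - l (φ (a i))
  have hp : ∀ i, 0 < p i := fun i => sub_pos.2 (hvb i)
  have hq : ∀ i, 0 < q i := fun i => sub_pos.2 (hav i)
  -- The i-th vector is the horizontal direction in the plane of `f i` from `v` to the chord joining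
  -- `a i` to `b i`. It is strictly negative on the normal of another face `f j`, since otherwise `a
  -- i`, `b i` and `v` would be three common vertices of the two faces.
  refine not_three_functionals hl (u := fun i => p i • (φ (a i) - φ v) + q i • (φ (b i) - φ v))
    (N := fun i => (e (f i)).1) (fun i => ?_) (fun i => ?_) fun i j hij => ?_
  · simp only [map_add, map_smul, map_sub, smul_eq_mul, p, q]
    ring
  · simp only [inner_add_right, inner_smul_right]
    rw [h.inner_sub_eq (hvf i) (ha i), h.inner_sub_eq (hvf i) (hb i)]
    simp
  · simp only [inner_add_right, inner_smul_right]
    have h1 := h.inner_sub_le (x := a i) (hvf j)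
    have h2' := h.inner_sub_le (x := b i) (hvf j)
    by_cases haj : inc (a i) (f j)
    · have hbj : ¬ inc (b i) (f j) := by
        intro hbj
        have hab : a i ≠ b i := fun hab => by
          have := (hav i).trans (hvb i)
          rw [hab] at this
          exact lt_irrefl _ this
        rcases h2 _ _ (hfne i j hij) (a i) (b i) v hab (ha i) (hb i) (hvf i) haj hbj (hvf j) with
          hv | hv
        · have := hav i
          rw [hv] at this
          exact lt_irrefl _ this
        · have := hvb i
          rw [hv] at this
          exact lt_irrefl _ this
      have h3 := h.inner_sub_lt (hvf j) hbj
      nlinarith [hp i, hq i, mul_nonneg (hp i).le (neg_nonneg.2 h1), mul_pos (hq i) (neg_pos.2 h3)]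
    · have h3 := h.inner_sub_lt (hvf j) haj
      nlinarith [hp i, hq i, mul_nonneg (hq i).le (neg_nonneg.2 h2'),
        mul_pos (hp i) (neg_pos.2 h3)]

open Classical in
/-- The number of incidences between sets of vertices and of faces, as in Euler's formula. -/
theorem sum_card_incidences_le [Finite V] (h : IsExactIncidence inc e φ)
    (h2 : FacesMeetInPairs inc) (hφ : Function.Injective φ) (A : Finset V) (B : Finset F)
    (hA : 2 ≤ #A) : ∑ f ∈ B, #{v ∈ A | inc v f} + 4 ≤ 2 * #A + 2 * #B := by
  obtain ⟨l, hl⟩ := exists_linear_injective_comp hφ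
  -- `mid v f` says that `v` is neither lowest nor highest among the vertices of `f` in `A`. A face
  -- has at most two incidences that are not of this kind. A vertex has at most two that are, and
  -- none if it is the lowest or the highest of `A`. The total is at most 2#B + 2(#A - 2).
  let mid : V → F → Prop := fun v f =>
    inc v f ∧ ∃ a ∈ A, ∃ b ∈ A, inc a f ∧ inc b f ∧ l (φ a) < l (φ v) ∧ l (φ v) < l (φ b)
  have hface : ∀ f ∈ B, #{v ∈ A | inc v f} ≤ #{v ∈ A | mid v f} + 2 := by
    intro f _
    rcases ({v ∈ A | inc v f} : Finset V).eq_empty_or_nonempty with h0 | hne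
    · rw [h0]; simp
    obtain ⟨m, hm, hmin⟩ := exists_min_image _ (l ∘ φ) hne
    obtain ⟨M, hM, hmax⟩ := exists_max_image _ (l ∘ φ) hne
    have hsub : ({v ∈ A | inc v f} : Finset V) ⊆ ({v ∈ A | mid v f} : Finset V) ∪ {m, M} := by
      intro v hv
      rw [mem_union]
      by_cases hvm : v = m
      · right; simp [hvm]
      by_cases hvM : v = M
      · right; simp [hvM]
      left
      have h1 := lt_of_le_of_ne (hmin v hv) fun hh => hvm (hl hh).symm
      have h3 := lt_of_le_of_ne (hmax v hv) fun hh => hvM (hl hh)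
      rw [mem_filter] at hv hm hM ⊢
      exact ⟨hv.1, hv.2, m, hm.1, M, hM.1, hm.2, hM.2, h1, h3⟩
    exact (card_le_card hsub).trans ((card_union_le _ _).trans (by gcongr; exact card_le_two))
  have hvert : ∑ v ∈ A, #{f ∈ B | mid v f} + 4 ≤ 2 * #A := by
    have hne : A.Nonempty := card_pos.1 (by omega)
    obtain ⟨m, hm, hmin⟩ := exists_min_image A (l ∘ φ) hne
    obtain ⟨M, hM, hmax⟩ := exists_max_image A (l ∘ φ) hne
    have hmM : m ≠ M := by
      rintro rfl
      have : ∀ x ∈ A, x = m := fun x hx => hl (le_antisymm (hmax x hx) (hmin x hx))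
      have := card_le_one.2 fun x hx y hy => (this x hx).trans (this y hy).symm
      omega
    have hM' : M ∈ A.erase m := mem_erase.2 ⟨hmM.symm, hM⟩
    rw [← add_sum_erase _ _ hm, ← add_sum_erase _ _ hM']
    have hm0 : #{f ∈ B | mid m f} = 0 := by
      rw [card_eq_zero, filter_eq_empty_iff]
      rintro f _ ⟨-, a, ha, -, -, -, -, h1, -⟩
      exact absurd (hmin a ha) (not_le.2 h1)
    have hM0 : #{f ∈ B | mid M f} = 0 := by
      rw [card_eq_zero, filter_eq_empty_iff]
      rintro f _ ⟨-, -, -, b, hb, -, -, -, h1⟩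
      exact absurd (hmax b hb) (not_le.2 h1)
    have hrest : ∑ v ∈ (A.erase m).erase M, #{f ∈ B | mid v f} ≤ #((A.erase m).erase M) * 2 := by
      refine sum_le_card_nsmul _ _ _ fun v _ => h.card_middle_le_two h2 (l := l) _ v ?_
      intro f hf
      obtain ⟨-, hvf, a, -, b, -, h1⟩ := mem_filter.1 hf
      exact ⟨hvf, a, b, h1⟩
    have hc1 := card_erase_of_mem hM'
    have hc2 := card_erase_of_mem hm
    omega
  have hswap : ∑ f ∈ B, #{v ∈ A | mid v f} = ∑ v ∈ A, #{f ∈ B | mid v f} :=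
    (sum_card_bipartiteAbove_eq_sum_card_bipartiteBelow (s := A) (t := B) mid).symm
  have := sum_le_sum hface
  rw [sum_add_distrib, sum_const, smul_eq_mul] at this
  omega

/-- The equations expressing the incidences of a convex polyhedron are independent. -/
theorem eq_zero_of_stress [Fintype V] [Fintype F] (h : IsExactIncidence inc e φ)
    (hn : ∀ f, (e f).1 ≠ 0) (h2 : FacesMeetInPairs inc)
    (hsub : ∀ f g, f ≠ g → ∃ x, inc x f ∧ ¬ inc x g) (hφ : ConvexIndependent ℝ φ)
    {c : V → F → ℝ} (hc : ∀ v f, c v f ≠ 0 → inc v f) (hv : ∀ v, ∑ f, c v f • (e f).1 = 0)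
    (hf : ∀ f, ∑ v, c v f = 0) (hf' : ∀ f, ∑ v, c v f • φ v = 0) : c = 0 := by
  classical
  by_contra hc0
  let A : Finset V := {v | ∃ f, c v f ≠ 0}
  let B : Finset F := {f | ∃ v, c v f ≠ 0}
  have hA4 : ∀ v ∈ A, 4 ≤ #{f ∈ B | c v f ≠ 0} := by
    intro v hvA
    obtain ⟨f, hvf⟩ := (mem_filter.1 hvA).2
    by_contra! hlt
    have e1 : ({f ∈ B | c v f ≠ 0} : Finset F) = ({f | c v f ≠ 0} : Finset F) := by
      ext g
      simp only [B, mem_filter, mem_univ, true_and, and_iff_right_iff_imp]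
      exact fun hg => ⟨v, hg⟩
    rw [e1] at hlt
    exact hvf (congrFun (h.eq_zero_of_normals hn hsub (hc v) (hv v) (by omega)) f)
  have hB4 : ∀ f ∈ B, 4 ≤ #{v ∈ A | c v f ≠ 0} := by
    intro f hfB
    obtain ⟨v, hvf⟩ := (mem_filter.1 hfB).2
    by_contra! hlt
    have e1 : ({v ∈ A | c v f ≠ 0} : Finset V) = ({v | c v f ≠ 0} : Finset V) := by
      ext g
      simp only [A, mem_filter, mem_univ, true_and, and_iff_right_iff_imp]
      exact fun hg => ⟨f, hg⟩
    rw [e1] at hlt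
    exact hvf (congrFun (hφ.eq_zero_of_card_le_three (hf f) (hf' f) (by omega)) v)
  obtain ⟨v, hv1⟩ := Function.ne_iff.1 hc0
  obtain ⟨f, hvf⟩ := Function.ne_iff.1 hv1
  have hfB : f ∈ B := mem_filter.2 ⟨mem_univ _, v, hvf⟩
  have hA2 : 2 ≤ #A := by
    have := (hB4 f hfB).trans (card_le_card (filter_subset _ _))
    omega
  have h1 := h.sum_card_incidences_le h2 hφ.injective A B hA2
  have hswap : ∑ f ∈ B, #{v ∈ A | c v f ≠ 0} = ∑ v ∈ A, #{f ∈ B | c v f ≠ 0} :=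
    (sum_card_bipartiteAbove_eq_sum_card_bipartiteBelow (s := A) (t := B)
      fun v f => c v f ≠ 0).symm
  have h3 : ∑ f ∈ B, #{v ∈ A | c v f ≠ 0} ≤ ∑ f ∈ B, #{v ∈ A | inc v f} :=
    sum_le_sum fun f _ => card_le_card (monotone_filter_right _ fun v _ => hc v f)
  have h4 := card_nsmul_le_sum A _ 4 hA4
  have h5 := card_nsmul_le_sum B _ 4 hB4
  simp only [smul_eq_mul] at h4 h5
  -- The support has at least 4#A and at least 4#B incidences, hence at least 2#A + 2#B, against the
  -- upper bound 2#A + 2#B - 4.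
  omega

end IsExactIncidence

end Incidence

end

section

/-! ### Edges and supporting planes in three-space -/

section SpaceLemmas

open Module

instance : Fact (finrank ℝ Space3 = 2 + 1) := ⟨by simp⟩

theorem exists_combination_of_orthogonal {n X Y Z : Space3} (hn : n ≠ 0)
    (hX : inner ℝ n X = 0) (hY : inner ℝ n Y = 0) (hZ : inner ℝ n Z = 0)
    (hXY : LinearIndependent ℝ ![X, Y]) : ∃ a b : ℝ, Z = a • X + b • Y := by
  have h1 : Submodule.span ℝ (Set.range ![X, Y]) = (Submodule.span ℝ {n})ᗮ := by
    refine Submodule.eq_of_le_of_finrank_eq ?_ ?_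
    · rw [Submodule.span_le]
      rintro _ ⟨i, rfl⟩
      rw [SetLike.mem_coe, Submodule.mem_orthogonal_singleton_iff_inner_right]
      fin_cases i <;> assumption
    · rw [Submodule.finrank_orthogonal_span_singleton (n := 2) hn, finrank_span_eq_card hXY]
      simp
  have h2 : Z ∈ Submodule.span ℝ (Set.range ![X, Y]) := by
    rw [h1, Submodule.mem_orthogonal_singleton_iff_inner_right]
    exact hZ
  rw [Matrix.range_cons_cons_empty, Submodule.mem_span_pair] at h2
  obtain ⟨a, b, hab⟩ := h2
  exact ⟨a, b, hab.symm⟩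

/-- If `X` and `Z` were independent they would span the plane orthogonal to `n`. The component `w`
of `m` in that plane, being orthogonal to both, would then vanish and `m` would be a multiple of
`n`. -/
theorem exists_smul_of_orthogonal_pair {n m X Z : Space3} (hnm : LinearIndependent ℝ ![n, m])
    (hX0 : X ≠ 0) (hX : inner ℝ n X = 0) (hX' : inner ℝ m X = 0) (hZ : inner ℝ n Z = 0)
    (hZ' : inner ℝ m Z = 0) : ∃ t : ℝ, Z = t • X := by
  by_cases hXZ : LinearIndependent ℝ ![X, Z]
  · exfalso
    have hn : n ≠ 0 := hnm.ne_zero 0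
    obtain ⟨w, hw⟩ : ∃ w : Space3, w = m - (inner ℝ n m / inner ℝ n n) • n := ⟨_, rfl⟩
    have hnn : inner ℝ n n ≠ 0 := inner_self_ne_zero.2 hn
    have hw1 : inner ℝ n w = 0 := by
      rw [hw, inner_sub_right, inner_smul_right]; field_simp; ring
    obtain ⟨a, b, hab⟩ := exists_combination_of_orthogonal hn hX hZ hw1 hXZ
    have hw0 : w = 0 := by
      rw [← inner_self_eq_zero (𝕜 := ℝ)]
      nth_rewrite 2 [hab]
      rw [inner_add_right, inner_smul_right, inner_smul_right, hw, inner_sub_left, inner_sub_left,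
        inner_smul_left, inner_smul_left, hX, hX', hZ, hZ']
      simp
    rw [LinearIndependent.pair_iff' hn] at hnm
    exact hnm (inner ℝ n m / inner ℝ n n) (sub_eq_zero.1 (hw ▸ hw0)).symm
  · rw [LinearIndependent.pair_iff' hX0] at hXZ
    push Not at hXZ
    obtain ⟨t, ht⟩ := hXZ
    exact ⟨t, ht.symm⟩

theorem ConvexIndependent.linearIndependent_sub_pair {V : Type*} [Finite V] {φ : V → Space3}
    (hφ : ConvexIndependent ℝ φ) {v x y : V} (hx : x ≠ v) (hy : y ≠ v) (hxy : x ≠ y) :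
    LinearIndependent ℝ ![φ x - φ v, φ y - φ v] := by
  classical
  have := Fintype.ofFinite V
  rw [LinearIndependent.pair_iff]
  intro s t hst
  let c : V → ℝ := Pi.single x s + Pi.single y t + Pi.single v (-(s + t))
  have hsupp : (Finset.univ.filter fun z => c z ≠ 0) ⊆ {x, y, v} := by
    intro z hz
    simp only [Finset.mem_filter, Finset.mem_univ, true_and] at hz
    by_contra h
    simp only [Finset.mem_insert, Finset.mem_singleton, not_or] at h
    apply hz
    simp [c, h.1, h.2.1, h.2.2]
  have hc := hφ.eq_zero_of_card_le_three (c := c) (by simp [c, Finset.sum_add_distrib]) (by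
      simp only [c, Pi.add_apply, add_smul, Finset.sum_add_distrib, Pi.single_apply, ite_smul,
        zero_smul, Finset.sum_ite_eq', Finset.mem_univ, if_true]
      rw [← hst]; module)
    ((Finset.card_le_card hsupp).trans Finset.card_le_three)
  have h1 := congrFun hc x
  have h2 := congrFun hc y
  simp [c, hx, hy, hxy, hxy.symm] at h1 h2
  exact ⟨h1, h2⟩

variable {P : Set Space3} {v x y z p n : Space3}

theorem IsPolyhedronEdge.mem_right (h : IsPolyhedronEdge P x y) : y ∈ P :=
  h.2.subset (right_mem_segment ℝ x y)

/-- If `a < 0`, then `p` and `x` are on opposite sides of the line through `v` and `y`. For `b ≥ 0`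
a segment joining points of `[v, p]` and `[v, x]` crosses the edge `[v, y]`, which is impossible
since an edge is extreme. For `b < 0` the vertex `v` lies strictly between `p` and a point of `[x,
y]`. -/
theorem IsPolyhedronEdge.coord_nonneg (hP : Convex ℝ P) (hv : v ∈ P.extremePoints ℝ)
    (hx : x ∈ P) (hy : IsPolyhedronEdge P v y) (hxy : LinearIndependent ℝ ![x - v, y - v])
    (hp : p ∈ P) {a b : ℝ} (hab : p - v = a • (x - v) + b • (y - v)) : 0 ≤ a := by
  rw [LinearIndependent.pair_iff] at hxy
  by_contra! ha
  have hp' : p = v + a • (x - v) + b • (y - v) := by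
    rw [add_assoc, ← hab]; abel
  rcases le_or_gt 0 b with hb | hb
  · have ht0 : 0 < (1 + b)⁻¹ := by positivity
    have ht1 : (1 + b)⁻¹ ≤ 1 := inv_le_one_of_one_le₀ (by linarith)
    have ht2 : (1 + b)⁻¹ * b ≤ 1 := by
      rw [inv_mul_le_iff₀ (by linarith)]; linarith
    set t := (1 + b)⁻¹
    have hpt : v + t • (p - v) ∈ P := hP.add_smul_sub_mem hv.1 hp ⟨ht0.le, ht1⟩
    have hxt : v + t • (x - v) ∈ P := hP.add_smul_sub_mem hv.1 hx ⟨ht0.le, ht1⟩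
    have h1a : 0 < 1 - a := by linarith
    have hz : v + (t * b / (1 - a)) • (y - v) ∈ segment ℝ v y := by
      rw [segment_eq_image']
      refine ⟨_, ⟨by positivity, ?_⟩, rfl⟩
      rw [div_le_one h1a]; linarith
    have hz' : v + (t * b / (1 - a)) • (y - v) ∈
        openSegment ℝ (v + t • (x - v)) (v + t • (p - v)) := by
      refine ⟨-a / (1 - a), 1 / (1 - a), div_pos (by linarith) h1a, by positivity, ?_, ?_⟩
      · field_simp; ring
      · rw [hp']
        match_scalars <;> field_simp <;> ring
    have := hy.2.left_mem_of_mem_openSegment hxt hpt hz hz'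
    rw [segment_eq_image'] at this
    obtain ⟨s, -, hs⟩ := this
    have hs' : t • (x - v) + (-s) • (y - v) = 0 := by
      have : s • (y - v) = t • (x - v) := add_left_cancel hs
      rw [neg_smul, this, add_neg_cancel]
    exact ht0.ne' (hxy _ _ hs').1
  · have hs : 0 < -a - b := by linarith
    have hq : (a / (a + b)) • x + (b / (a + b)) • y ∈ P := by
      have hab' : a + b < 0 := by linarith
      refine hP hx hy.mem_right (div_nonneg_of_nonpos ha.le hab'.le)
        (div_nonneg_of_nonpos hb.le hab'.le) ?_
      rw [← add_div, div_self hab'.ne]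
    have hne : a + b ≠ 0 := by linarith
    have hv' : v ∈ openSegment ℝ ((a / (a + b)) • x + (b / (a + b)) • y) p := by
      have h1 : 0 < 1 - a - b := by linarith
      refine ⟨(-a - b) / (1 - a - b), 1 / (1 - a - b), by positivity, by positivity, ?_, ?_⟩
      · field_simp; ring
      · rw [hp']
        match_scalars <;> field_simp <;> ring
    have hqv := hv.2 hq hp hv'
    have h0 : (a / (a + b)) • (x - v) + (b / (a + b)) • (y - v) = 0 := by
      have h1 : (a / (a + b)) • (x - v) + (b / (a + b)) • (y - v) =
          (a / (a + b)) • x + (b / (a + b)) • y - ((a + b) / (a + b)) • v := by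
        match_scalars <;> field_simp <;> ring
      rw [h1, div_self hne, one_smul, hqv, sub_self]
    exact div_ne_zero ha.ne hne (hxy _ _ h0).1

/-- The part of a polyhedron in a plane containing two edges at a vertex lies in the angle of these
edges. -/
theorem IsPolyhedronEdge.exists_nonneg_combination (hP : Convex ℝ P) (hv : v ∈ P.extremePoints ℝ)
    (hx : IsPolyhedronEdge P v x) (hy : IsPolyhedronEdge P v y)
    (hxy : LinearIndependent ℝ ![x - v, y - v]) (hp : p ∈ P) (hn : n ≠ 0)
    (hnx : inner ℝ n (x - v) = 0) (hny : inner ℝ n (y - v) = 0) (hnp : inner ℝ n (p - v) = 0) :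
    ∃ a b : ℝ, 0 ≤ a ∧ 0 ≤ b ∧ p - v = a • (x - v) + b • (y - v) := by
  obtain ⟨a, b, hab⟩ := exists_combination_of_orthogonal hn hnx hny hnp hxy
  refine ⟨a, b, hy.coord_nonneg hP hv hx.mem_right hxy hp hab, ?_, hab⟩
  refine hx.coord_nonneg hP hv hy.mem_right ?_ hp (hab.trans (add_comm _ _))
  exact LinearIndependent.pair_symm_iff.1 hxy

/-- Each edge direction lies in the convex angle of the other two. Writing z in terms of x, y and
then x in terms of y, z, and substituting, makes the directions of z and x parallel. -/
theorem not_three_coplanar_edges (hP : Convex ℝ P) (hv : v ∈ P.extremePoints ℝ)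
    (hx : IsPolyhedronEdge P v x) (hy : IsPolyhedronEdge P v y) (hz : IsPolyhedronEdge P v z)
    (hxy : LinearIndependent ℝ ![x - v, y - v]) (hyz : LinearIndependent ℝ ![y - v, z - v])
    (hxz : LinearIndependent ℝ ![x - v, z - v]) (hn : n ≠ 0) (hnx : inner ℝ n (x - v) = 0)
    (hny : inner ℝ n (y - v) = 0) (hnz : inner ℝ n (z - v) = 0) : False := by
  obtain ⟨a, b, ha, hb, h1⟩ := hx.exists_nonneg_combination hP hv hy hxy hz.mem_right hn hnx hny hnz
  obtain ⟨c, d, hc, hd, h2⟩ := hy.exists_nonneg_combination hP hv hz hyz hx.mem_right hn hny hnz hnx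
  rw [LinearIndependent.pair_iff] at hxy hxz hyz
  have h3 := hxy (1 - d * a) (-(c + d * b)) (by
    nth_rewrite 1 [h1] at h2
    have : (1 - d * a) • (x - v) + (-(c + d * b)) • (y - v) =
      (x - v) - (c • (y - v) + d • (a • (x - v) + b • (y - v))) := by module
    rw [this, ← h2, sub_self])
  have hdb : d * b = 0 := le_antisymm (by nlinarith [h3.2]) (mul_nonneg hd hb)
  have hda : d * a = 1 := by linarith [h3.1]
  have hb0 : b = 0 := by
    rcases mul_eq_zero.1 hdb with h | h
    · rw [h, zero_mul] at hda; linarith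
    · exact h
  rw [hb0, zero_smul, add_zero] at h1
  have := hxz a (-1) (by rw [h1]; module)
  linarith [this.2]

/-- Two vertices lying on two different supporting planes are joined by an edge. -/
theorem IsPolyhedronEdge.of_supporting_planes {m a b : Space3} {c d : ℝ}
    (hP : Convex ℝ P) (hn : ∀ q ∈ P, inner ℝ n q ≤ c) (hm : ∀ q ∈ P, inner ℝ m q ≤ d)
    (hnm : LinearIndependent ℝ ![n, m]) (ha : a ∈ P.extremePoints ℝ) (hb : b ∈ P.extremePoints ℝ)
    (hab : a ≠ b) (hna : inner ℝ n a = c) (hnb : inner ℝ n b = c) (hma : inner ℝ m a = d)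
    (hmb : inner ℝ m b = d) : IsPolyhedronEdge P a b := by
  -- The two planes meet in the line through `a` and `b`; since these points are extreme, the
  -- polyhedron contains no point of the line beyond them.
  have hline : ∀ q ∈ P, inner ℝ n q = c → inner ℝ m q = d → q ∈ segment ℝ a b := by
    intro q hq hnq hmq
    obtain ⟨t, ht⟩ := exists_smul_of_orthogonal_pair hnm (sub_ne_zero.2 hab.symm) (Z := q - a)
      (by rw [inner_sub_right, hna, hnb, sub_self]) (by rw [inner_sub_right, hma, hmb, sub_self])
      (by rw [inner_sub_right, hna, hnq, sub_self]) (by rw [inner_sub_right, hma, hmq, sub_self])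
    have hq' : q = a + t • (b - a) := by rw [← ht]; abel
    have ht0 : 0 ≤ t := by
      by_contra! h0
      have h1 : 0 < 1 - t := by linarith
      have hmem : a ∈ openSegment ℝ b q := by
        refine ⟨-t / (1 - t), 1 / (1 - t), div_pos (by linarith) h1, by positivity, ?_, ?_⟩
        · field_simp; ring
        · rw [hq']; match_scalars <;> field_simp <;> ring
      exact hab (ha.2 hb.1 hq hmem).symm
    have ht1 : t ≤ 1 := by
      by_contra! h0
      have hmem : b ∈ openSegment ℝ a q := by
        refine ⟨(t - 1) / t, 1 / t, div_pos (by linarith) (by linarith),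
          div_pos one_pos (by linarith), ?_, ?_⟩
        · field_simp; ring
        · rw [hq']; match_scalars <;> field_simp <;> ring
      exact hab (hb.2 ha.1 hq hmem)
    rw [segment_eq_image']
    exact ⟨t, ⟨ht0, ht1⟩, hq'.symm⟩
  -- A point of a supporting plane lying strictly between two points of the polyhedron forces both
  -- of them into that plane.
  have key : ∀ {k : Space3} {r : ℝ}, (∀ q ∈ P, inner ℝ k q ≤ r) → inner ℝ k a = r →
      inner ℝ k b = r → ∀ p ∈ P, ∀ q ∈ P, ∀ w ∈ segment ℝ a b, w ∈ openSegment ℝ p q →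
      inner ℝ k p = r := by
    rintro k r hk hka hkb p hp q hq w ⟨s, t, -, -, hst, rfl⟩ ⟨s', t', hs', ht', hst', h⟩
    have h1 := congrArg (inner ℝ k) h
    simp only [inner_add_right, inner_smul_right, hka, hkb] at h1
    have h2 := hk p hp
    have h3 := hk q hq
    have h4 : s' * inner ℝ k p + t' * inner ℝ k q = s' * r + t' * r := by
      rw [h1, ← add_mul, ← add_mul, hst, hst']
    by_contra hne
    have h5 := mul_lt_mul_of_pos_left (lt_of_le_of_ne h2 hne) hs'
    have h6 := mul_le_mul_of_nonneg_left h3 ht'.le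
    linarith
  refine ⟨hab, hP.segment_subset ha.1 hb.1, fun p hp q hq w hw hwpq => ?_⟩
  exact hline p hp (key hn hna hnb p hp q hq w hw hwpq) (key hm hma hmb p hp q hq w hw hwpq)

end SpaceLemmas

end

/-! ### Combinatorics forced by a geometric 1-skeleton -/

section

theorem convex_polyhedron {F : Type*} (T : F → HalfSpace) : Convex ℝ (polyhedron T) := by
  refine (convex_ball _ _).inter (convex_iInter fun f => ?_)
  exact convex_halfSpace_le (f := fun x => inner ℝ ((T f).1 : Space3) x)
    ⟨fun _ _ => inner_add_right _ _ _, fun _ _ => inner_smul_right _ _ _⟩ _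

theorem inner_le_of_mem_polyhedron {F : Type*} {T : F → HalfSpace} {x : Space3}
    (hx : x ∈ polyhedron T) (f : F) : inner ℝ ((T f).1 : Space3) x ≤ (T f).2 :=
  Set.mem_iInter.1 hx.2 f

theorem HalfSpace.normal_ne_zero (H : HalfSpace) : (H.1 : Space3) ≠ 0 :=
  ne_zero_of_mem_unit_sphere H.1

namespace RotationSystem

variable {V : Type*} {G : SimpleGraph V} (M : RotationSystem G)

/-- Incidence of a vertex and a face. -/
def inc (v : V) (f : M.Face) : Prop := v ∈ M.faceVerts f

/-- Every vertex has a neighbour, and at least three of them. -/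
structure HasMinDegreeThree : Prop where
  exists_adj : ∀ v, ∃ x, G.Adj v x
  rot_rot_ne : ∀ v x, G.Adj v x → M.rot v (M.rot v x) ≠ x

/-- The combinatorial properties of the faces of the boundary of a polyhedron. -/
structure IsPolyhedral : Prop where
  face_ne_face_symm : ∀ d : G.Dart, M.face d ≠ M.face d.symm
  facesMeetInPairs : FacesMeetInPairs M.inc
  adj : ∀ f g, f ≠ g → ∀ a b, a ≠ b → M.inc a f → M.inc b f → M.inc a g → M.inc b g → G.Adj a b

/-- Every face visits each vertex at most once. -/
def HasSimpleFaces : Prop :=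
  ∀ d d' : G.Dart, M.face d = M.face d' → d.snd = d'.snd → d = d'

variable {M}

theorem adj_rot {v x : V} (h : G.Adj v x) : G.Adj v (M.rot v x) :=
  (M.isCycleOn v).1.mapsTo h

theorem adj_rot_symm {v x : V} (h : G.Adj v x) : G.Adj v ((M.rot v).symm x) := by
  by_contra hn
  have h1 := M.fixes v _ hn
  rw [Equiv.apply_symm_apply] at h1
  exact hn (h1 ▸ h)

theorem HasMinDegreeThree.rot_ne (hM : M.HasMinDegreeThree) {v x : V} (h : G.Adj v x) :
    M.rot v x ≠ x := fun h1 => hM.rot_rot_ne v x h (by rw [h1, h1])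

variable (M) in
/-- The directed edge following `d` on its face. -/
def next (d : G.Dart) : G.Dart := ⟨(d.snd, M.rot d.snd d.fst), adj_rot d.adj.symm⟩

variable (M) in
/-- The directed edge preceding `d` on its face. -/
def prev (d : G.Dart) : G.Dart := ⟨((M.rot d.fst).symm d.snd, d.fst), (adj_rot_symm d.adj).symm⟩

theorem faceStep_iff {d d' : G.Dart} : M.FaceStep d d' ↔ d' = M.next d := by
  constructor
  · rintro ⟨h1, h2⟩
    exact SimpleGraph.Dart.ext _ _ (Prod.ext h1 h2)
  · rintro rfl
    exact ⟨rfl, rfl⟩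

theorem next_prev (d : G.Dart) : M.next (M.prev d) = d := by
  apply SimpleGraph.Dart.ext
  simp [next, prev]

theorem prev_next (d : G.Dart) : M.prev (M.next d) = d := by
  apply SimpleGraph.Dart.ext
  simp [next, prev]

theorem face_next (d : G.Dart) : M.face (M.next d) = M.face d :=
  (Quot.sound (faceStep_iff.2 rfl)).symm

theorem face_prev (d : G.Dart) : M.face (M.prev d) = M.face d := by
  rw [← face_next (M.prev d), next_prev]

theorem inc_fst (d : G.Dart) : M.inc d.fst (M.face d) := ⟨d, rfl, rfl⟩

theorem inc_snd (d : G.Dart) : M.inc d.snd (M.face d) := by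
  rw [← face_next]; exact inc_fst (M.next d)

theorem inc_rot (d : G.Dart) : M.inc (M.rot d.snd d.fst) (M.face d) := by
  rw [← face_next]; exact inc_snd (M.next d)

theorem inc.exists_snd {v : V} {f : M.Face} (h : M.inc v f) :
    ∃ d : G.Dart, M.face d = f ∧ d.snd = v := by
  obtain ⟨d, h1, h2⟩ := h
  exact ⟨M.prev d, by rw [face_prev, h1], h2⟩

theorem exists_face_eq (f : M.Face) : ∃ d, M.face d = f := Quot.exists_rep f

section Skeleton

variable {P : Set Space3} {φ : V → Space3}

theorem _root_.IsOneSkeleton.mem (h : IsOneSkeleton G P φ) (v : V) : φ v ∈ P.extremePoints ℝ :=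
  h.vertices.mapsTo (Set.mem_univ v)

theorem _root_.convexIndependent_of_bijOn (hP : Convex ℝ P)
    (h : Set.BijOn φ Set.univ (P.extremePoints ℝ)) : ConvexIndependent ℝ φ := by
  let i : V ↪ P.extremePoints ℝ := ⟨fun v => ⟨φ v, h.mapsTo (Set.mem_univ v)⟩, fun _ _ hab =>
    h.injOn (Set.mem_univ _) (Set.mem_univ _) (congrArg Subtype.val hab)⟩
  exact hP.convexIndependent_extremePoints.comp_embedding i

variable [Finite V]

theorem _root_.IsOneSkeleton.not_three_neighbors (hP : Convex ℝ P) (h : IsOneSkeleton G P φ)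
    {n : Space3} (hn : n ≠ 0) {v x y z : V} (hx : G.Adj v x) (hy : G.Adj v y) (hz : G.Adj v z)
    (hxy : x ≠ y) (hyz : y ≠ z) (hxz : x ≠ z) (hnx : inner ℝ n (φ x - φ v) = 0)
    (hny : inner ℝ n (φ y - φ v) = 0) (hnz : inner ℝ n (φ z - φ v) = 0) : False := by
  have hc := convexIndependent_of_bijOn hP h.vertices
  exact not_three_coplanar_edges hP (h.mem v) ((h.edges _ _).1 hx) ((h.edges _ _).1 hy)
    ((h.edges _ _).1 hz) (hc.linearIndependent_sub_pair hx.ne' hy.ne' hxy)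
    (hc.linearIndependent_sub_pair hy.ne' hz.ne' hyz)
    (hc.linearIndependent_sub_pair hx.ne' hz.ne' hxz) hn hnx hny hnz

/-- A directed edge stands for the corner formed at its head by itself and the next edge. Since the
rotation has no orbit of length two, distinct corners at one vertex involve at least three edges,
and these cannot be coplanar. -/
theorem _root_.IsOneSkeleton.dart_eq (hP : Convex ℝ P) (h : IsOneSkeleton G P φ)
    (hM : M.HasMinDegreeThree) {n : Space3} (hn : n ≠ 0) {d d' : G.Dart} (hd : d.snd = d'.snd)
    (h1 : inner ℝ n (φ d.fst - φ d.snd) = 0)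
    (h2 : inner ℝ n (φ (M.rot d.snd d.fst) - φ d.snd) = 0)
    (h1' : inner ℝ n (φ d'.fst - φ d'.snd) = 0)
    (h2' : inner ℝ n (φ (M.rot d'.snd d'.fst) - φ d'.snd) = 0) : d = d' := by
  obtain ⟨⟨x, v⟩, hxv⟩ := d
  obtain ⟨⟨x', v'⟩, hxv'⟩ := d'
  obtain rfl : v = v' := hd
  have hx : G.Adj v x := hxv.symm
  have hx' : G.Adj v x' := hxv'.symm
  dsimp only at h1 h2 h1' h2'
  by_cases hxx : x = x'
  · subst hxx; rfl
  exfalso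
  by_cases hyx : M.rot v x = x'
  · subst hyx
    refine h.not_three_neighbors hP hn hx hx' (adj_rot hx') (hM.rot_ne hx).symm
      (hM.rot_ne hx').symm (hM.rot_rot_ne v x hx).symm h1 h1' h2'
  · exact h.not_three_neighbors hP hn hx (adj_rot hx) hx' (hM.rot_ne hx).symm hyx hxx h1 h2 h1'

variable {T : M.Face → HalfSpace}

/-- Suppose that a vertex `z` in the plane of `f` is not on `f`, and separate it by `l` from the
hull of the vertices of `f`. At a vertex of `f` where `l` is maximal, `z` lies in the angle of the
two edges of `f`, along which `l` does not increase. So `l` is not larger at `z`, a contradiction.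
-/
theorem _root_.IsOneSkeleton.isExactIncidence (h : IsOneSkeleton G (polyhedron T) φ)
    (hM : M.HasMinDegreeThree) (hT : ∀ f, ∀ v ∈ M.faceVerts f, φ v ∈ (T f).boundaryPlane) :
    IsExactIncidence M.inc (halfSpaceCoords T) φ := by
  have hP := convex_polyhedron T
  have hc := convexIndependent_of_bijOn hP h.vertices
  refine ⟨fun v f hv => hT f v hv, fun z f hz => ?_⟩
  refine lt_of_le_of_ne (inner_le_of_mem_polyhedron (h.mem z).1 f) fun heq => hz ?_
  let C : Set V := M.faceVerts f
  have hCfin : C.Finite := Set.toFinite C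
  have hCne : C.Nonempty := by
    obtain ⟨d, rfl⟩ := exists_face_eq f
    exact ⟨_, inc_fst d⟩
  by_contra hzC
  have hnot : φ z ∉ convexHull ℝ (φ '' C) := fun hmem => hzC (hc C z hmem)
  obtain ⟨l, u, hl, hu⟩ := geometric_hahn_banach_closed_point (convex_convexHull ℝ _)
    ((hCfin.image φ).isCompact_convexHull ℝ).isClosed hnot
  obtain ⟨v, hvC, hmax⟩ := hCfin.exists_maximalFor (fun v => l (φ v)) C hCne
  have hmax' : ∀ w ∈ C, l (φ w) ≤ l (φ v) := fun w hw =>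
    (le_total (l (φ w)) (l (φ v))).elim id fun h => hmax hw h
  obtain ⟨d, rfl, rfl⟩ := inc.exists_snd (M := M) hvC
  have hx := d.adj.symm
  have hx1 := inc_fst (M := M) d
  have hy1 := inc_rot (M := M) d
  have hplane : ∀ w, inner ℝ ((T (M.face d)).1 : Space3) (φ w) = (T (M.face d)).2 →
      inner ℝ ((T (M.face d)).1 : Space3) (φ w - φ d.snd) = 0 := fun w hw => by
    have := hT _ _ hvC
    rw [HalfSpace.boundaryPlane, Set.mem_ofPred_eq] at this
    rw [inner_sub_right, hw, this, sub_self]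
  obtain ⟨a, b, ha, hb, hab⟩ := IsPolyhedronEdge.exists_nonneg_combination hP (h.mem d.snd)
    ((h.edges _ _).1 hx) ((h.edges _ _).1 (adj_rot (M := M) hx))
    (hc.linearIndependent_sub_pair hx.ne' (adj_rot (M := M) hx).ne' (hM.rot_ne hx).symm)
    (h.mem z).1 (T (M.face d)).normal_ne_zero (hplane _ (hT _ _ hx1)) (hplane _ (hT _ _ hy1))
    (hplane z heq)
  have h1 := congrArg l hab
  simp only [map_sub, map_add, map_smul, smul_eq_mul] at h1
  have h2 := hmax' _ hx1
  have h3 := hmax' _ hy1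
  have h4 := hl _ (subset_convexHull ℝ _ (Set.mem_image_of_mem φ hvC))
  nlinarith [mul_nonneg ha (sub_nonneg.2 h2), mul_nonneg hb (sub_nonneg.2 h3)]

variable (h : IsOneSkeleton G (polyhedron T) φ) (hM : M.HasMinDegreeThree)
  (hT : ∀ f, ∀ v ∈ M.faceVerts f, φ v ∈ (T f).boundaryPlane)
include h hM hT

/-- With proportional normals the two planes through `a` would coincide and contain the corners of
both faces at `a`. By `IsOneSkeleton.dart_eq` these corners are equal, hence so are the faces. -/
theorem _root_.IsOneSkeleton.linearIndependent_normals {f g : M.Face} (hfg : f ≠ g) {a : V}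
    (haf : M.inc a f) (hag : M.inc a g) :
    LinearIndependent ℝ ![((T f).1 : Space3), ((T g).1 : Space3)] := by
  have hex := h.isExactIncidence hM hT
  rw [LinearIndependent.pair_iff' (T f).normal_ne_zero]
  intro s hs
  have hs0 : s ≠ 0 := by
    rintro rfl
    rw [zero_smul] at hs
    exact (T g).normal_ne_zero hs.symm
  have hiff : ∀ w, inner ℝ ((T g).1 : Space3) (φ w - φ a) = 0 →
      inner ℝ ((T f).1 : Space3) (φ w - φ a) = 0 := fun w hw => by
    rw [← hs, inner_smul_left] at hw
    exact (mul_eq_zero.1 hw).resolve_left hs0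
  obtain ⟨d, rfl, rfl⟩ := haf.exists_snd
  obtain ⟨d', rfl, hd⟩ := hag.exists_snd
  refine hfg (congrArg M.face (h.dart_eq (convex_polyhedron T) hM (T (M.face d)).normal_ne_zero
    hd.symm ?_ ?_ ?_ ?_))
  · exact hex.inner_sub_eq (inc_snd d) (inc_fst d)
  · exact hex.inner_sub_eq (inc_snd d) (inc_rot d)
  · have := hiff d'.fst (by rw [← hd]; exact hex.inner_sub_eq (inc_snd d') (inc_fst d'))
    rwa [← hd] at this
  · have := hiff (M.rot d'.snd d'.fst) (by
      rw [← hd]; exact hex.inner_sub_eq (inc_snd d') (inc_rot d'))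
    rwa [← hd] at this

/-- Two visits of a face to a vertex would give two corners there in the plane of the face. -/
theorem _root_.IsOneSkeleton.hasSimpleFaces : M.HasSimpleFaces := by
  have hex := h.isExactIncidence hM hT
  intro d d' hf hd
  refine h.dart_eq (convex_polyhedron T) hM (T (M.face d)).normal_ne_zero hd ?_ ?_ ?_ ?_
  · exact hex.inner_sub_eq (inc_snd d) (inc_fst d)
  · exact hex.inner_sub_eq (inc_snd d) (inc_rot d)
  · rw [hf]; exact hex.inner_sub_eq (inc_snd d') (inc_fst d')
  · rw [hf]; exact hex.inner_sub_eq (inc_snd d') (inc_rot d')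

/-- A face on both sides of an edge would contain the three consecutive edges around that edge at an
end. Two distinct faces with a common vertex have planes meeting in a line, which carries at most
two vertices, and two vertices on that line span an edge. -/
theorem _root_.IsOneSkeleton.isPolyhedral : M.IsPolyhedral := by
  have hP := convex_polyhedron T
  have hc := convexIndependent_of_bijOn hP h.vertices
  have hex := h.isExactIncidence hM hT
  refine ⟨fun d hd => ?_, fun f g hfg a b z hab haf hbf hzf hag hbg hzg => ?_,
    fun f g hfg a b hab haf hbf hag hbg => ?_⟩
  · have hn := (T (M.face d)).normal_ne_zero
    have ha : G.Adj d.snd d.fst := d.adj.symm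
    have hz := adj_rot_symm (M := M) ha
    have hzr : M.rot d.snd ((M.rot d.snd).symm d.fst) = d.fst := Equiv.apply_symm_apply _ _
    have h1 := hM.rot_ne hz
    have h2 := hM.rot_rot_ne _ _ hz
    rw [hzr] at h1 h2
    refine h.not_three_neighbors hP hn ha (adj_rot ha) hz (hM.rot_ne ha).symm h2 h1
      (hex.inner_sub_eq (inc_snd d) (inc_fst d)) (hex.inner_sub_eq (inc_snd d) (inc_rot d))
      (hex.inner_sub_eq (inc_snd d) ?_)
    rw [hd, ← face_prev]
    exact inc_fst (M.prev d.symm)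
  · by_contra! hz
    have hli := h.linearIndependent_normals hM hT hfg haf hag
    have hX : φ b - φ a ≠ 0 := sub_ne_zero.2 (hc.injective.ne hab.symm)
    obtain ⟨t, ht⟩ := exists_smul_of_orthogonal_pair hli hX (hex.inner_sub_eq haf hbf)
      (hex.inner_sub_eq hag hbg) (hex.inner_sub_eq haf hzf) (hex.inner_sub_eq hag hzg)
    have := hc.linearIndependent_sub_pair hab.symm hz.1 hz.2.symm
    rw [LinearIndependent.pair_iff' hX] at this
    exact this t ht.symm
  · rw [h.edges]
    exact IsPolyhedronEdge.of_supporting_planes hP (fun q hq => inner_le_of_mem_polyhedron hq f)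
      (fun q hq => inner_le_of_mem_polyhedron hq g)
      (h.linearIndependent_normals hM hT hfg haf hag) (h.mem a) (h.mem b) (hc.injective.ne hab)
      (hT _ _ haf) (hT _ _ hbf) (hT _ _ hag) (hT _ _ hbg)

end Skeleton

end RotationSystem

end

/-! ### Reconstructing the polyhedron from exact incidences -/

section

theorem exists_orthogonal_not_smul {n : Space3} (hn : n ≠ 0) (D : Space3) :
    ∃ Y : Space3, inner ℝ n Y = 0 ∧ ∀ t : ℝ, Y ≠ t • D := by
  by_contra! hcon
  have hle : (Submodule.span ℝ {n})ᗮ ≤ Submodule.span ℝ {D} := by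
    intro Y hY
    rw [Submodule.mem_orthogonal_singleton_iff_inner_right] at hY
    obtain ⟨t, ht⟩ := hcon Y hY
    exact Submodule.mem_span_singleton.2 ⟨t, ht.symm⟩
  have h1 := Submodule.finrank_mono hle
  rw [Submodule.finrank_orthogonal_span_singleton (n := 2) hn] at h1
  have h2 := finrank_span_le_card (R := ℝ) ({D} : Set Space3)
  simp at h2
  omega

namespace RotationSystem

variable {V : Type*} {G : SimpleGraph V} {M : RotationSystem G}

theorem IsPolyhedral.not_inc_rot (hp : M.IsPolyhedral) (hM : M.HasMinDegreeThree) (d : G.Dart) :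
    ¬ M.inc (M.rot d.snd d.fst) (M.face d.symm) := by
  intro hy
  rcases hp.facesMeetInPairs _ _ (hp.face_ne_face_symm d) d.snd d.fst (M.rot d.snd d.fst)
    d.adj.ne' (inc_snd d) (inc_fst d) (inc_rot d) (inc_fst d.symm) (inc_snd d.symm) hy with h | h
  · exact (adj_rot d.adj.symm).ne' h
  · exact hM.rot_ne d.adj.symm h

theorem IsPolyhedral.not_inc_fst (hp : M.IsPolyhedral) (hM : M.HasMinDegreeThree) (d : G.Dart) :
    ¬ M.inc d.fst (M.face (M.next d).symm) := by
  intro hx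
  have hne := hp.face_ne_face_symm (M.next d)
  rw [face_next] at hne
  rcases hp.facesMeetInPairs _ _ hne d.snd (M.rot d.snd d.fst) d.fst
    (adj_rot d.adj.symm).ne (inc_snd d) (inc_rot d) (inc_fst d) (inc_snd (M.next d).symm)
    (inc_fst (M.next d).symm) hx with h | h
  · exact d.adj.ne h
  · exact hM.rot_ne d.adj.symm h.symm

end RotationSystem

namespace IsExactIncidence

open RotationSystem

variable {V : Type*} {G : SimpleGraph V} {M : RotationSystem G} {e : M.Face → Space3 × ℝ}
  {φ : V → Space3} (hex : IsExactIncidence M.inc e φ) (hp : M.IsPolyhedral)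
  (hM : M.HasMinDegreeThree)
include hex hp hM

theorem inner_rot_neg (d : G.Dart) :
    inner ℝ (e (M.face d.symm)).1 (φ (M.rot d.snd d.fst) - φ d.snd) < 0 :=
  hex.inner_sub_lt (inc_fst d.symm) (hp.not_inc_rot hM d)

theorem inner_fst_neg (d : G.Dart) :
    inner ℝ (e (M.face (M.next d).symm)).1 (φ d.fst - φ d.snd) < 0 :=
  hex.inner_sub_lt (inc_snd (M.next d).symm) (hp.not_inc_fst hM d)

omit hp hM in
theorem inner_fst_eq (d : G.Dart) : inner ℝ (e (M.face d.symm)).1 (φ d.fst - φ d.snd) = 0 :=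
  hex.inner_sub_eq (inc_fst d.symm) (inc_snd d.symm)

omit hp hM in
theorem inner_rot_eq (d : G.Dart) :
    inner ℝ (e (M.face (M.next d).symm)).1 (φ (M.rot d.snd d.fst) - φ d.snd) = 0 :=
  hex.inner_sub_eq (inc_snd (M.next d).symm) (inc_fst (M.next d).symm)

/-- The two edges of a corner are independent: the normal of the face across one of them vanishes on
that edge and is strictly negative on the other. -/
theorem exists_face_combination (hn : ∀ f, (e f).1 ≠ 0) (d : G.Dart) {p : Space3}
    (hd : inner ℝ (e (M.face d)).1 p = 0) :
    ∃ a b : ℝ, p = a • (φ d.fst - φ d.snd) + b • (φ (M.rot d.snd d.fst) - φ d.snd) := by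
  refine exists_combination_of_orthogonal (hn (M.face d)) (hex.inner_sub_eq (inc_snd d) (inc_fst d))
    (hex.inner_sub_eq (inc_snd d) (inc_rot d)) hd ?_
  rw [LinearIndependent.pair_iff]
  intro s t hst
  have h1 := congrArg (inner ℝ (e (M.face d.symm)).1) hst
  have h2 := congrArg (inner ℝ (e (M.face (M.next d).symm)).1) hst
  simp only [inner_add_right, inner_smul_right, inner_zero_right, hex.inner_fst_eq d,
    hex.inner_rot_eq d, mul_zero, zero_add, add_zero] at h1 h2
  exact ⟨(mul_eq_zero.1 h2).resolve_right (hex.inner_fst_neg hp hM d).ne,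
    (mul_eq_zero.1 h1).resolve_right (hex.inner_rot_neg hp hM d).ne⟩

/-- Three faces suffice: the face of a corner puts `p` in the span of its two edges, and the faces
across these edges kill the two coefficients. -/
theorem eq_zero_of_forall_inner_eq_zero (hn : ∀ f, (e f).1 ≠ 0) {v : V} {p : Space3}
    (hv : ∀ f, M.inc v f → inner ℝ (e f).1 p = 0) : p = 0 := by
  obtain ⟨x, hx⟩ := hM.exists_adj v
  let d : G.Dart := ⟨(x, v), hx.symm⟩
  obtain ⟨a, b, hab⟩ := hex.exists_face_combination hp hM hn d (hv _ (inc_snd d))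
  have h1 := hv _ (inc_fst d.symm)
  have h2 := hv _ (inc_snd (M.next d).symm)
  rw [hab] at h1 h2 ⊢
  simp only [inner_add_right, inner_smul_right, hex.inner_fst_eq d,
    hex.inner_rot_eq d, mul_zero, zero_add, add_zero] at h1 h2
  rw [(mul_eq_zero.1 h2).resolve_right (hex.inner_fst_neg hp hM d).ne,
    (mul_eq_zero.1 h1).resolve_right (hex.inner_rot_neg hp hM d).ne]
  simp

/-- If the images coincide, `w` lies on every face of `v`. The two sides of an edge at `v` then have
`w` in common, which makes `w` the other end of that edge, but that end misses the next face at `v`.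
-/
theorem injective : Function.Injective φ := by
  intro v w hvw
  have hiff : ∀ f, M.inc v f → M.inc w f := by
    intro f hf
    by_contra hwf
    have h1 := hex.lt w f hwf
    rw [← hvw, hex.eq v f hf] at h1
    exact lt_irrefl _ h1
  obtain ⟨x, hx⟩ := hM.exists_adj v
  let d : G.Dart := ⟨(x, v), hx.symm⟩
  by_contra hne
  rcases hp.facesMeetInPairs _ _ (hp.face_ne_face_symm d) d.snd d.fst w d.adj.ne' (inc_snd d)
    (inc_fst d) (hiff _ (inc_snd d)) (inc_fst d.symm) (inc_snd d.symm)
    (hiff _ (inc_fst d.symm)) with h | h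
  · exact hne h.symm
  · refine hp.not_inc_fst hM d ?_
    rw [← h]
    exact hiff _ (inc_snd (M.next d).symm)

variable [Finite V]

/-- The tangent cone at a vertex is generated by the directions of the other vertices. -/
theorem apply_nonpos_of_mem_tangentCone (hn : ∀ f, (e f).1 ≠ 0) {v : V} {p : Space3}
    (hv : ∀ f, M.inc v f → inner ℝ (e f).1 p ≤ 0) (l : Space3 →ₗ[ℝ] ℝ)
    (hl : ∀ x, l (φ x - φ v) ≤ 0) : l p ≤ 0 := by
  classical
  obtain ⟨x, hx⟩ := hM.exists_adj v
  let d₀ : G.Dart := ⟨(x, v), hx.symm⟩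
  let X₀ := φ x - φ v
  let s : Finset M.Face := {f | M.inc v f ∧ inner ℝ (e f).1 X₀ < 0}
  have hs : s.Nonempty := ⟨M.face (M.next d₀).symm, by
    simp only [s, Finset.mem_filter, Finset.mem_univ, true_and]
    exact ⟨inc_snd (M.next d₀).symm, hex.inner_fst_neg hp hM d₀⟩⟩
  -- Subtract from `p` multiples of the direction `X₀` until a first face `f` at the vertex becomes
  -- tight; the least ratio is that moment. The remainder lies in the plane of `f` and in the
  -- tangent cone, so it is a nonnegative combination of the two edges of the corner of `f`.
  obtain ⟨f, hf, hmin⟩ := Finset.exists_min_image s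
    (fun f => inner ℝ (e f).1 p / inner ℝ (e f).1 X₀) hs
  simp only [s, Finset.mem_filter, Finset.mem_univ, true_and] at hf hmin
  set t := inner ℝ (e f).1 p / inner ℝ (e f).1 X₀ with ht
  have ht0 : 0 ≤ t := div_nonneg_of_nonpos (hv f hf.1) hf.2.le
  have hp' : ∀ g, M.inc v g → inner ℝ (e g).1 (p - t • X₀) ≤ 0 := by
    intro g hg
    rw [inner_sub_right, inner_smul_right]
    have h1 : inner ℝ (e g).1 X₀ ≤ 0 := hex.inner_sub_le hg
    rcases h1.lt_or_eq with h2 | h2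
    · have := hmin g ⟨hg, h2⟩
      rw [le_div_iff_of_neg h2] at this
      linarith
    · rw [h2, mul_zero, sub_zero]
      exact hv g hg
  have hpf : inner ℝ (e f).1 (p - t • X₀) = 0 := by
    rw [inner_sub_right, inner_smul_right, ht, div_mul_cancel₀ _ hf.2.ne, sub_self]
  obtain ⟨d, rfl, rfl⟩ := hf.1.exists_snd
  obtain ⟨a, b, hab⟩ := hex.exists_face_combination hp hM hn d hpf
  have h1 := hp' _ (inc_fst d.symm)
  have h2 := hp' _ (inc_snd (M.next d).symm)
  rw [hab] at h1 h2
  simp only [inner_add_right, inner_smul_right, hex.inner_fst_eq d,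
    hex.inner_rot_eq d, mul_zero, zero_add, add_zero] at h1 h2
  have ha : 0 ≤ a := nonneg_of_mul_nonpos_left h2 (hex.inner_fst_neg hp hM d)
  have hb : 0 ≤ b := nonneg_of_mul_nonpos_left h1 (hex.inner_rot_neg hp hM d)
  have hpe : p = t • X₀ + (a • (φ d.fst - φ d.snd) + b • (φ (M.rot d.snd d.fst) - φ d.snd)) := by
    rw [← hab]; abel
  rw [hpe, map_add, map_add, map_smul, map_smul, map_smul, smul_eq_mul, smul_eq_mul, smul_eq_mul]
  have l1 := mul_nonpos_of_nonneg_of_nonpos ht0 (hl x)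
  have l2 := mul_nonpos_of_nonneg_of_nonpos ha (hl d.fst)
  have l3 := mul_nonpos_of_nonneg_of_nonpos hb (hl (M.rot d.snd d.fst))
  linarith

/-- Were `q` separated from the hull by `l`, then at a vertex `v` maximizing `l` the vector `q - φ
v` would be in the tangent cone, where `l` is nonpositive. -/
theorem mem_convexHull_of_forall_inner_le [Nonempty V] (hn : ∀ f, (e f).1 ≠ 0) {q : Space3}
    (hq : ∀ f, inner ℝ (e f).1 q ≤ (e f).2) : q ∈ convexHull ℝ (Set.range φ) := by
  by_contra hnot
  obtain ⟨l, u, hl, hu⟩ := geometric_hahn_banach_closed_point (convex_convexHull ℝ _)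
    (((Set.finite_range φ).isCompact_convexHull ℝ).isClosed) hnot
  obtain ⟨v, hv⟩ := Finite.exists_max fun v => l (φ v)
  have h1 := hex.apply_nonpos_of_mem_tangentCone hp hM hn (v := v) (p := q - φ v)
    (fun f hf => by rw [inner_sub_right, hex.eq v f hf, sub_nonpos]; exact hq f) l.toLinearMap
    (fun x => by
      have := hv x
      simpa using this)
  have h2 := hl _ (subset_convexHull ℝ _ (Set.mem_range_self v))
  have h3 : l q - l (φ v) ≤ 0 := by simpa using h1
  linarith

omit hex

variable {T : M.Face → HalfSpace} (hT : IsExactIncidence M.inc (halfSpaceCoords T) φ)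
  (hball : ∀ v, φ v ∈ hyperbolicSpace3)
include hT hball

theorem polyhedron_eq_convexHull [Nonempty V] : polyhedron T = convexHull ℝ (Set.range φ) := by
  apply Set.Subset.antisymm
  · exact fun q hq => hT.mem_convexHull_of_forall_inner_le hp hM (fun f => (T f).normal_ne_zero)
      fun f => inner_le_of_mem_polyhedron hq f
  · refine convexHull_min ?_ (convex_polyhedron T)
    rintro _ ⟨v, rfl⟩
    exact ⟨hball v, Set.mem_iInter.2 fun f => hT.le v f⟩

theorem mem_polyhedron_iff [Nonempty V] {q : Space3} :
    q ∈ polyhedron T ↔ ∀ f, inner ℝ ((T f).1 : Space3) q ≤ (T f).2 := by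
  refine ⟨inner_le_of_mem_polyhedron, fun hq => ?_⟩
  rw [polyhedron_eq_convexHull hp hM hT hball]
  exact hT.mem_convexHull_of_forall_inner_le hp hM (fun f => (T f).normal_ne_zero) hq

/-- If `φ v` lies strictly between two points of the polyhedron, they satisfy with equality all
inequalities of the faces at `v`. The normals at `v` span, so both points equal `φ v`. -/
theorem mem_extremePoints [Nonempty V] (v : V) : φ v ∈ (polyhedron T).extremePoints ℝ := by
  refine ⟨(mem_polyhedron_iff hp hM hT hball).2 fun f => hT.le v f, ?_⟩
  rintro p hpP q hqP ⟨s, t, hs, ht, hst, hpq⟩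
  rw [← sub_eq_zero]
  refine hT.eq_zero_of_forall_inner_eq_zero hp hM (fun f => (T f).normal_ne_zero) (v := v)
    fun f hf => ?_
  have h1 := hT.eq v f hf
  have h2 := inner_le_of_mem_polyhedron hpP f
  have h3 := inner_le_of_mem_polyhedron hqP f
  change inner ℝ ((T f).1 : Space3) (φ v) = (T f).2 at h1
  change inner ℝ ((T f).1 : Space3) (p - φ v) = 0
  have h4 : s * inner ℝ ((T f).1 : Space3) p + t * inner ℝ ((T f).1 : Space3) q = (T f).2 := by
    rw [← h1, ← hpq, inner_add_right, inner_smul_right, inner_smul_right]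
  rw [inner_sub_right, h1]
  have h5 : s * (T f).2 + t * (T f).2 = (T f).2 := by rw [← add_mul, hst, one_mul]
  by_contra hne
  have h6 := lt_of_le_of_ne h2 (fun h => hne (sub_eq_zero.2 h))
  have h7 := mul_lt_mul_of_pos_left h6 hs
  have h8 := mul_le_mul_of_nonneg_left h3 ht.le
  linarith

theorem isPolyhedronEdge_of_adj [Nonempty V] {a b : V} (hab : G.Adj a b) :
    IsPolyhedronEdge (polyhedron T) (φ a) (φ b) := by
  have hn := fun f => (T f).normal_ne_zero
  let d : G.Dart := ⟨(a, b), hab⟩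
  refine IsPolyhedronEdge.of_supporting_planes (convex_polyhedron T)
    (fun q hq => inner_le_of_mem_polyhedron hq (M.face d))
    (fun q hq => inner_le_of_mem_polyhedron hq (M.face d.symm)) ?_
    (mem_extremePoints hp hM hT hball a) (mem_extremePoints hp hM hT hball b)
    ((hT.injective hp hM).ne hab.ne) (hT.eq _ _ (inc_fst d)) (hT.eq _ _ (inc_snd d))
    (hT.eq _ _ (inc_snd d.symm)) (hT.eq _ _ (inc_fst d.symm))
  rw [LinearIndependent.pair_iff]
  intro s t hst
  have h1 := congrArg (fun z => inner ℝ z (φ (M.rot d.snd d.fst) - φ d.snd)) hst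
  simp only [inner_add_left, inner_smul_left, inner_zero_left] at h1
  have h2 : inner ℝ ((T (M.face d)).1 : Space3) (φ (M.rot d.snd d.fst) - φ d.snd) = 0 :=
    hT.inner_sub_eq (inc_snd d) (inc_rot d)
  have h3 := hT.inner_rot_neg hp hM d
  change inner ℝ ((T (M.face d.symm)).1 : Space3) (φ (M.rot d.snd d.fst) - φ d.snd) < 0 at h3
  rw [h2, mul_zero, zero_add] at h1
  have ht : t = 0 := (mul_eq_zero.1 h1).resolve_right h3.ne
  rw [ht, zero_smul, add_zero] at hst
  exact ⟨(smul_eq_zero.1 hst).resolve_right (hn _), ht⟩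

/-- Nonadjacent vertices share at most one face. The midpoint of their segment can then be moved
both ways, inside the plane of that face and transversally to the segment, without leaving the
polyhedron, so the segment is not extreme. -/
theorem adj_of_isPolyhedronEdge [Nonempty V] {a b : V}
    (hab : IsPolyhedronEdge (polyhedron T) (φ a) (φ b)) : G.Adj a b := by
  have hne : a ≠ b := fun h => hab.1 (congrArg φ h)
  by_contra hadj
  have huniq : ∀ f g, M.inc a f → M.inc b f → M.inc a g → M.inc b g → f = g := by
    intro f g haf hbf hag hbg
    by_contra hfg
    exact hadj (hp.adj f g hfg a b hne haf hbf hag hbg)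
  set D := φ b - φ a with hD
  have hD0 : D ≠ 0 := sub_ne_zero.2 hab.1.symm
  obtain ⟨Y, hY, hYD⟩ : ∃ Y : Space3, (∀ f, M.inc a f → M.inc b f →
      inner ℝ ((T f).1 : Space3) Y = 0) ∧ ∀ t : ℝ, Y ≠ t • D := by
    by_cases hf : ∃ f, M.inc a f ∧ M.inc b f
    · obtain ⟨f, haf, hbf⟩ := hf
      obtain ⟨Y, hY, hYD⟩ := exists_orthogonal_not_smul (T f).normal_ne_zero D
      exact ⟨Y, fun g hag hbg => by rw [huniq g f hag hbg haf hbf]; exact hY, hYD⟩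
    · obtain ⟨Y, -, hYD⟩ := exists_orthogonal_not_smul hD0 D
      exact ⟨Y, fun g hag hbg => absurd ⟨g, hag, hbg⟩ hf, hYD⟩
  set m := φ a + (1 / 2 : ℝ) • D with hm
  have hmid : ∀ f, inner ℝ ((T f).1 : Space3) m =
      (1 / 2) * inner ℝ ((T f).1 : Space3) (φ a) + (1 / 2) * inner ℝ ((T f).1 : Space3) (φ b) := by
    intro f
    rw [hm, hD, inner_add_right, inner_smul_right, inner_sub_right]
    ring
  have hev : ∀ᶠ s : ℝ in nhds 0, ∀ f, inner ℝ ((T f).1 : Space3) (m + s • Y) ≤ (T f).2 := by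
    rw [Filter.eventually_all]
    intro f
    have ha' : inner ℝ ((T f).1 : Space3) (φ a) ≤ (T f).2 := hT.le a f
    have hb' : inner ℝ ((T f).1 : Space3) (φ b) ≤ (T f).2 := hT.le b f
    by_cases hf : M.inc a f ∧ M.inc b f
    · filter_upwards with s
      rw [inner_add_right, inner_smul_right, hY f hf.1 hf.2, mul_zero, add_zero, hmid]
      linarith
    · have hlt : inner ℝ ((T f).1 : Space3) (m + (0 : ℝ) • Y) < (T f).2 := by
        rw [zero_smul, add_zero, hmid]
        by_cases haf : M.inc a f
        · have : inner ℝ ((T f).1 : Space3) (φ b) < (T f).2 := hT.lt b f fun h => hf ⟨haf, h⟩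
          linarith
        · have : inner ℝ ((T f).1 : Space3) (φ a) < (T f).2 := hT.lt a f haf
          linarith
      have hcont : Continuous fun s : ℝ => inner ℝ ((T f).1 : Space3) (m + s • Y) := by fun_prop
      filter_upwards [hcont.continuousAt.eventually_lt_const hlt] with s hs using hs.le
  obtain ⟨δ, hδ, hball'⟩ := Metric.eventually_nhds_iff.1 hev
  have h1 : m + (δ / 2) • Y ∈ polyhedron T := (mem_polyhedron_iff hp hM hT hball).2
    (hball' (by rw [Real.dist_eq, sub_zero, abs_of_pos (by linarith)]; linarith))
  have h2 : m + (-(δ / 2)) • Y ∈ polyhedron T := (mem_polyhedron_iff hp hM hT hball).2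
    (hball' (by rw [Real.dist_eq, sub_zero, abs_neg, abs_of_pos (by linarith)]; linarith))
  have h3 : m ∈ segment ℝ (φ a) (φ b) := by
    rw [segment_eq_image']
    exact ⟨1 / 2, by norm_num, rfl⟩
  have h4 : m ∈ openSegment ℝ (m + (δ / 2) • Y) (m + (-(δ / 2)) • Y) :=
    ⟨1 / 2, 1 / 2, by norm_num, by norm_num, by norm_num, by module⟩
  have h5 := hab.2.left_mem_of_mem_openSegment h1 h2 h3 h4
  rw [segment_eq_image'] at h5
  obtain ⟨r, -, hr⟩ := h5
  refine hYD ((r - 1 / 2) * (2 / δ)) ?_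
  have h6 : (δ / 2) • Y = (r - 1 / 2) • D := by
    have : φ a + r • D = φ a + (1 / 2 : ℝ) • D + (δ / 2) • Y := hr
    rw [sub_smul, eq_sub_iff_add_eq, add_comm]
    rw [add_assoc] at this
    exact (add_left_cancel this).symm
  rw [mul_comm, mul_smul, ← h6, smul_smul]
  rw [show 2 / δ * (δ / 2) = 1 by field_simp, one_smul]

theorem isCompact_and_isOneSkeleton [Nonempty V] :
    IsCompact (polyhedron T) ∧ IsOneSkeleton G (polyhedron T) φ := by
  have hPeq := polyhedron_eq_convexHull hp hM hT hball
  refine ⟨?_, ⟨fun v _ => mem_extremePoints hp hM hT hball v,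
    (hT.injective hp hM).injOn, ?_⟩,
    fun a b => ⟨isPolyhedronEdge_of_adj hp hM hT hball, adj_of_isPolyhedronEdge hp hM hT hball⟩⟩
  · rw [hPeq]
    exact (Set.finite_range φ).isCompact_convexHull ℝ
  · rw [Set.SurjOn, hPeq, Set.image_univ]
    exact extremePoints_convexHull_subset

theorem mem_polyhedronSpace [Nonempty V] : T ∈ polyhedronSpace M := by
  obtain ⟨h1, h2⟩ := isCompact_and_isOneSkeleton hp hM hT hball
  exact ⟨h1, φ, h2, fun f v hv => hT.eq v f hv⟩

end IsExactIncidence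

end

/-! ### Minimal degree, and the faces after adding a chord -/

section

/-- Removing all neighbours of a vertex with at most two of them would cut it off from some fourth
vertex. -/
theorem SimpleGraph.IsThreeConnected.three_le_ncard_neighborSet {V : Type*} [Finite V]
    {G : SimpleGraph V} (h : G.IsThreeConnected) (v : V) : 3 ≤ (G.neighborSet v).ncard := by
  by_contra! hlt
  have hconn := h.2 (G.neighborSet v) (by omega)
  have hv : v ∈ (G.neighborSet v)ᶜ := by simp
  obtain ⟨y, hy⟩ : ∃ y, y ∉ insert v (G.neighborSet v) := by
    by_contra! hall
    have h1 := Set.ncard_insert_le v (G.neighborSet v)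
    rw [Set.eq_univ_of_forall hall, Set.ncard_univ] at h1
    have := h.1
    omega
  rw [Set.mem_insert_iff, not_or] at hy
  obtain ⟨walk⟩ := hconn.preconnected ⟨v, hv⟩ ⟨y, hy.2⟩
  cases walk with
  | nil => exact hy.1 rfl
  | @cons _ x _ hadj _ => exact x.2 hadj

namespace RotationSystem

variable {V : Type*} {G : SimpleGraph V}

/-- The neighbours of a vertex form a single orbit of the rotation; a fixed point of its square
would leave at most two of them. -/
theorem hasMinDegreeThree_of_three_le [Finite V] (M : RotationSystem G)
    (h : ∀ v, 3 ≤ (G.neighborSet v).ncard) : M.HasMinDegreeThree := by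
  refine ⟨fun v => ?_, fun v x hx hrr => ?_⟩
  · have h3 := h v
    exact Set.nonempty_of_ncard_ne_zero (s := G.neighborSet v) (by omega)
  · have hsub : G.neighborSet v ⊆ {x, M.rot v x} := by
      intro y hy
      obtain ⟨k, -, rfl⟩ := ((M.isCycleOn v).2 hx hy).exists_pow_eq'
      clear hy
      induction k with
      | zero => simp
      | succ k ih =>
        rw [pow_succ', Equiv.Perm.mul_apply]
        rcases ih with ih | ih
        · rw [ih]; right; rfl
        · rw [ih, hrr]; left; rfl
    have h1 := Set.ncard_le_ncard hsub
    have h2 := Set.ncard_insert_le x {M.rot v x}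
    rw [Set.ncard_singleton] at h2
    have h3 := h v
    omega

/-- Faces are the orbits of a permutation of a finite set, so forward steps alone connect any two
directed edges of a face. -/
theorem exists_iterate_next_eq [Finite V] {M : RotationSystem G} {a b : G.Dart}
    (h : M.face a = M.face b) : ∃ k : ℕ, (M.next)^[k] a = b := by
  have hfin : Finite G.Dart :=
    Finite.of_injective (fun d : G.Dart => d.toProd) SimpleGraph.Dart.toProd_injective
  let σ : Equiv.Perm G.Dart := ⟨M.next, M.prev, prev_next, next_prev⟩
  have hcyc : σ.SameCycle a b := by
    have hgen := Quot.eqvGen_exact h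
    clear h
    induction hgen with
    | rel a b hab =>
      rw [faceStep_iff] at hab
      subst hab
      exact ⟨1, rfl⟩
    | refl a => exact Equiv.Perm.SameCycle.refl _ _
    | symm a b h ih => exact ih.symm
    | trans a b d h1 h2 ih1 ih2 => exact ih1.trans ih2
  obtain ⟨k, -, hk⟩ := hcyc.exists_pow_eq'
  exact ⟨k, by rw [← hk, ← Equiv.Perm.iterate_eq_pow]; rfl⟩

/-- Walking around a face visits all its directed edges. -/
theorem mem_of_face_eq [Finite V] {M : RotationSystem G} {B : Set G.Dart}
    (hB : ∀ a ∈ B, M.next a ∈ B) {a b : G.Dart} (h : M.face a = M.face b) (ha : a ∈ B) :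
    b ∈ B := by
  obtain ⟨k, rfl⟩ := exists_iterate_next_eq h
  clear h
  induction k with
  | zero => exact ha
  | succ k ih => rw [Function.iterate_succ_apply']; exact hB _ ih

variable [DecidableEq V] {d₁ d₂ : G.Dart}

section ChordDart

variable (hne : d₁.snd ≠ d₂.snd)

/-- The added edge, directed from the head of `d₁` to the head of `d₂`. -/
def chordDart : (chordGraph d₁ d₂).Dart :=
  ⟨(d₁.snd, d₂.snd), Or.inr ((SimpleGraph.edge_adj _ _ _ _).2 ⟨Or.inl ⟨rfl, rfl⟩, hne⟩)⟩

omit [DecidableEq V] in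
theorem dart_cases (d : (chordGraph d₁ d₂).Dart) :
    (∃ d₀ : G.Dart, d = oldDart d₀) ∨ d = chordDart hne ∨ d = (chordDart hne).symm := by
  obtain ⟨⟨a, b⟩, h⟩ := d
  rcases h with h | h
  · exact Or.inl ⟨⟨(a, b), h⟩, rfl⟩
  · rw [SimpleGraph.edge_adj] at h
    rcases h.1 with ⟨h1, h2⟩ | ⟨h1, h2⟩
    · right; left
      exact SimpleGraph.Dart.ext _ _ (Prod.ext h1 h2)
    · right; right
      exact SimpleGraph.Dart.ext _ _ (Prod.ext h1 h2)

end ChordDart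

variable [Finite V] (M : RotationSystem G) (hne : d₁.snd ≠ d₂.snd)
  (hadj : ¬ G.Adj d₁.snd d₂.snd)

local notation "𝒩" => addChord M d₁ d₂ hne hadj

theorem addChord_rot_left (x : V) :
    (𝒩).rot d₁.snd x = M.rot d₁.snd (Equiv.swap d₁.fst d₂.snd x) := by
  simp [addChord]

theorem addChord_rot_right (x : V) :
    (𝒩).rot d₂.snd x = M.rot d₂.snd (Equiv.swap d₂.fst d₁.snd x) := by
  simp [addChord, hne.symm]

theorem addChord_rot_of_ne {v : V} (h1 : v ≠ d₁.snd) (h2 : v ≠ d₂.snd) (x : V) :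
    (𝒩).rot v x = M.rot v x := by
  simp [addChord, h1, h2]

/-- The chord alters face walks only at its ends: after `d₁` the walk takes the chord and continues
as it formerly did after `d₂`; after `d₂` it takes the reversed chord and continues as after `d₁`.
The four lemmas below are these exceptional steps. -/
theorem next_oldDart {d : G.Dart} (h1 : d ≠ d₁) (h2 : d ≠ d₂) :
    (𝒩).next (oldDart d) = oldDart (M.next d) := by
  apply SimpleGraph.Dart.ext
  refine Prod.ext rfl ?_
  change (𝒩).rot d.snd d.fst = M.rot d.snd d.fst
  have hd := d.adj
  by_cases e1 : d.snd = d₁.snd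
  · have hf : d.fst ≠ d₁.fst := fun hf => h1 (SimpleGraph.Dart.ext _ _ (Prod.ext hf e1))
    have hw : d.fst ≠ d₂.snd := fun hw => hadj (by rw [← e1, ← hw]; exact hd.symm)
    rw [e1, addChord_rot_left, Equiv.swap_apply_of_ne_of_ne hf hw]
  by_cases e2 : d.snd = d₂.snd
  · have hf : d.fst ≠ d₂.fst := fun hf => h2 (SimpleGraph.Dart.ext _ _ (Prod.ext hf e2))
    have hw : d.fst ≠ d₁.snd := fun hw => hadj (by rw [← e2, ← hw]; exact hd)
    rw [e2, addChord_rot_right, Equiv.swap_apply_of_ne_of_ne hf hw]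
  · rw [addChord_rot_of_ne M hne hadj e1 e2]

theorem next_oldDart_left : (𝒩).next (oldDart d₁) = chordDart hne := by
  apply SimpleGraph.Dart.ext
  refine Prod.ext rfl ?_
  change (𝒩).rot d₁.snd d₁.fst = d₂.snd
  rw [addChord_rot_left, Equiv.swap_apply_left, M.fixes _ _ hadj]

theorem next_oldDart_right : (𝒩).next (oldDart d₂) = (chordDart hne).symm := by
  apply SimpleGraph.Dart.ext
  refine Prod.ext rfl ?_
  change (𝒩).rot d₂.snd d₂.fst = d₁.snd
  rw [addChord_rot_right, Equiv.swap_apply_left, M.fixes _ _ fun h => hadj h.symm]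

theorem next_chordDart : (𝒩).next (chordDart hne) = oldDart (M.next d₂) := by
  apply SimpleGraph.Dart.ext
  refine Prod.ext rfl ?_
  change (𝒩).rot d₂.snd d₁.snd = M.rot d₂.snd d₂.fst
  rw [addChord_rot_right, Equiv.swap_apply_right]

theorem next_chordDart_symm : (𝒩).next (chordDart hne).symm = oldDart (M.next d₁) := by
  apply SimpleGraph.Dart.ext
  refine Prod.ext rfl ?_
  change (𝒩).rot d₁.snd d₂.snd = M.rot d₁.snd d₁.fst
  rw [addChord_rot_left, Equiv.swap_apply_right]

variable (hface : M.face d₁ = M.face d₂)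

open Classical in
/-- The face of the graph without the chord to which a directed edge of the graph with the chord
belongs; the chord is sent to the face that it cuts. -/
noncomputable def chordDartFace (d : (chordGraph d₁ d₂).Dart) : M.Face :=
  if h : G.Adj d.fst d.snd then M.face ⟨d.toProd, h⟩ else M.face d₁

omit [DecidableEq V] [Finite V] in
theorem chordDartFace_oldDart (d : G.Dart) :
    M.chordDartFace (oldDart (d₁ := d₁) (d₂ := d₂) d) = M.face d :=
  dif_pos d.adj

omit [DecidableEq V] [Finite V] in
theorem chordDartFace_chordDart (hadj : ¬ G.Adj d₁.snd d₂.snd) :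
    M.chordDartFace (chordDart hne) = M.face d₁ :=
  dif_neg hadj

omit [DecidableEq V] [Finite V] in
theorem chordDartFace_chordDart_symm (hadj : ¬ G.Adj d₁.snd d₂.snd) :
    M.chordDartFace (chordDart hne).symm = M.face d₁ :=
  dif_neg fun h => hadj h.symm

/-- The face of the graph without the chord which contains a given face of the graph with it. -/
noncomputable def chordFaceMap : (𝒩).Face → M.Face :=
  Quot.lift M.chordDartFace (by
    intro d d' hdd'
    rw [faceStep_iff] at hdd'
    subst hdd'
    rcases dart_cases hne d with ⟨d₀, rfl⟩ | rfl | rfl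
    · by_cases h1 : d₀ = d₁
      · subst h1
        rw [next_oldDart_left, chordDartFace_oldDart, chordDartFace_chordDart M hne hadj]
      by_cases h2 : d₀ = d₂
      · subst h2
        rw [next_oldDart_right, chordDartFace_oldDart, chordDartFace_chordDart_symm M hne hadj,
          hface]
      rw [next_oldDart M hne hadj h1 h2, chordDartFace_oldDart, chordDartFace_oldDart, face_next]
    · rw [next_chordDart, chordDartFace_chordDart M hne hadj, chordDartFace_oldDart, face_next,
        hface]
    · rw [next_chordDart_symm, chordDartFace_chordDart_symm M hne hadj, chordDartFace_oldDart,
        face_next])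

local notation "𝒸" => chordFaceMap M hne hadj hface

theorem chordFaceMap_oldDart (d : G.Dart) : 𝒸 ((𝒩).face (oldDart d)) = M.face d :=
  M.chordDartFace_oldDart d

theorem chordFaceMap_chordDart : 𝒸 ((𝒩).face (chordDart hne)) = M.face d₁ :=
  M.chordDartFace_chordDart hne hadj

theorem chordFaceMap_chordDart_symm : 𝒸 ((𝒩).face (chordDart hne).symm) = M.face d₁ :=
  M.chordDartFace_chordDart_symm hne hadj

theorem face_oldDart_left : (𝒩).face (oldDart d₁) = (𝒩).face (chordDart hne) := by
  rw [← face_next (oldDart d₁), next_oldDart_left]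

theorem face_oldDart_right : (𝒩).face (oldDart d₂) = (𝒩).face (chordDart hne).symm := by
  rw [← face_next (oldDart d₂), next_oldDart_right]

theorem exists_face_oldDart_eq (f : (𝒩).Face) : ∃ d : G.Dart, (𝒩).face (oldDart d) = f := by
  obtain ⟨d, rfl⟩ := exists_face_eq f
  rcases dart_cases hne d with ⟨d₀, rfl⟩ | rfl | rfl
  · exact ⟨d₀, rfl⟩
  · exact ⟨d₁, face_oldDart_left M hne hadj⟩
  · exact ⟨d₂, face_oldDart_right M hne hadj⟩

/-- One of the two faces adjacent to the chord. -/
def IsChordFace (f : (𝒩).Face) : Prop :=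
  f = (𝒩).face (chordDart hne) ∨ f = (𝒩).face (chordDart hne).symm

/-- Consecutive old directed edges stay on one face except after `d₁` and `d₂`, where both lie on
faces adjacent to the chord. The alternative propagates along the equivalence defining a face. -/
theorem eq_or_isChordFace_of_chordFaceMap_eq {f g : (𝒩).Face} (h : 𝒸 f = 𝒸 g) :
    f = g ∨ IsChordFace M hne hadj f ∧ IsChordFace M hne hadj g := by
  have key : ∀ a b : G.Dart, M.face a = M.face b →
      (𝒩).face (oldDart a) = (𝒩).face (oldDart b) ∨
        IsChordFace M hne hadj ((𝒩).face (oldDart a)) ∧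
          IsChordFace M hne hadj ((𝒩).face (oldDart b)) := by
    intro a b hab
    have hgen := Quot.eqvGen_exact hab
    clear hab
    induction hgen with
    | rel a b hab =>
      rw [faceStep_iff] at hab
      subst hab
      by_cases h1 : a = d₁
      · subst h1
        rw [← next_chordDart_symm M hne hadj, face_next, face_oldDart_left]
        exact Or.inr ⟨Or.inl rfl, Or.inr rfl⟩
      by_cases h2 : a = d₂
      · subst h2
        rw [← next_chordDart M hne hadj, face_next, face_oldDart_right]
        exact Or.inr ⟨Or.inr rfl, Or.inl rfl⟩
      · rw [← next_oldDart M hne hadj h1 h2, face_next]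
        exact Or.inl rfl
    | refl a => exact Or.inl rfl
    | symm a b h ih =>
      rcases ih with h | h
      · exact Or.inl h.symm
      · exact Or.inr h.symm
    | trans a b d h1 h2 ih1 ih2 =>
      rcases ih1 with h | h
      · rw [h]; exact ih2
      · rcases ih2 with h' | h'
        · rw [← h']; exact Or.inr h
        · exact Or.inr ⟨h.1, h'.2⟩
  obtain ⟨a, rfl⟩ := exists_face_oldDart_eq M hne hadj f
  obtain ⟨b, rfl⟩ := exists_face_oldDart_eq M hne hadj g
  rw [chordFaceMap_oldDart, chordFaceMap_oldDart] at h
  exact key a b h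

include hface in
/-- A chord cuts a face into two faces. -/
theorem face_chordDart_ne : (𝒩).face (chordDart hne) ≠ (𝒩).face (chordDart hne).symm := by
  classical
  have hd12 : d₁ ≠ d₂ := fun h => hne (congrArg (fun d : G.Dart => d.snd) h)
  have hreach : ∃ k : ℕ, (M.next)^[k] d₁ = d₂ := exists_iterate_next_eq hface
  -- The old face is cut at `d₁` and at the first subsequent visit to `d₂`. `A₀` collects the steps
  -- 0, …, k - 1 from `d₁`, and `A` the steps 1, …, k.
  obtain ⟨k, hk, hmin⟩ : ∃ k : ℕ, (M.next)^[k] d₁ = d₂ ∧ ∀ j < k, (M.next)^[j] d₁ ≠ d₂ :=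
    ⟨Nat.find hreach, Nat.find_spec hreach, fun j hj => Nat.find_min hreach hj⟩
  have hinj : Function.Injective M.next := fun a b hab => by
    rw [← prev_next (M := M) a, hab, prev_next]
  let A₀ : G.Dart → Prop := fun d => ∃ i < k, (M.next)^[i] d₁ = d
  let A : G.Dart → Prop := fun d => ∃ i < k, (M.next)^[i + 1] d₁ = d
  have hk0 : 0 < k := by
    rcases Nat.eq_zero_or_pos k with h | h
    · subst h; exact absurd hk hd12
    · exact h
  have hA1 : ¬ A d₁ := by
    rintro ⟨i, hi, h⟩
    refine hmin (k - (i + 1)) (by omega) ?_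
    have : (M.next)^[(k - (i + 1)) + (i + 1)] d₁ = d₂ := by
      rw [Nat.sub_add_cancel (by omega)]; exact hk
    rwa [Function.iterate_add_apply, h] at this
  have hA2 : A d₂ := ⟨k - 1, by omega, by rw [Nat.sub_add_cancel hk0]; exact hk⟩
  have hA01 : A₀ d₁ := ⟨0, hk0, rfl⟩
  have hA02 : ¬ A₀ d₂ := fun ⟨i, hi, h⟩ => hmin i hi h
  have hnext : ∀ d, A (M.next d) ↔ A₀ d := by
    intro d
    refine exists_congr fun i => and_congr_right fun _ => ?_
    rw [Function.iterate_succ_apply']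
    exact hinj.eq_iff
  have hAA : ∀ d, d ≠ d₁ → d ≠ d₂ → (A d ↔ A₀ d) := by
    intro d h1 h2
    constructor
    · rintro ⟨i, hi, h⟩
      refine ⟨i + 1, lt_of_le_of_ne hi ?_, h⟩
      intro hik
      rw [hik, hk] at h
      exact h2 h.symm
    · rintro ⟨i, hi, h⟩
      cases i with
      | zero => exact absurd h.symm h1
      | succ i => exact ⟨i, by omega, h⟩
  -- The arc `A` closed up by the reversed chord is stable under the new face steps in both
  -- directions and does not contain the chord itself, so it separates the two faces.
  let Q : (chordGraph d₁ d₂).Dart → Prop :=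
    fun d => d = (chordDart hne).symm ∨ ∃ d₀, A d₀ ∧ d = oldDart d₀
  have hchord_old : ∀ d₀ : G.Dart, chordDart hne ≠ oldDart d₀ := fun d₀ h => by
    have h1 := d₀.adj
    have h2 : (chordDart hne).toProd = d₀.toProd := congrArg SimpleGraph.Dart.toProd h
    rw [← h2] at h1
    exact hadj h1
  have hchord_old' : ∀ d₀ : G.Dart, (chordDart hne).symm ≠ oldDart d₀ := fun d₀ h => by
    have h1 := d₀.adj
    have h2 : (chordDart hne).symm.toProd = d₀.toProd := congrArg SimpleGraph.Dart.toProd h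
    rw [← h2] at h1
    exact hadj h1.symm
  have holdinj : ∀ a b : G.Dart, oldDart (d₁ := d₁) (d₂ := d₂) a = oldDart b → a = b :=
    fun a b h => SimpleGraph.Dart.ext _ _ (congrArg (fun d : (chordGraph d₁ d₂).Dart => d.toProd) h)
  have hQold : ∀ d₀, Q (oldDart d₀) ↔ A d₀ := by
    intro d₀
    constructor
    · rintro (h | ⟨d, hd, h⟩)
      · exact absurd h.symm (hchord_old' d₀)
      · rw [holdinj _ _ h]; exact hd
    · exact fun h => Or.inr ⟨d₀, h, rfl⟩
  have hQ1 : ¬ Q (chordDart hne) := by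
    rintro (h | ⟨d, hd, h⟩)
    · exact SimpleGraph.Dart.symm_ne _ h.symm
    · exact hchord_old d h
  have hQ2 : Q (chordDart hne).symm := Or.inl rfl
  have hstep : ∀ d d', (𝒩).FaceStep d d' → Q d = Q d' := by
    intro d d' h
    rw [faceStep_iff] at h
    subst h
    rw [eq_iff_iff]
    rcases dart_cases hne d with ⟨d₀, rfl⟩ | rfl | rfl
    · by_cases h1 : d₀ = d₁
      · subst h1
        rw [next_oldDart_left, hQold]
        exact iff_of_false hA1 hQ1
      by_cases h2 : d₀ = d₂
      · subst h2
        rw [next_oldDart_right, hQold]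
        exact iff_of_true hA2 hQ2
      · rw [next_oldDart M hne hadj h1 h2, hQold, hQold, hnext, hAA _ h1 h2]
    · rw [next_chordDart, hQold, hnext]
      exact iff_of_false hQ1 hA02
    · rw [next_chordDart_symm, hQold, hnext]
      exact iff_of_true hQ2 hA01
  intro h
  have : Q (chordDart hne) = Q (chordDart hne).symm := congrArg (Quot.lift Q hstep) h
  exact hQ1 (this ▸ hQ2)

theorem inc_chordFaceMap {v : V} {f : (𝒩).Face} (h : (𝒩).inc v f) : M.inc v (𝒸 f) := by
  obtain ⟨d, rfl, rfl⟩ := h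
  rcases dart_cases hne d with ⟨d₀, rfl⟩ | rfl | rfl
  · rw [chordFaceMap_oldDart]; exact inc_fst d₀
  · rw [chordFaceMap_chordDart]; exact inc_snd d₁
  · rw [chordFaceMap_chordDart_symm, hface]; exact inc_snd d₂

theorem exists_inc_of_inc {v : V} {f' : M.Face} (h : M.inc v f') :
    ∃ f : (𝒩).Face, 𝒸 f = f' ∧ (𝒩).inc v f := by
  obtain ⟨d, rfl, rfl⟩ := h
  exact ⟨(𝒩).face (oldDart d), chordFaceMap_oldDart M hne hadj hface d, inc_fst (M := 𝒩) (oldDart d)⟩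

theorem chordFaceMap_surjective : Function.Surjective 𝒸 := by
  intro f
  obtain ⟨d, rfl⟩ := exists_face_eq f
  exact ⟨_, chordFaceMap_oldDart M hne hadj hface d⟩

include hface in
-- If each of the two faces had an old directed edge ending at `v`, both edges would belong to the
-- same old face; simplicity would identify them, and hence the two faces. So one of the faces
-- reaches `v` along the chord.
theorem eq_or_eq_of_inc_chordFaces (hs : M.HasSimpleFaces) {v : V}
    (h1 : (𝒩).inc v ((𝒩).face (chordDart hne))) (h2 : (𝒩).inc v ((𝒩).face (chordDart hne).symm)) :
    v = d₁.snd ∨ v = d₂.snd := by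
  obtain ⟨a, ha, rfl⟩ := h1.exists_snd
  obtain ⟨b, hb, hab⟩ := h2.exists_snd
  rcases dart_cases hne a with ⟨a₀, rfl⟩ | rfl | rfl
  · rcases dart_cases hne b with ⟨b₀, rfl⟩ | rfl | rfl
    · exfalso
      have e1 := congrArg 𝒸 ha
      have e2 := congrArg 𝒸 hb
      rw [chordFaceMap_oldDart, chordFaceMap_chordDart] at e1
      rw [chordFaceMap_oldDart, chordFaceMap_chordDart_symm] at e2
      have : a₀ = b₀ := hs a₀ b₀ (e1.trans e2.symm) hab.symm
      subst this
      exact face_chordDart_ne M hne hadj hface (ha.symm.trans hb)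
    · exact Or.inr hab.symm
    · exact Or.inl hab.symm
  · exact Or.inr rfl
  · exact Or.inl rfl

include hface in
theorem IsChordFace.eq_or_eq_of_inc {f g : (𝒩).Face} (hf : IsChordFace M hne hadj f)
    (hg : IsChordFace M hne hadj g) (hfg : f ≠ g) (hs : M.HasSimpleFaces) {v : V}
    (h1 : (𝒩).inc v f) (h2 : (𝒩).inc v g) : v = d₁.snd ∨ v = d₂.snd := by
  rcases hf with rfl | rfl <;> rcases hg with rfl | rfl
  · exact absurd rfl hfg
  · exact eq_or_eq_of_inc_chordFaces M hne hadj hface hs h1 h2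
  · exact eq_or_eq_of_inc_chordFaces M hne hadj hface hs h2 h1
  · exact absurd rfl hfg

include hface in
-- Faces with different images under `chordFaceMap` inherit everything from `M`. Distinct faces with
-- the same image are the two sides of the chord, and these meet only at its ends.
theorem IsPolyhedral.addChord (hp : M.IsPolyhedral) (hs : M.HasSimpleFaces) :
    (𝒩).IsPolyhedral := by
  refine ⟨fun d => ?_, fun f g hfg a b z hab haf hbf hzf hag hbg hzg => ?_,
    fun f g hfg a b hab haf hbf hag hbg => ?_⟩
  · rcases dart_cases hne d with ⟨d₀, rfl⟩ | rfl | rfl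
    · intro h
      have := congrArg 𝒸 h
      change 𝒸 ((𝒩).face (oldDart d₀)) = 𝒸 ((𝒩).face (oldDart d₀.symm)) at this
      rw [chordFaceMap_oldDart, chordFaceMap_oldDart] at this
      exact hp.face_ne_face_symm d₀ this
    · exact face_chordDart_ne M hne hadj hface
    · rw [SimpleGraph.Dart.symm_symm]
      exact (face_chordDart_ne M hne hadj hface).symm
  · by_cases hc : 𝒸 f = 𝒸 g
    · obtain ⟨h1, h2⟩ :=
        (eq_or_isChordFace_of_chordFaceMap_eq M hne hadj hface hc).resolve_left hfg
      have ha := h1.eq_or_eq_of_inc M hne hadj hface h2 hfg hs haf hag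
      have hb := h1.eq_or_eq_of_inc M hne hadj hface h2 hfg hs hbf hbg
      have hz := h1.eq_or_eq_of_inc M hne hadj hface h2 hfg hs hzf hzg
      grind
    · have i := fun {v : V} {f : (𝒩).Face} (h : (𝒩).inc v f) => inc_chordFaceMap M hne hadj hface h
      exact hp.facesMeetInPairs _ _ hc a b z hab (i haf) (i hbf) (i hzf) (i hag) (i hbg) (i hzg)
  · by_cases hc : 𝒸 f = 𝒸 g
    · obtain ⟨h1, h2⟩ :=
        (eq_or_isChordFace_of_chordFaceMap_eq M hne hadj hface hc).resolve_left hfg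
      have ha := h1.eq_or_eq_of_inc M hne hadj hface h2 hfg hs haf hag
      have hb := h1.eq_or_eq_of_inc M hne hadj hface h2 hfg hs hbf hbg
      right
      rw [SimpleGraph.edge_adj]
      grind
    · have i := fun {v : V} {f : (𝒩).Face} (h : (𝒩).inc v f) => inc_chordFaceMap M hne hadj hface h
      exact Or.inl (hp.adj _ _ hc a b hab (i haf) (i hbf) (i hag) (i hbg))

theorem hasMinDegreeThree_addChord (h : ∀ v, 3 ≤ (G.neighborSet v).ncard) :
    (𝒩).HasMinDegreeThree := by
  refine hasMinDegreeThree_of_three_le _ fun v => (h v).trans (Set.ncard_le_ncard ?_)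
  intro x hx
  exact Or.inl hx

theorem inc_rot_chordDart_symm :
    (𝒩).inc (M.rot d₁.snd d₁.fst) ((𝒩).face (chordDart hne).symm) := by
  rw [← face_next, next_chordDart_symm]
  exact inc_snd (M := 𝒩) (oldDart (M.next d₁))

end RotationSystem

end

/-! ### The incidence equations and their differential -/

section

section IncidenceMap

variable {V F : Type*} [Fintype V] [Fintype F]

/-- The equations expressing that `φ v` lies on the plane with unit normal `(e f).1` and offset
`(e f).2`, for all `(v, f)` in `s`. -/
noncomputable def incidenceMap (s : Set (V × F)) (y : (F → Space3 × ℝ) × (V → Space3)) :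
    (F → ℝ) × (s → ℝ) :=
  (fun f => inner ℝ (y.1 f).1 (y.1 f).1 - 1,
    fun p => inner ℝ (y.1 p.1.2).1 (y.2 p.1.1) - (y.1 p.1.2).2)

omit [Fintype V] [Fintype F] in
theorem incidenceMap_eq_zero_iff {s : Set (V × F)} {y : (F → Space3 × ℝ) × (V → Space3)} :
    incidenceMap s y = 0 ↔ (∀ f, ‖(y.1 f).1‖ = 1) ∧
      ∀ v f, (v, f) ∈ s → inner ℝ (y.1 f).1 (y.2 v) = (y.1 f).2 := by
  simp only [incidenceMap, Prod.ext_iff, funext_iff, Prod.fst_zero, Prod.snd_zero, Pi.zero_apply,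
    sub_eq_zero, real_inner_self_eq_norm_sq, Subtype.forall, Prod.forall]
  refine and_congr (forall_congr' fun f => ?_) Iff.rfl
  exact pow_eq_one_iff_of_nonneg (norm_nonneg _) two_ne_zero

theorem contDiff_incidenceMap (s : Set (V × F)) [Fintype s] : ContDiff ℝ ∞ (incidenceMap s) := by
  unfold incidenceMap
  refine ContDiff.prodMk (contDiff_pi.2 fun f => ?_) (contDiff_pi.2 fun p => ?_)
  · have h : ContDiff ℝ ∞ fun y : (F → Space3 × ℝ) × (V → Space3) => (y.1 f).1 := by fun_prop
    exact (h.inner ℝ h).sub contDiff_const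
  · have h : ContDiff ℝ ∞ fun y : (F → Space3 × ℝ) × (V → Space3) => (y.1 p.1.2).1 := by fun_prop
    have h' : ContDiff ℝ ∞ fun y : (F → Space3 × ℝ) × (V → Space3) => y.2 p.1.1 := by fun_prop
    exact (h.inner ℝ h').sub (by fun_prop)

theorem hasFDerivAt_inner_normal_vertex (v : V) (f : F) (y : (F → Space3 × ℝ) × (V → Space3)) :
    ∃ A : ((F → Space3 × ℝ) × (V → Space3)) →L[ℝ] ℝ,
      HasFDerivAt (fun y : (F → Space3 × ℝ) × (V → Space3) =>
        inner ℝ (y.1 f).1 (y.2 v) - (y.1 f).2) A y ∧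
      ∀ d, A d = inner ℝ (d.1 f).1 (y.2 v) + inner ℝ (y.1 f).1 (d.2 v) - (d.1 f).2 := by
  let a : ((F → Space3 × ℝ) × (V → Space3)) →L[ℝ] Space3 × ℝ :=
    (ContinuousLinearMap.proj f).comp (ContinuousLinearMap.fst ℝ _ _)
  let b : ((F → Space3 × ℝ) × (V → Space3)) →L[ℝ] Space3 :=
    (ContinuousLinearMap.proj v).comp (ContinuousLinearMap.snd ℝ _ _)
  let a1 := (ContinuousLinearMap.fst ℝ Space3 ℝ).comp a
  let a2 := (ContinuousLinearMap.snd ℝ Space3 ℝ).comp a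
  refine ⟨_, (a1.hasFDerivAt.inner ℝ b.hasFDerivAt).sub a2.hasFDerivAt, fun d => ?_⟩
  simp [fderivInnerCLM_apply, a1, a2, a, b]
  ring

theorem hasFDerivAt_inner_normal_self (f : F) (y : (F → Space3 × ℝ) × (V → Space3)) :
    ∃ A : ((F → Space3 × ℝ) × (V → Space3)) →L[ℝ] ℝ,
      HasFDerivAt (fun y : (F → Space3 × ℝ) × (V → Space3) =>
        inner ℝ (y.1 f).1 (y.1 f).1 - 1) A y ∧
      ∀ d, A d = 2 * inner ℝ (y.1 f).1 (d.1 f).1 := by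
  let a : ((F → Space3 × ℝ) × (V → Space3)) →L[ℝ] Space3 × ℝ :=
    (ContinuousLinearMap.proj f).comp (ContinuousLinearMap.fst ℝ _ _)
  let a1 := (ContinuousLinearMap.fst ℝ Space3 ℝ).comp a
  refine ⟨_, (a1.hasFDerivAt.inner ℝ a1.hasFDerivAt).sub_const _, fun d => ?_⟩
  simp [fderivInnerCLM_apply, a1, a, real_inner_comm]
  ring

theorem fderiv_incidenceMap_apply (s : Set (V × F)) [Fintype s]
    (y d : (F → Space3 × ℝ) × (V → Space3)) :
    fderiv ℝ (incidenceMap s) y d =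
      (fun f => 2 * inner ℝ (y.1 f).1 (d.1 f).1,
        fun p => inner ℝ (d.1 p.1.2).1 (y.2 p.1.1) + inner ℝ (y.1 p.1.2).1 (d.2 p.1.1)
          - (d.1 p.1.2).2) := by
  choose A hA hA' using fun f => hasFDerivAt_inner_normal_self (V := V) f y
  choose B hB hB' using fun p : s => hasFDerivAt_inner_normal_vertex p.1.1 p.1.2 y
  have h : HasFDerivAt (incidenceMap s) ((ContinuousLinearMap.pi A).prod
      (ContinuousLinearMap.pi B)) y :=
    (hasFDerivAt_pi.2 hA).prodMk (hasFDerivAt_pi.2 hB)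
  rw [h.fderiv]
  ext i
  · exact hA' i d
  · exact hB' i d

/-- There are no nonzero self-stresses supported on `s`. -/
def StressFree (s : Set (V × F)) (e : F → Space3 × ℝ) (φ : V → Space3) : Prop :=
  ∀ c : V → F → ℝ, (∀ v f, c v f ≠ 0 → (v, f) ∈ s) → (∀ v, ∑ f, c v f • (e f).1 = 0) →
    (∀ f, ∑ v, c v f = 0) → (∀ f, ∑ v, c v f • φ v = 0) → c = 0

theorem StressFree.mono {s t : Set (V × F)} {e : F → Space3 × ℝ} {φ : V → Space3}
    (h : StressFree t e φ) (hst : s ⊆ t) : StressFree s e φ :=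
  fun c hc => h c fun v f hvf => hst (hc v f hvf)

/-- A functional vanishing on the image has coefficients `μ` on the normalization equations and `cc`
on the incidences. Testing it on variations of vertices, offsets and normals shows that `cc` is a
stress, up to a term 2 μ_f n_f in the balance on each face. Once this term is known to vanish, so
does `cc`. -/
theorem StressFree.fderiv_surjective {s : Set (V × F)} [Fintype s]
    {y : (F → Space3 × ℝ) × (V → Space3)} (hs : StressFree s y.1 y.2) (hy : incidenceMap s y = 0) :
    Function.Surjective (fderiv ℝ (incidenceMap s) y) := by
  classical
  obtain ⟨hunit, hinc⟩ := incidenceMap_eq_zero_iff.1 hy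
  rw [← ContinuousLinearMap.coe_coe, ← LinearMap.range_eq_top]
  by_contra hne
  obtain ⟨l, hl0, hl⟩ := Submodule.exists_le_ker_of_lt_top _ (lt_top_iff_ne_top.2 hne)
  let μ : F → ℝ := fun f => l (Pi.single f 1, 0)
  let lam : s → ℝ := fun p => l (0, Pi.single p 1)
  have hlin : ∀ a b, l (a, b) = ∑ f, a f * μ f + ∑ p, b p * lam p := by
    intro a b
    have h1 : ((a, b) : (F → ℝ) × (s → ℝ)) =
        ∑ f, a f • ((Pi.single f 1, 0) : (F → ℝ) × (s → ℝ)) +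
          ∑ p, b p • ((0, Pi.single p 1) : (F → ℝ) × (s → ℝ)) := by
      ext i
      · simp [Prod.fst_sum, Finset.sum_apply, Pi.single_apply]
      · simp [Prod.snd_sum, Finset.sum_apply, Pi.single_apply]
    rw [h1, map_add, map_sum, map_sum]
    simp only [map_smul, smul_eq_mul, μ, lam]
  let cc : V → F → ℝ := fun v f => if h : (v, f) ∈ s then lam ⟨(v, f), h⟩ else 0
  have hsum : ∀ b : V × F → ℝ, ∑ p : s, b p * lam p = ∑ v, ∑ f, cc v f * b (v, f) := by
    intro b
    rw [← Fintype.sum_prod_type' (f := fun v f => cc v f * b (v, f)),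
      ← Finset.sum_subset (Finset.subset_univ s.toFinset)]
    · rw [← Finset.sum_coe_sort s.toFinset]
      refine Fintype.sum_equiv (Equiv.subtypeEquivRight fun p => by simp) _ _ fun p => ?_
      have : cc p.1.1 p.1.2 = lam p := dif_pos p.2
      simp [this, mul_comm]
    · intro p _ hp
      have : cc p.1 p.2 = 0 := dif_neg (by simpa using hp)
      rw [this, zero_mul]
  have hzero : ∀ d : (F → Space3 × ℝ) × (V → Space3),
      ∑ f, 2 * inner ℝ (y.1 f).1 (d.1 f).1 * μ f + ∑ v, ∑ f, cc v f *
        (inner ℝ (d.1 f).1 (y.2 v) + inner ℝ (y.1 f).1 (d.2 v) - (d.1 f).2) = 0 := by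
    intro d
    have h : l (fderiv ℝ (incidenceMap s) y d) = 0 := hl ⟨d, rfl⟩
    rw [fderiv_incidenceMap_apply, hlin] at h
    rw [← h, hsum fun p => inner ℝ (d.1 p.2).1 (y.2 p.1) + inner ℝ (y.1 p.2).1 (d.2 p.1)
          - (d.1 p.2).2]
  have hv : ∀ v, ∑ f, cc v f • (y.1 f).1 = 0 := by
    intro v
    refine ext_inner_right ℝ fun x => ?_
    have h := hzero (0, Pi.single v x)
    rw [inner_zero_left, sum_inner, ← h, Finset.sum_eq_single v]
    · simp [inner_smul_left]
    · intro w _ hw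
      simp [hw]
    · simp
  have hf : ∀ f, ∑ v, cc v f = 0 := by
    intro f
    have h := hzero (Pi.single f (0, -1), 0)
    rw [← h, Finset.sum_eq_zero (s := Finset.univ) (f := fun g => 2 * _ * μ g), zero_add]
    · refine Finset.sum_congr rfl fun v _ => ?_
      rw [Finset.sum_eq_single f]
      · simp
      · intro g _ hg
        simp [hg]
      · simp
    · intro g _
      by_cases hg : g = f
      · subst hg; simp
      · simp [hg]
  have hf' : ∀ f, (2 * μ f) • (y.1 f).1 + ∑ v, cc v f • y.2 v = 0 := by
    intro f
    refine ext_inner_right ℝ fun x => ?_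
    have h := hzero (Pi.single f (x, 0), 0)
    rw [inner_zero_left, inner_add_left, sum_inner, ← h]
    congr 1
    · rw [Finset.sum_eq_single f]
      · simp [inner_smul_left]; ring
      · intro g _ hg
        simp [hg]
      · simp
    · refine Finset.sum_congr rfl fun v _ => ?_
      rw [Finset.sum_eq_single f]
      · simp [inner_smul_left, real_inner_comm]
      · intro g _ hg
        simp [hg]
      · simp
  -- Pair the balance on `f` with its unit normal: the incidences turn the sum into the offset times
  -- the sum of the `cc v f`, which is zero, and only 2 μ_f remains.
  have hμ : μ = 0 := by
    funext f
    have h := congrArg (fun z => inner ℝ (y.1 f).1 z) (hf' f)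
    simp only [inner_add_right, inner_smul_right, inner_sum, inner_zero_right,
      real_inner_self_eq_norm_sq, hunit] at h
    have h2 : ∑ v, cc v f * inner ℝ (y.1 f).1 (y.2 v) = ∑ v, cc v f * (y.1 f).2 := by
      refine Finset.sum_congr rfl fun v _ => ?_
      by_cases hvf : (v, f) ∈ s
      · rw [hinc v f hvf]
      · have : cc v f = 0 := dif_neg hvf
        rw [this, zero_mul, zero_mul]
    rw [h2, ← Finset.sum_mul, hf f] at h
    simpa using h
  have hcc : cc = 0 := by
    refine hs cc (fun v f h => ?_) hv hf fun f => ?_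
    · by_contra hvf
      exact h (dif_neg hvf)
    · have := hf' f
      rwa [hμ, Pi.zero_apply, mul_zero, zero_smul, zero_add] at this
  refine hl0 (LinearMap.ext fun z => ?_)
  have hz := hlin z.1 z.2
  have hlam : lam = 0 := by
    funext p
    have h1 : cc p.1.1 p.1.2 = lam p := dif_pos p.2
    rw [← h1, hcc]; rfl
  rw [hμ, hlam] at hz
  simpa using hz

/-- Solving the linearized larger system with value one in the equation `q` and zero elsewhere shows
that this equation is a coordinate on the solutions of the smaller system. -/
theorem StressFree.exists_fderiv_eq {s : Set (V × F)} [Fintype s] {q : V × F} (hq : q ∉ s)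
    {y : (F → Space3 × ℝ) × (V → Space3)} (hs : StressFree (insert q s) y.1 y.2)
    (hy : incidenceMap (insert q s) y = 0) :
    ∃ d, fderiv ℝ (incidenceMap s) y d = 0 ∧
      inner ℝ (d.1 q.2).1 (y.2 q.1) + inner ℝ (y.1 q.2).1 (d.2 q.1) - (d.1 q.2).2 = 1 := by
  classical
  have := Fintype.ofFinite (insert q s : Set (V × F))
  obtain ⟨d, hd⟩ := hs.fderiv_surjective hy (0, Pi.single ⟨q, Set.mem_insert _ _⟩ 1)
  rw [fderiv_incidenceMap_apply, Prod.mk.injEq] at hd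
  refine ⟨d, ?_, ?_⟩
  · rw [fderiv_incidenceMap_apply]
    refine Prod.ext hd.1 (funext fun p => ?_)
    have h1 := congrFun hd.2 ⟨p.1, Set.mem_insert_of_mem _ p.2⟩
    rw [Pi.single_eq_of_ne] at h1
    · exact h1
    · intro h
      have h2 : p.1 = q := congrArg Subtype.val h
      exact hq (h2 ▸ p.2)
  · have h1 := congrFun hd.2 ⟨q, Set.mem_insert _ _⟩
    rwa [Pi.single_eq_same] at h1

/-- Moving all vertices and planes by a common translation preserves the incidences. This makes the
dimension positive, and provides a nonconstant coordinate on the solutions. -/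
theorem fderiv_incidenceMap_translation (s : Set (V × F)) [Fintype s]
    (y : (F → Space3 × ℝ) × (V → Space3)) (t : Space3) :
    fderiv ℝ (incidenceMap s) y (fun f => (0, inner ℝ (y.1 f).1 t), fun _ => t) = 0 := by
  rw [fderiv_incidenceMap_apply]
  ext i <;> simp

/-- With the planes held fixed, a vertex can only move orthogonally to all normals there, and these
span. -/
theorem eq_zero_of_fderiv_incidenceMap_vertical {s : Set (V × F)} [Fintype s]
    {y : (F → Space3 × ℝ) × (V → Space3)}
    (hspan : ∀ v p, (∀ f, (v, f) ∈ s → inner ℝ (y.1 f).1 p = 0) → p = 0) (w : V → Space3)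
    (h : fderiv ℝ (incidenceMap s) y (0, w) = 0) : w = 0 := by
  rw [fderiv_incidenceMap_apply] at h
  funext v
  refine hspan v _ fun f hf => ?_
  have := congrFun (congrArg Prod.snd h) ⟨(v, f), hf⟩
  simpa using this

theorem finrank_faceFamily : Module.finrank ℝ (F → Space3 × ℝ) = 4 * Fintype.card F := by
  rw [Module.finrank_pi_fintype]
  simp [Module.finrank_prod]
  ring

theorem finrank_vertexFamily : Module.finrank ℝ (V → Space3) = 3 * Fintype.card V := by
  rw [Module.finrank_pi_fintype]
  simp
  ring

/-- The number of degrees of freedom is positive, and bounded by the number of coordinates of the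
family of half-spaces. -/
theorem StressFree.exists_dimension [Nonempty V] {s : Set (V × F)} [Fintype s]
    {y : (F → Space3 × ℝ) × (V → Space3)} (hs : StressFree s y.1 y.2)
    (hy : incidenceMap s y = 0)
    (hspan : ∀ v p, (∀ f, (v, f) ∈ s → inner ℝ (y.1 f).1 p = 0) → p = 0) :
    ∃ n k : ℕ, 3 * Fintype.card F + 3 * Fintype.card V = n + 1 + s.ncard ∧
      4 * Fintype.card F = n + 1 + k := by
  let A : ((F → Space3 × ℝ) × (V → Space3)) →ₗ[ℝ] (F → ℝ) × (s → ℝ) :=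
    (fderiv ℝ (incidenceMap s) y : _ →L[ℝ] _)
  have hA : Function.Surjective A := hs.fderiv_surjective hy
  have hrank := A.finrank_range_add_finrank_ker
  rw [LinearMap.range_eq_top.2 hA, finrank_top] at hrank
  have hcard : Fintype.card s = s.ncard := by
    rw [← Nat.card_coe_set_eq, Nat.card_eq_fintype_card]
  simp only [Module.finrank_prod, finrank_faceFamily, finrank_vertexFamily,
    Module.finrank_fintype_fun_eq_card, hcard] at hrank
  have hpos : 0 < Module.finrank ℝ (LinearMap.ker A) := by
    obtain ⟨v⟩ := ‹Nonempty V›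
    let t : Space3 := EuclideanSpace.single 0 1
    rw [Module.finrank_pos_iff_exists_ne_zero]
    refine ⟨⟨(fun f => (0, inner ℝ (y.1 f).1 t), fun _ => t),
      fderiv_incidenceMap_translation s y t⟩, fun h => ?_⟩
    have h1 := congrFun (congrArg (fun z => z.1.2) h) v
    have h2 := congrArg (fun z : Space3 => z 0) h1
    simp [t] at h2
  -- The kernel injects into the variations of the planes, which bounds the dimension by 4 · #F and
  -- defines the codimension `k`.
  have hle : Module.finrank ℝ (LinearMap.ker A) ≤ Module.finrank ℝ (F → Space3 × ℝ) := by
    refine LinearMap.finrank_le_finrank_of_injective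
      (f := (LinearMap.fst ℝ _ _).comp (LinearMap.ker A).subtype) ?_
    rw [injective_iff_map_eq_zero]
    rintro ⟨⟨a, b⟩, hab⟩ h
    have ha : a = 0 := h
    subst ha
    have hb := eq_zero_of_fderiv_incidenceMap_vertical hspan b hab
    subst hb
    rfl
  rw [finrank_faceFamily] at hle
  refine ⟨Module.finrank ℝ (LinearMap.ker A) - 1,
    4 * Fintype.card F - Module.finrank ℝ (LinearMap.ker A), ?_, ?_⟩ <;> omega

end IncidenceMap

end

/-! ### Slice charts at polyhedra with the full skeleton -/

section

open Filter Topology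

section SliceChart

variable {V F : Type*} [Fintype V] [Fintype F]

/-- The vertices lie in the unit ball, which provides the compact set required by
`exists_isSliceChart_of_submersion`. Over the given planes the vertices are unique because the
normals at each vertex span. -/
theorem exists_isSliceChart_of_incidence {n k : ℕ} {H : Type*} [TopologicalSpace H]
    (I : ModelWithCorners ℝ (EuclideanSpace ℝ (Fin (n + 1))) H) (hI : Set ℝ)
    (hIr : ∀ y, y ∈ Set.range I ↔ y 0 ∈ hI) {s : Set (V × F)} [Fintype s]
    (hdim : 3 * Fintype.card F + 3 * Fintype.card V = n + 1 + s.ncard)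
    (hk : 4 * Fintype.card F = n + 1 + k) {e : F → Space3 × ℝ} {φ : V → Space3}
    (h0 : incidenceMap s (e, φ) = 0) (hs : StressFree s e φ)
    (hspan : ∀ v p, (∀ f, (v, f) ∈ s → inner ℝ (e f).1 p = 0) → p = 0)
    {g : (F → Space3 × ℝ) × (V → Space3) → ℝ} (hg : ContDiff ℝ ∞ g)
    (hgn : ∃ y, fderiv ℝ (incidenceMap s) (e, φ) y = 0 ∧ fderiv ℝ g (e, φ) y ≠ 0)
    (S : Set (F → Space3 × ℝ))
    (h1 : ∀ e ∈ S, ∃ φ : V → Space3, (∀ v, φ v ∈ hyperbolicSpace3) ∧ incidenceMap s (e, φ) = 0)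
    (h3 : ∀ᶠ y in 𝓝 (e, φ), incidenceMap s y = 0 → (y.1 ∈ S ↔ g y ∈ hI)) :
    ∃ Ψ : OpenPartialHomeomorph (F → Space3 × ℝ)
        (EuclideanSpace ℝ (Fin (n + 1)) × EuclideanSpace ℝ (Fin k)),
      IsSliceChart I S Ψ e ∧ (Ψ e).1 0 = g (e, φ) := by
  have hcard : Fintype.card s = s.ncard := by
    rw [← Nat.card_coe_set_eq, Nat.card_eq_fintype_card]
  refine exists_isSliceChart_of_submersion (y₀ := (e, φ)) I hI hIr ?_ ?_ (contDiff_incidenceMap s) h0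
    (hs.fderiv_surjective h0) (fun w => eq_zero_of_fderiv_incidenceMap_vertical hspan w) hg
    hgn S (isCompact_closedBall (0 : V → Space3) 1) ?_ ?_ h3
  · simp only [Module.finrank_prod, finrank_faceFamily, finrank_vertexFamily,
      Module.finrank_fintype_fun_eq_card, hcard]
    omega
  · rw [finrank_faceFamily, hk]
  · intro e he
    obtain ⟨ψ, hψ, h⟩ := h1 e he
    refine ⟨ψ, ?_, h⟩
    rw [mem_closedBall_zero_iff, pi_norm_le_iff_of_nonneg zero_le_one]
    exact fun v => (mem_ball_zero_iff.1 (hψ v)).le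
  · intro ψ _ hψ
    funext v
    rw [← sub_eq_zero]
    refine hspan v _ fun f hf => ?_
    rw [inner_sub_right, (incidenceMap_eq_zero_iff.1 hψ).2 v f hf,
      (incidenceMap_eq_zero_iff.1 h0).2 v f hf, sub_self]

theorem eventually_inner_lt {p : V → F → Prop} {e : F → Space3 × ℝ} {φ : V → Space3}
    (h : ∀ v f, p v f → inner ℝ (e f).1 (φ v) < (e f).2) :
    ∀ᶠ y : (F → Space3 × ℝ) × (V → Space3) in 𝓝 (e, φ),
      ∀ v f, p v f → inner ℝ (y.1 f).1 (y.2 v) < (y.1 f).2 := by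
  simp only [eventually_all]
  intro v f hvf
  exact Continuous.tendsto' (f := fun y : (F → Space3 × ℝ) × (V → Space3) =>
    inner ℝ (y.1 f).1 (y.2 v)) (by fun_prop) _ _ rfl |>.eventually_lt
    (Continuous.tendsto' (f := fun y : (F → Space3 × ℝ) × (V → Space3) => (y.1 f).2)
      (by fun_prop) _ _ rfl) (h v f hvf)

omit [Fintype V] [Fintype F] in
theorem halfSpaceCoords_injective : Function.Injective (halfSpaceCoords (F := F)) := by
  intro T T' h
  funext f
  have := congrFun h f
  exact Prod.ext (Subtype.ext (congrArg Prod.fst this)) (congrArg (fun z : Space3 × ℝ => z.2) this)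

omit [Fintype V] [Fintype F] in
theorem isEmbedding_halfSpaceCoords : IsEmbedding (halfSpaceCoords (F := F)) := by
  have : halfSpaceCoords (F := F) =
      Pi.map fun _ => Prod.map (Subtype.val : Metric.sphere (0 : Space3) 1 → Space3) (id : ℝ → ℝ) :=
    rfl
  rw [this]
  exact IsEmbedding.piMap fun _ => IsEmbedding.subtypeVal.prodMap IsEmbedding.id

omit [Fintype V] [Fintype F] in
theorem exists_halfSpaceCoords_eq {e : F → Space3 × ℝ} (h : ∀ f, ‖(e f).1‖ = 1) :
    ∃ T : F → HalfSpace, halfSpaceCoords T = e :=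
  ⟨fun f => (⟨(e f).1, mem_sphere_zero_iff_norm.2 (h f)⟩, (e f).2), rfl⟩

omit [Fintype V] [Fintype F] in
theorem norm_halfSpaceCoords (T : F → HalfSpace) (f : F) : ‖(halfSpaceCoords T f).1‖ = 1 :=
  mem_sphere_zero_iff_norm.1 (T f).1.2

omit [Fintype V] [Fintype F] in
theorem eventually_mem_hyperbolicSpace3 [Finite V] {e : F → Space3 × ℝ} {φ : V → Space3}
    (h : ∀ v, φ v ∈ hyperbolicSpace3) :
    ∀ᶠ y : (F → Space3 × ℝ) × (V → Space3) in 𝓝 (e, φ), ∀ v, y.2 v ∈ hyperbolicSpace3 := by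
  rw [eventually_all]
  intro v
  exact (Continuous.tendsto' (f := fun y : (F → Space3 × ℝ) × (V → Space3) => y.2 v)
    (by fun_prop) _ _ rfl).eventually (Metric.isOpen_ball.mem_nhds (h v))

end SliceChart

namespace RotationSystem

variable {V : Type*} {G : SimpleGraph V} {M : RotationSystem G}

variable (M) in
/-- The incident pairs of a vertex and a face. -/
def incidences : Set (V × M.Face) := {p | M.inc p.1 p.2}

theorem IsPolyhedral.exists_inc_not_inc (hp : M.IsPolyhedral) (hM : M.HasMinDegreeThree)
    {f g : M.Face} (hfg : f ≠ g) : ∃ x, M.inc x f ∧ ¬ M.inc x g := by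
  by_contra! h
  obtain ⟨d, rfl⟩ := exists_face_eq f
  have h1 := inc_fst (M := M) d
  have h2 := inc_snd (M := M) d
  have h3 := inc_rot (M := M) d
  rcases hp.facesMeetInPairs _ _ hfg d.fst d.snd (M.rot d.snd d.fst) d.adj.ne h1 h2 h3
    (h _ h1) (h _ h2) (h _ h3) with h | h
  · exact hM.rot_ne d.adj.symm h
  · exact (adj_rot d.adj.symm).ne' h

variable [Fintype V] {T : M.Face → HalfSpace} {φ : V → Space3}

omit [Fintype V] in
theorem incidenceMap_incidences_eq_zero_iff :
    incidenceMap M.incidences (halfSpaceCoords T, φ) = 0 ↔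
      ∀ f, ∀ v ∈ M.faceVerts f, φ v ∈ (T f).boundaryPlane := by
  rw [incidenceMap_eq_zero_iff]
  exact ⟨fun h f v hv => h.2 v f hv, fun h => ⟨norm_halfSpaceCoords T, fun v f hv => h f v hv⟩⟩

theorem _root_.IsOneSkeleton.stressFree (h : IsOneSkeleton G (polyhedron T) φ)
    (hM : M.HasMinDegreeThree) (hT : ∀ f, ∀ v ∈ M.faceVerts f, φ v ∈ (T f).boundaryPlane) :
    StressFree M.incidences (halfSpaceCoords T) φ := by
  have hp := h.isPolyhedral hM hT
  intro c hc hv hf hf'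
  exact (h.isExactIncidence hM hT).eq_zero_of_stress (fun f => (T f).normal_ne_zero)
    hp.facesMeetInPairs (fun f g hfg => hp.exists_inc_not_inc hM hfg)
    (convexIndependent_of_bijOn (convex_polyhedron T) h.vertices) hc hv hf hf'

theorem _root_.IsOneSkeleton.normals_span (h : IsOneSkeleton G (polyhedron T) φ)
    (hM : M.HasMinDegreeThree) (hT : ∀ f, ∀ v ∈ M.faceVerts f, φ v ∈ (T f).boundaryPlane)
    (v : V) (p : Space3) (hvp : ∀ f, (v, f) ∈ M.incidences → inner ℝ (halfSpaceCoords T f).1 p = 0) :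
    p = 0 :=
  (h.isExactIncidence hM hT).eq_zero_of_forall_inner_eq_zero (h.isPolyhedral hM hT) hM
    (fun f => (T f).normal_ne_zero) hvp

variable (M) in
/-- The families of half-spaces whose boundary planes meet in hyperbolic space as prescribed. -/
def planeFamilies : Set (M.Face → HalfSpace) :=
  {T | ∃ φ : V → Space3, (∀ v, φ v ∈ hyperbolicSpace3) ∧
    ∀ f, ∀ v ∈ M.faceVerts f, φ v ∈ (T f).boundaryPlane}

omit [Fintype V] in
theorem polyhedronSpace_subset_planeFamilies : polyhedronSpace M ⊆ M.planeFamilies :=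
  fun _ ⟨_, φ, h, hT⟩ => ⟨φ, fun v => (h.mem v).1.1, hT⟩

/-- The space of polyhedra has slice charts, and so has, at the same points, every larger space. -/
theorem exists_isSliceChart_of_mem_polyhedronSpace [Nonempty V] (hM : M.HasMinDegreeThree)
    {n k : ℕ} {H : Type*} [TopologicalSpace H]
    (I : ModelWithCorners ℝ (EuclideanSpace ℝ (Fin (n + 1))) H) (hI : Set ℝ)
    (hIr : ∀ y, y ∈ Set.range I ↔ y 0 ∈ hI) (hI1 : hI ∈ 𝓝 1)
    (hdim : 3 * Fintype.card M.Face + 3 * Fintype.card V = n + 1 + M.incidences.ncard)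
    (hk : 4 * Fintype.card M.Face = n + 1 + k) (hT : T ∈ polyhedronSpace M)
    {S : Set (M.Face → HalfSpace)} (hS : polyhedronSpace M ⊆ S) (hS' : S ⊆ M.planeFamilies) :
    ∃ Ψ : OpenPartialHomeomorph (M.Face → Space3 × ℝ)
        (EuclideanSpace ℝ (Fin (n + 1)) × EuclideanSpace ℝ (Fin k)),
      IsSliceChart I (halfSpaceCoords '' S) Ψ (halfSpaceCoords T) ∧
        (Ψ (halfSpaceCoords T)).1 0 = 1 := by
  obtain ⟨-, φ, h, hφ⟩ := hT
  obtain ⟨v⟩ := ‹Nonempty V›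
  have := Fintype.ofFinite M.incidences
  have hex := h.isExactIncidence hM hφ
  have hp := h.isPolyhedral hM hφ
  let A : ((M.Face → Space3 × ℝ) × (V → Space3)) →L[ℝ] ℝ :=
    (EuclideanSpace.proj 0).comp
      ((ContinuousLinearMap.proj v).comp (ContinuousLinearMap.snd ℝ _ _))
  -- The first coordinate of one vertex, shifted to have the value 1 at the given polyhedron.
  -- Translations make its differential nonzero on the solutions, and the value 1 is interior to the
  -- half-line when the model is a half-space.
  let g : (M.Face → Space3 × ℝ) × (V → Space3) → ℝ := fun y => A y - A (0, φ) + 1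
  have hg1 : g (halfSpaceCoords T, φ) = 1 := by simp [g, A]
  have hgc : ContDiff ℝ ∞ g := (A.contDiff.sub contDiff_const).add contDiff_const
  rw [← hg1]
  refine exists_isSliceChart_of_incidence I hI hIr hdim hk
    (incidenceMap_incidences_eq_zero_iff.2 hφ) (h.stressFree hM hφ) (h.normals_span hM hφ) hgc
    ⟨_, fderiv_incidenceMap_translation _ _ (EuclideanSpace.single 0 1), ?_⟩ _ ?_ ?_
  · have : HasFDerivAt g A (halfSpaceCoords T, φ) :=
      (A.hasFDerivAt.sub_const _).add_const _
    rw [this.fderiv]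
    simp [A]
  · rintro _ ⟨T', hT', rfl⟩
    obtain ⟨ψ, hψ, h'⟩ := hS' hT'
    exact ⟨ψ, hψ, incidenceMap_incidences_eq_zero_iff.2 h'⟩
  · have hgI : ∀ᶠ y in 𝓝 (halfSpaceCoords T, φ), g y ∈ hI :=
      hgc.continuous.continuousAt.eventually (by rw [hg1]; exact hI1)
    filter_upwards [hgI, eventually_inner_lt hex.lt,
      eventually_mem_hyperbolicSpace3 (fun v => (h.mem v).1.1)] with y hy hylt hyball hy0
    -- Near the given polyhedron both sides hold: `g` stays in `hI`, and every solution is again a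
    -- polyhedron with the same skeleton.
    refine iff_of_true ?_ hy
    obtain ⟨hunit, hinc⟩ := incidenceMap_eq_zero_iff.1 hy0
    obtain ⟨T', hT'⟩ := exists_halfSpaceCoords_eq hunit
    refine ⟨T', hS ?_, hT'⟩
    have hex' : IsExactIncidence M.inc y.1 y.2 := ⟨hinc, hylt⟩
    rw [← hT'] at hex'
    exact hex'.mem_polyhedronSpace hp hM hyball

end RotationSystem

end

/-! ### The two strata of the weak polyhedron space -/

section

theorem isProperFace_inter_boundaryPlane {F : Type*} (T : F → HalfSpace) (f : F) {x : Space3}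
    (hx : x ∈ polyhedron T) (hxf : x ∉ (T f).boundaryPlane) :
    IsProperFace (polyhedron T) (polyhedron T ∩ (T f).boundaryPlane) := by
  refine ⟨fun h => hxf ?_, (convex_polyhedron T).inter ?_, Set.inter_subset_left, ?_⟩
  · rw [← h] at hx
    exact hx.2
  · exact convex_hyperplane (f := fun x => inner ℝ ((T f).1 : Space3) x)
      ⟨fun _ _ => inner_add_right _ _ _, fun _ _ => inner_smul_right _ _ _⟩ _
  · rintro p hp q hq z ⟨-, hz⟩ ⟨a, b, ha, hb, hab, rfl⟩
    refine ⟨hp, ?_⟩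
    have h1 := inner_le_of_mem_polyhedron hp f
    have h2 := inner_le_of_mem_polyhedron hq f
    have h3 : inner ℝ ((T f).1 : Space3) (a • p + b • q) = (T f).2 := hz
    rw [inner_add_right, inner_smul_right, inner_smul_right] at h3
    refine le_antisymm h1 ?_
    have hb' : b = 1 - a := by linarith
    subst hb'
    by_contra! hlt
    nlinarith

theorem polyhedron_comp {F F' : Type*} (T : F' → HalfSpace) {c : F → F'}
    (hc : Function.Surjective c) : polyhedron (T ∘ c) = polyhedron T := by
  unfold polyhedron
  rw [← hc.iInter_comp fun f => (T f).carrier]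
  rfl

theorem IsPolyhedronEdge.symm {P : Set Space3} {x y : Space3} (h : IsPolyhedronEdge P x y) :
    IsPolyhedronEdge P y x :=
  ⟨h.1.symm, segment_symm ℝ x y ▸ h.2⟩

namespace RotationSystem

variable {V : Type*} [Finite V] {G : SimpleGraph V} {M : RotationSystem G}

/-- A polyhedron is not contained in a plane. -/
theorem _root_.IsOneSkeleton.exists_inner_ne [Nonempty V] {P : Set Space3} {φ : V → Space3}
    (hP : Convex ℝ P) (h : IsOneSkeleton G P φ) (hM : M.HasMinDegreeThree) {n : Space3} (hn : n ≠ 0)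
    (a : ℝ) : ∃ v, inner ℝ n (φ v) ≠ a := by
  by_contra! hall
  obtain ⟨v⟩ := ‹Nonempty V›
  obtain ⟨x, hx⟩ := hM.exists_adj v
  have hz : ∀ y, inner ℝ n (φ y - φ v) = 0 := fun y => by
    rw [inner_sub_right, hall, hall, sub_self]
  exact h.not_three_neighbors hP hn hx (adj_rot (M := M) hx) (adj_rot (M := M) (adj_rot hx))
    (hM.rot_ne hx).symm (hM.rot_ne (adj_rot hx)).symm (hM.rot_rot_ne v x hx).symm (hz _) (hz _)
    (hz _)

section Chord

variable [DecidableEq V] {d₁ d₂ : G.Dart}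
  (hne : d₁.snd ≠ d₂.snd) (hadj : ¬ G.Adj d₁.snd d₂.snd) (hface : M.face d₁ = M.face d₂)

omit [Finite V] [DecidableEq V] in
theorem chordGraph_adj_iff {a b : V} (h : s(a, b) ≠ s(d₁.snd, d₂.snd)) :
    (chordGraph d₁ d₂).Adj a b ↔ G.Adj a b := by
  rw [SimpleGraph.sup_adj, SimpleGraph.edge_adj]
  refine or_iff_left fun h' => h ?_
  rw [Sym2.eq_iff]
  exact h'.1

include hface in
-- The chord lies in the plane of one of its two sides, and that plane cuts out a proper face
-- because the other side has a vertex off it.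
theorem polyhedronSpace_addChord_subset (hM : (M.addChord d₁ d₂ hne hadj).HasMinDegreeThree) :
    polyhedronSpace (M.addChord d₁ d₂ hne hadj) ⊆
      weakPolyhedronSpace (M.addChord d₁ d₂ hne hadj) d₁.snd d₂.snd := by
  rintro T ⟨hc, φ, h, hT⟩
  refine ⟨hc, φ, ⟨h.vertices, fun a b _ => h.edges a b, ?_⟩, hT⟩
  obtain ⟨x, hx, hx'⟩ := (h.isPolyhedral hM hT).exists_inc_not_inc hM
    (face_chordDart_ne M hne hadj hface).symm
  have hseg : ∀ v, (M.addChord d₁ d₂ hne hadj).inc v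
      ((M.addChord d₁ d₂ hne hadj).face (chordDart hne)) → φ v ∈ polyhedron T ∩
        (T ((M.addChord d₁ d₂ hne hadj).face (chordDart hne))).boundaryPlane :=
    fun v hv => ⟨(h.mem v).1, hT _ v hv⟩
  have hface := isProperFace_inter_boundaryPlane T _ (h.mem x).1
    (((h.isExactIncidence hM hT).lt x _ hx').ne)
  exact ⟨_, hface, hface.2.1.segment_subset (hseg _ (inc_fst (chordDart hne)))
    (hseg _ (inc_snd (chordDart hne)))⟩

/-- Labelling the cut face twice does not change the polyhedron, and the chord lies in that face. -/
theorem image_polyhedronSpace_subset (hM : M.HasMinDegreeThree) [Nonempty V] :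
    (fun T' : M.Face → HalfSpace => T' ∘ chordFaceMap M hne hadj hface) '' polyhedronSpace M ⊆
      weakPolyhedronSpace (M.addChord d₁ d₂ hne hadj) d₁.snd d₂.snd := by
  rintro _ ⟨T, ⟨hc, φ, h, hT⟩, rfl⟩
  have hP := polyhedron_comp T (chordFaceMap_surjective M hne hadj hface)
  refine ⟨by rwa [hP], φ, ?_, fun f v hv => hT _ v (inc_chordFaceMap M hne hadj hface hv)⟩
  simp only [hP]
  refine ⟨h.vertices, fun a b hab => (chordGraph_adj_iff hab).trans (h.edges a b), ?_⟩
  obtain ⟨x, hx⟩ := h.exists_inner_ne (convex_polyhedron T) hM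
    (T (M.face d₁)).normal_ne_zero (T (M.face d₁)).2
  have hface' := isProperFace_inter_boundaryPlane T (M.face d₁) (h.mem x).1 hx
  refine ⟨_, hface', hface'.2.1.segment_subset ⟨(h.mem _).1, hT _ _ (inc_snd d₁)⟩
    ⟨(h.mem _).1, hT _ _ ?_⟩⟩
  rw [hface]
  exact inc_snd d₂

/-- The only fibre of `chordFaceMap` with more than one element is the pair of sides of the chord.
-/
theorem eq_comp_chordFaceMap {α : Type*} {T : (M.addChord d₁ d₂ hne hadj).Face → α}
    (h : T ((M.addChord d₁ d₂ hne hadj).face (chordDart hne)) =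
      T ((M.addChord d₁ d₂ hne hadj).face (chordDart hne).symm)) :
    ∃ T' : M.Face → α, T' ∘ chordFaceMap M hne hadj hface = T := by
  refine ⟨T ∘ Function.surjInv (chordFaceMap_surjective M hne hadj hface), ?_⟩
  funext f
  rcases eq_or_isChordFace_of_chordFaceMap_eq M hne hadj hface
    (Function.surjInv_eq (chordFaceMap_surjective M hne hadj hface) (chordFaceMap M hne hadj hface f))
    with h' | ⟨h1, h2⟩
  · exact congrArg T h'
  · rw [Function.comp_apply, Function.comp_apply]
    rcases h1 with h1 | h1 <;> rcases h2 with h2 | h2 <;> rw [h1, h2]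
    · exact h
    · exact h.symm

theorem forall_mem_boundaryPlane_of_comp {T' : M.Face → HalfSpace} {φ : V → Space3}
    (hT : ∀ f, ∀ v ∈ (M.addChord d₁ d₂ hne hadj).faceVerts f,
      φ v ∈ ((T' ∘ chordFaceMap M hne hadj hface) f).boundaryPlane) :
    ∀ f, ∀ v ∈ M.faceVerts f, φ v ∈ (T' f).boundaryPlane := by
  intro f v hv
  obtain ⟨f, rfl, hf⟩ := exists_inc_of_inc M hne hadj hface hv
  exact hT f v hf

/-- If the chord spans an edge, the skeleton is the larger graph. If not, it is the smaller one, and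
the planes of the two sides must coincide, since otherwise their intersection would make the chord
an edge. -/
theorem weakPolyhedronSpace_subset [Nonempty V] (hM : M.HasMinDegreeThree) :
    weakPolyhedronSpace (M.addChord d₁ d₂ hne hadj) d₁.snd d₂.snd ⊆
      polyhedronSpace (M.addChord d₁ d₂ hne hadj) ∪
        (fun T' : M.Face → HalfSpace => T' ∘ chordFaceMap M hne hadj hface) ''
          polyhedronSpace M := by
  rintro T ⟨hc, φ, h, hT⟩
  by_cases hedge : IsPolyhedronEdge (polyhedron T) (φ d₁.snd) (φ d₂.snd)
  · refine Or.inl ⟨hc, φ, ⟨h.vertices, fun a b => ?_⟩, hT⟩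
    by_cases hab : s(a, b) = s(d₁.snd, d₂.snd)
    · rcases Sym2.eq_iff.1 hab with ⟨rfl, rfl⟩ | ⟨rfl, rfl⟩
      · exact iff_of_true (chordDart hne).adj hedge
      · exact iff_of_true (chordDart hne).adj.symm hedge.symm
    · exact h.edges a b hab
  · right
    have hG : IsOneSkeleton G (polyhedron T) φ := by
      refine ⟨h.vertices, fun a b => ?_⟩
      by_cases hab : s(a, b) = s(d₁.snd, d₂.snd)
      · rcases Sym2.eq_iff.1 hab with ⟨rfl, rfl⟩ | ⟨rfl, rfl⟩
        · exact iff_of_false hadj hedge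
        · exact iff_of_false (fun h => hadj h.symm) fun h => hedge h.symm
      · exact (chordGraph_adj_iff hab).symm.trans (h.edges a b hab)
    have hconv := convex_polyhedron T
    set f := (M.addChord d₁ d₂ hne hadj).face (chordDart hne) with hf
    set g := (M.addChord d₁ d₂ hne hadj).face (chordDart hne).symm with hg
    have huf : inner ℝ ((T f).1 : Space3) (φ d₁.snd) = (T f).2 := hT f _ (inc_fst (chordDart hne))
    have hwf : inner ℝ ((T f).1 : Space3) (φ d₂.snd) = (T f).2 := hT f _ (inc_snd (chordDart hne))
    have hug : inner ℝ ((T g).1 : Space3) (φ d₁.snd) = (T g).2 :=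
      hT g _ (inc_snd (chordDart hne).symm)
    have hwg : inner ℝ ((T g).1 : Space3) (φ d₂.snd) = (T g).2 :=
      hT g _ (inc_fst (chordDart hne).symm)
    have hfg : T f = T g := by
      have hdep : ¬ LinearIndependent ℝ ![((T f).1 : Space3), ((T g).1 : Space3)] := fun hli =>
        hedge (IsPolyhedronEdge.of_supporting_planes hconv
          (fun q hq => inner_le_of_mem_polyhedron hq f)
          (fun q hq => inner_le_of_mem_polyhedron hq g) hli (hG.mem _) (hG.mem _)
          (fun h' => hne (h.vertices.injOn (Set.mem_univ _) (Set.mem_univ _) h')) huf hwf hug hwg)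
      rw [LinearIndependent.pair_iff' (T f).normal_ne_zero] at hdep
      push Not at hdep
      obtain ⟨a, ha⟩ := hdep
      have h1 : |a| = 1 := by
        have := congrArg norm ha
        rwa [norm_smul, norm_eq_of_mem_sphere, norm_eq_of_mem_sphere, mul_one, Real.norm_eq_abs]
          at this
      rcases eq_or_eq_neg_of_abs_eq h1 with rfl | rfl
      · rw [one_smul] at ha
        exact Prod.ext (Subtype.ext ha) (by rw [← huf, ← hug, ha])
      -- Opposite normals would squeeze the polyhedron into a plane.
      · exfalso
        obtain ⟨v, hv⟩ := hG.exists_inner_ne hconv hM (T f).normal_ne_zero (T f).2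
        have h2 := inner_le_of_mem_polyhedron (hG.mem v).1 f
        have h3 := inner_le_of_mem_polyhedron (hG.mem v).1 g
        rw [← hug, ← ha, inner_smul_left, inner_smul_left, huf] at h3
        simp only [map_neg, map_one] at h3
        exact hv (by linarith)
    obtain ⟨T', rfl⟩ := eq_comp_chordFaceMap hne hadj hface hfg
    rw [polyhedron_comp T' (chordFaceMap_surjective M hne hadj hface)] at hc hG
    exact ⟨T', ⟨hc, φ, hG, forall_mem_boundaryPlane_of_comp hne hadj hface hT⟩, rfl⟩

theorem weakPolyhedronSpace_addChord [Nonempty V] (hM : M.HasMinDegreeThree)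
    (hN : (M.addChord d₁ d₂ hne hadj).HasMinDegreeThree) :
    weakPolyhedronSpace (M.addChord d₁ d₂ hne hadj) d₁.snd d₂.snd =
      polyhedronSpace (M.addChord d₁ d₂ hne hadj) ∪
        (fun T' : M.Face → HalfSpace => T' ∘ chordFaceMap M hne hadj hface) ''
          polyhedronSpace M :=
  (weakPolyhedronSpace_subset hne hadj hface hM).antisymm
    (Set.union_subset (polyhedronSpace_addChord_subset hne hadj hface hN)
      (image_polyhedronSpace_subset hne hadj hface hM))

/-- The normals of the two sides of the chord are independent in the first set and equal in the
second. -/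
theorem disjoint_polyhedronSpace_image (hN : (M.addChord d₁ d₂ hne hadj).HasMinDegreeThree) :
    Disjoint (polyhedronSpace (M.addChord d₁ d₂ hne hadj))
      ((fun T' : M.Face → HalfSpace => T' ∘ chordFaceMap M hne hadj hface) ''
        polyhedronSpace M) := by
  rw [Set.disjoint_left]
  rintro _ ⟨-, φ, h, hT⟩ ⟨T', -, rfl⟩
  have h1 := h.linearIndependent_normals hN hT (face_chordDart_ne M hne hadj hface)
    (inc_fst (chordDart hne)) (inc_snd (chordDart hne).symm)
  refine h1.injective.ne (show (0 : Fin 2) ≠ 1 by decide) ?_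
  simp [chordFaceMap_chordDart, chordFaceMap_chordDart_symm]

theorem weakPolyhedronSpace_subset_planeFamilies :
    weakPolyhedronSpace (M.addChord d₁ d₂ hne hadj) d₁.snd d₂.snd ⊆
      (M.addChord d₁ d₂ hne hadj).planeFamilies :=
  fun _ ⟨_, φ, h, hT⟩ => ⟨φ, fun v => (h.vertices.mapsTo (Set.mem_univ v)).1.1, hT⟩

end Chord

end RotationSystem

end

/-! ### Sides of a chord in its face -/

section

section ChordNormal

/-- A vector orthogonal to `d`, in the plane spanned by `d` and `x`, on the side of `x`. -/
noncomputable def sideVector (d x : Space3) : Space3 :=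
  (inner ℝ d d : ℝ) • x - (inner ℝ d x : ℝ) • d

variable {d x y n : Space3}

theorem inner_sideVector (d x y : Space3) :
    inner ℝ (sideVector d x) y = inner ℝ d d * inner ℝ x y - inner ℝ d x * inner ℝ d y := by
  rw [sideVector, inner_sub_left, inner_smul_left, inner_smul_left]
  rfl

theorem inner_sideVector_left (d x : Space3) : inner ℝ (sideVector d x) d = 0 := by
  rw [inner_sideVector, real_inner_comm d x]
  ring

theorem inner_sideVector_self (d x : Space3) :
    inner ℝ (sideVector d x) (sideVector d x) = inner ℝ d d * inner ℝ (sideVector d x) x := by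
  rw [inner_sideVector, real_inner_comm (sideVector d x) d, inner_sideVector_left,
    real_inner_comm (sideVector d x) x]
  ring

theorem inner_sideVector_pos (h : LinearIndependent ℝ ![d, x]) :
    0 < inner ℝ (sideVector d x) x := by
  have hd : d ≠ 0 := h.ne_zero 0
  have hd' : 0 < inner ℝ d d := real_inner_self_pos.2 hd
  have hm : sideVector d x ≠ 0 := by
    intro h0
    rw [sideVector, sub_eq_zero] at h0
    have := LinearIndependent.pair_iff.1 h (-inner ℝ d x) (inner ℝ d d) (by
      rw [h0, neg_smul, neg_add_cancel])
    exact hd'.ne' this.2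
  have h1 := real_inner_self_pos.2 hm
  rw [inner_sideVector_self] at h1
  exact pos_of_mul_pos_right h1 hd'.le

theorem inner_sideVector_eq_zero (hd : inner ℝ n d = 0) (hx : inner ℝ n x = 0) :
    inner ℝ n (sideVector d x) = 0 := by
  rw [sideVector, inner_sub_right, inner_smul_right, inner_smul_right, hd, hx]
  ring

theorem linearIndependent_pair_of_inner_eq_zero {a b : Space3} (ha : a ≠ 0) (hb : b ≠ 0)
    (hab : inner ℝ a b = 0) : LinearIndependent ℝ ![a, b] := by
  rw [LinearIndependent.pair_iff]
  intro s t hst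
  have h1 := congrArg (fun z => inner ℝ a z) hst
  have h2 := congrArg (fun z => inner ℝ b z) hst
  simp only [inner_add_right, inner_smul_right, inner_zero_right, hab, real_inner_comm a b] at h1 h2
  have ha' := (real_inner_self_pos.2 ha).ne'
  have hb' := (real_inner_self_pos.2 hb).ne'
  constructor
  · simpa [ha] using h1
  · simpa [hb] using h2

/-- Two unit normals orthogonal to `d`, compared by their values on `x`. -/
theorem normal_eq_of_orthogonal {n₁ n₂ : Space3} (h₂ : ‖n₂‖ = 1) (hd1 : inner ℝ n₁ d = 0)
    (hd2 : inner ℝ n₂ d = 0) (hx2 : inner ℝ n₂ x = 0) (hpos : 0 < inner ℝ (sideVector d x) x) :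
    n₁ = (inner ℝ n₁ n₂ : ℝ) • n₂ +
      ((inner ℝ n₁ x : ℝ) / inner ℝ (sideVector d x) x) • sideVector d x := by
  set m := sideVector d x with hm
  have hn2 : n₂ ≠ 0 := by rintro rfl; simp at h₂
  have hd : d ≠ 0 := by rintro rfl; simp [hm, sideVector] at hpos
  have hd' : inner ℝ d d ≠ 0 := (real_inner_self_pos.2 hd).ne'
  have hm0 : m ≠ 0 := by rintro h; rw [h] at hpos; simp at hpos
  have hmd : inner ℝ m d = 0 := inner_sideVector_left d x
  have hmm : inner ℝ m m = inner ℝ d d * inner ℝ m x := inner_sideVector_self d x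
  have hn2m : inner ℝ n₂ m = 0 := inner_sideVector_eq_zero hd2 hx2
  have hn1m : inner ℝ n₁ m = inner ℝ d d * inner ℝ n₁ x := by
    rw [hm, sideVector, inner_sub_right, inner_smul_right, inner_smul_right, hd1]
    ring
  have hn22 : inner ℝ n₂ n₂ = 1 := by rw [real_inner_self_eq_norm_sq, h₂, one_pow]
  rw [← sub_eq_zero]
  -- The error `r` is orthogonal to `n₂`, hence a combination of `d` and `m`; being orthogonal to
  -- these as well, it is zero.
  set r := n₁ - ((inner ℝ n₁ n₂ : ℝ) • n₂ + ((inner ℝ n₁ x : ℝ) / inner ℝ m x) • m) with hr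
  have key : ∀ q, inner ℝ q r = inner ℝ q n₁ - (inner ℝ n₁ n₂ * inner ℝ q n₂ +
      (inner ℝ n₁ x / inner ℝ m x) * inner ℝ q m) := by
    intro q
    rw [hr, inner_sub_right, inner_add_right, inner_smul_right, inner_smul_right]
  have r1 : inner ℝ n₂ r = 0 := by
    rw [key, hn22, hn2m, real_inner_comm n₁ n₂]
    ring
  have r2 : inner ℝ d r = 0 := by
    rw [key, real_inner_comm n₁ d, hd1, real_inner_comm n₂ d, hd2, real_inner_comm m d, hmd]
    ring
  have r3 : inner ℝ m r = 0 := by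
    rw [key, real_inner_comm n₁ m, hn1m, real_inner_comm n₂ m, hn2m, hmm]
    field_simp
    ring
  obtain ⟨a, b, hab⟩ := exists_combination_of_orthogonal hn2 hd2 hn2m r1
    (linearIndependent_pair_of_inner_eq_zero hd hm0 (by rw [real_inner_comm, hmd]))
  rw [← inner_self_eq_zero (𝕜 := ℝ)]
  nth_rewrite 1 [hab]
  rw [inner_add_left, inner_smul_left, inner_smul_left, r2, r3]
  simp

end ChordNormal

namespace RotationSystem

variable {V : Type*} [Finite V] {G : SimpleGraph V} {M : RotationSystem G}

section Sides

variable {T : M.Face → HalfSpace} {φ : V → Space3} (h : IsOneSkeleton G (polyhedron T) φ)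
  (hM : M.HasMinDegreeThree) (hT : ∀ f, ∀ v ∈ M.faceVerts f, φ v ∈ (T f).boundaryPlane)
include h

theorem linearIndependent_sub_sub {u w z : V} (hwu : w ≠ u) (hzu : z ≠ u) (hwz : w ≠ z) :
    LinearIndependent ℝ ![φ w - φ u, φ z - φ u] :=
  (convexIndependent_of_bijOn (convex_polyhedron T) h.vertices).linearIndependent_sub_pair
    hwu hzu hwz

include hM hT

/-- A chord of a face meets the face only at its ends among the vertices. -/
theorem exists_smul_of_inner_sideVector_eq_zero {f : M.Face} {u w z : V} (hu : M.inc u f)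
    (hw : M.inc w f) (hz : M.inc z f) (hwu : w ≠ u) (hzu : z ≠ u) (hwz : w ≠ z) {q : Space3}
    (hq : inner ℝ ((T f).1 : Space3) (q - φ u) = 0)
    (hq0 : inner ℝ (sideVector (φ w - φ u) (φ z - φ u)) (q - φ u) = 0) :
    ∃ t : ℝ, q - φ u = t • (φ w - φ u) := by
  have hex := h.isExactIncidence hM hT
  have hli := linearIndependent_sub_sub h hwu hzu hwz
  have hn := (T f).normal_ne_zero
  have hd1 : inner ℝ ((T f).1 : Space3) (φ w - φ u) = 0 := hex.inner_sub_eq hu hw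
  have hd2 : inner ℝ ((T f).1 : Space3) (φ z - φ u) = 0 := hex.inner_sub_eq hu hz
  have hm : sideVector (φ w - φ u) (φ z - φ u) ≠ 0 := by
    intro h0
    have := inner_sideVector_pos hli
    rw [h0] at this
    simp at this
  exact exists_smul_of_orthogonal_pair (linearIndependent_pair_of_inner_eq_zero hn hm
    (inner_sideVector_eq_zero hd1 hd2)) (hli.ne_zero 0) hd1 (inner_sideVector_left _ _) hq hq0

theorem inner_sideVector_ne_zero {f : M.Face} {u w z v : V} (hu : M.inc u f)
    (hw : M.inc w f) (hz : M.inc z f) (hwu : w ≠ u) (hzu : z ≠ u) (hwz : w ≠ z)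
    (hv : M.inc v f) (hvu : v ≠ u) (hvw : v ≠ w) :
    inner ℝ (sideVector (φ w - φ u) (φ z - φ u)) (φ v - φ u) ≠ 0 := by
  intro h0
  obtain ⟨t, ht⟩ := exists_smul_of_inner_sideVector_eq_zero h hM hT hu hw hz hwu hzu hwz
    ((h.isExactIncidence hM hT).inner_sub_eq hu hv) h0
  have := LinearIndependent.pair_iff.1 (linearIndependent_sub_sub h hwu hvu hvw.symm) t (-1)
    (by rw [ht]; module)
  norm_num at this

/-- Consecutive vertices of a face are on the same side of a chord. -/
theorem inner_sideVector_mul_pos {u w z : V} (d : G.Dart) (hu : M.inc u (M.face d))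
    (hw : M.inc w (M.face d)) (hz : M.inc z (M.face d)) (hwu : w ≠ u) (hzu : z ≠ u) (hwz : w ≠ z)
    (h1u : d.fst ≠ u) (h1w : d.fst ≠ w) (h2u : d.snd ≠ u) (h2w : d.snd ≠ w) :
    0 < inner ℝ (sideVector (φ w - φ u) (φ z - φ u)) (φ d.fst - φ u) *
      inner ℝ (sideVector (φ w - φ u) (φ z - φ u)) (φ d.snd - φ u) := by
  have hex := h.isExactIncidence hM hT
  have hp := h.isPolyhedral hM hT
  have hc := convexIndependent_of_bijOn (convex_polyhedron T) h.vertices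
  set m := sideVector (φ w - φ u) (φ z - φ u) with hm
  have hA := inner_sideVector_ne_zero h hM hT hu hw hz hwu hzu hwz (inc_fst d) h1u h1w
  have hB := inner_sideVector_ne_zero h hM hT hu hw hz hwu hzu hwz (inc_snd d) h2u h2w
  rw [← hm] at hA hB
  set A := inner ℝ m (φ d.fst - φ u) with hAdef
  set B := inner ℝ m (φ d.snd - φ u) with hBdef
  by_contra! hAB
  have hAB' : A * B < 0 := lt_of_le_of_ne hAB (mul_ne_zero hA hB)
  -- If the ends of the edge were on different sides, the edge would cross the line of the chord at
  -- a point `q`; `s` is the position of `q` on the edge.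
  obtain ⟨s, hs0, hs1, hs⟩ : ∃ s : ℝ, 0 < s ∧ s < 1 ∧ (1 - s) * A + s * B = 0 := by
    have hne : A - B ≠ 0 := by
      intro h0
      have : A = B := by linarith
      rw [this] at hAB'
      nlinarith [mul_self_nonneg B]
    have hsq : 0 < (A - B) ^ 2 := by positivity
    refine ⟨A * (A - B) / (A - B) ^ 2, ?_, ?_, ?_⟩
    · apply div_pos _ hsq
      nlinarith [mul_self_nonneg A]
    · rw [div_lt_one hsq]
      nlinarith [mul_self_nonneg B]
    · field_simp
      ring
  set q := (1 - s) • φ d.fst + s • φ d.snd with hq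
  have hqu : q - φ u = (1 - s) • (φ d.fst - φ u) + s • (φ d.snd - φ u) := by
    rw [hq]; module
  obtain ⟨t, ht⟩ := exists_smul_of_inner_sideVector_eq_zero h hM hT hu hw hz hwu hzu hwz (q := q)
    (by rw [hqu, inner_add_right, inner_smul_right, inner_smul_right]
        have e1 := hex.inner_sub_eq hu (inc_fst d)
        have e2 := hex.inner_sub_eq hu (inc_snd d)
        change inner ℝ ((T (M.face d)).1 : Space3) _ = 0 at e1 e2
        rw [e1, e2]; ring)
    (by rw [hqu, inner_add_right, inner_smul_right, inner_smul_right]; exact hs)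
  have hnot : ∀ x, M.inc x (M.face d) → d.fst ≠ x → d.snd ≠ x → ¬ M.inc x (M.face d.symm) := by
    intro x hx h1 h2 hx'
    rcases hp.facesMeetInPairs _ _ (hp.face_ne_face_symm d) d.fst d.snd x d.adj.ne (inc_fst d)
      (inc_snd d) hx (inc_snd d.symm) (inc_fst d.symm) hx' with h | h
    · exact h1 h.symm
    · exact h2 h.symm
  have lu := hex.lt u _ (hnot u hu h1u h2u)
  have lw := hex.lt w _ (hnot w hw h1w h2w)
  have la := hex.eq _ _ (inc_snd (M := M) d.symm)
  have lb := hex.eq _ _ (inc_fst (M := M) d.symm)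
  change inner ℝ _ (φ d.fst) = _ at la
  change inner ℝ _ (φ d.snd) = _ at lb
  set N := (halfSpaceCoords T (M.face d.symm)).1
  set c := (halfSpaceCoords T (M.face d.symm)).2
  have hNq : inner ℝ N q = c := by
    rw [hq, inner_add_right, inner_smul_right, inner_smul_right, la, lb]; ring
  have hqt : q = (1 - t) • φ u + t • φ w := by
    have : q = φ u + t • (φ w - φ u) := by rw [← ht]; module
    rw [this]; module
  have hNq' : c = (1 - t) * inner ℝ N (φ u) + t * inner ℝ N (φ w) := by
    rw [← hNq, hqt, inner_add_right, inner_smul_right, inner_smul_right]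
  have hqmem : ∀ S : Set V, d.fst ∈ S → d.snd ∈ S → q ∈ convexHull ℝ (φ '' S) := by
    intro S h1 h2
    exact (convex_convexHull ℝ _) (subset_convexHull ℝ _ (Set.mem_image_of_mem φ h1))
      (subset_convexHull ℝ _ (Set.mem_image_of_mem φ h2)) (by linarith) hs0.le (by ring)
  -- `t` is the position of `q` on the line from `u` to `w`. If `q` is beyond an end, that end is in
  -- the hull of the edge and the other end, against convex independence. If `q` is on the chord, it
  -- is strictly inside the half-space of the face across the edge, although it lies on the edge.
  rcases lt_or_ge t 0 with ht0 | ht0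
  · have hpos : 0 < 1 - t := by linarith
    have : φ u ∈ convexHull ℝ (φ '' {d.fst, d.snd, w}) := by
      have e : φ u = (1 / (1 - t)) • q + (-t / (1 - t)) • φ w := by
        rw [hqt]
        match_scalars <;> field_simp
        ring
      rw [e]
      refine (convex_convexHull ℝ _) (hqmem _ (by simp) (by simp))
        (subset_convexHull ℝ _ ⟨w, by simp, rfl⟩) (by positivity)
        (div_nonneg (by linarith) hpos.le) (by field_simp; ring)
    have := hc _ _ this
    simp only [Set.mem_insert_iff, Set.mem_singleton_iff] at this
    rcases this with h | h | h
    · exact h1u h.symm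
    · exact h2u h.symm
    · exact hwu h.symm
  rcases lt_or_ge 1 t with ht1 | ht1
  · have hpos : 0 < t := by linarith
    have : φ w ∈ convexHull ℝ (φ '' {d.fst, d.snd, u}) := by
      have e : φ w = (1 / t) • q + ((t - 1) / t) • φ u := by
        rw [hqt]
        match_scalars <;> field_simp
        ring
      rw [e]
      refine (convex_convexHull ℝ _) (hqmem _ (by simp) (by simp))
        (subset_convexHull ℝ _ ⟨u, by simp, rfl⟩) (by positivity)
        (div_nonneg (by linarith) hpos.le) (by field_simp; ring)
    have := hc _ _ this
    simp only [Set.mem_insert_iff, Set.mem_singleton_iff] at this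
    rcases this with h | h | h
    · exact h1w h.symm
    · exact h2w h.symm
    · exact hwu h
  · rcases eq_or_lt_of_le ht0 with h0 | h0
    · rw [← h0] at hNq'; linarith
    · nlinarith

/-- The neighbours of an end of a chord of a face are on different sides of the chord. -/
theorem inner_sideVector_fst_neg {w : V} (d : G.Dart) (hw : M.inc w (M.face d)) (hwu : w ≠ d.snd)
    (hwz : w ≠ M.rot d.snd d.fst) (hwp : w ≠ d.fst) :
    inner ℝ (sideVector (φ w - φ d.snd) (φ (M.rot d.snd d.fst) - φ d.snd))
      (φ d.fst - φ d.snd) < 0 := by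
  have hex := h.isExactIncidence hM hT
  have hz : G.Adj d.snd (M.rot d.snd d.fst) := adj_rot d.adj.symm
  have hpz : d.fst ≠ M.rot d.snd d.fst := (hM.rot_ne d.adj.symm).symm
  have hpos := inner_sideVector_pos (linearIndependent_sub_sub h hwu hz.ne' hwz)
  obtain ⟨a, b, ha, hb, hab⟩ := IsPolyhedronEdge.exists_nonneg_combination (convex_polyhedron T)
    (h.mem d.snd) ((h.edges _ _).1 d.adj.symm) ((h.edges _ _).1 hz)
    (linearIndependent_sub_sub h d.adj.ne hz.ne' hpz) (h.mem w).1 (T (M.face d)).normal_ne_zero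
    (hex.inner_sub_eq (inc_snd d) (inc_fst d)) (hex.inner_sub_eq (inc_snd d) (inc_rot d))
    (hex.inner_sub_eq (inc_snd d) hw)
  have hb0 : b ≠ 0 := by
    rintro rfl
    have := LinearIndependent.pair_iff.1 (linearIndependent_sub_sub h hwu d.adj.ne hwp) 1 (-a)
      (by rw [hab]; module)
    exact one_ne_zero this.1
  -- The end `w` lies in the corner at `d.snd`, with positive coefficient `b` on the next edge.
  -- Pairing with the side vector, which vanishes on the chord and is positive on that edge, makes
  -- it negative on the other edge.
  have h0 := inner_sideVector_left (φ w - φ d.snd) (φ (M.rot d.snd d.fst) - φ d.snd)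
  nth_rewrite 2 [hab] at h0
  rw [inner_add_right, inner_smul_right, inner_smul_right] at h0
  have hb' : 0 < b := lt_of_le_of_ne hb hb0.symm
  have := mul_pos hb' hpos
  by_contra! hge
  have := mul_nonneg ha hge
  linarith

end Sides

end RotationSystem

end

/-! ### The chord faces near the boundary: sides and stresses -/

section

open Filter Topology

namespace RotationSystem

variable {V : Type*} {G : SimpleGraph V} {M : RotationSystem G} [DecidableEq V] {d₁ d₂ : G.Dart}
  (hne : d₁.snd ≠ d₂.snd) (hadj : ¬ G.Adj d₁.snd d₂.snd) (hface : M.face d₁ = M.face d₂)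

section Finite

variable [Finite V]

include hface in
-- A vertex common to both sides is an end of the chord, but this one is a neighbour of `d₁.snd`,
-- hence neither `d₁.snd` nor `d₂.snd`.
theorem not_inc_rot_chordDart (hs : M.HasSimpleFaces) :
    ¬ (M.addChord d₁ d₂ hne hadj).inc (M.rot d₁.snd d₁.fst)
      ((M.addChord d₁ d₂ hne hadj).face (chordDart hne)) := by
  intro h1
  have hz : G.Adj d₁.snd (M.rot d₁.snd d₁.fst) := adj_rot d₁.adj.symm
  rcases eq_or_eq_of_inc_chordFaces M hne hadj hface hs h1 (inc_rot_chordDart_symm M hne hadj)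
    with h | h
  · exact hz.ne' h
  · exact hadj (h ▸ hz)

section Sides

variable {T : M.Face → HalfSpace} {φ : V → Space3} (h : IsOneSkeleton G (polyhedron T) φ)
  (hM : M.HasMinDegreeThree) (hT : ∀ f, ∀ v ∈ M.faceVerts f, φ v ∈ (T f).boundaryPlane)
include h hM hT hface

/-- Walk around the face from the reversed chord: the first vertex met defines the positive side,
and consecutive vertices stay on it until `d₂.snd` is reached, whence the walk returns along the
reversed chord. It cannot reach `d₁.snd` earlier, since `d₁` lies on the other side. -/
theorem inner_sideVector_chord_pos {v : V}
    (hv : (M.addChord d₁ d₂ hne hadj).inc v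
      ((M.addChord d₁ d₂ hne hadj).face (chordDart hne).symm))
    (hvu : v ≠ d₁.snd) (hvw : v ≠ d₂.snd) :
    0 < inner ℝ (sideVector (φ d₂.snd - φ d₁.snd) (φ (M.rot d₁.snd d₁.fst) - φ d₁.snd))
      (φ v - φ d₁.snd) := by
  have hs := h.hasSimpleFaces hM hT
  have hz : G.Adj d₁.snd (M.rot d₁.snd d₁.fst) := adj_rot d₁.adj.symm
  have hwz : d₂.snd ≠ M.rot d₁.snd d₁.fst := fun h => hadj (h ▸ hz)
  have hw : M.inc d₂.snd (M.face d₁) := hface ▸ inc_snd d₂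
  set ψ : V → ℝ := fun x => inner ℝ (sideVector (φ d₂.snd - φ d₁.snd)
    (φ (M.rot d₁.snd d₁.fst) - φ d₁.snd)) (φ x - φ d₁.snd) with hψ
  have hψz : 0 < ψ (M.rot d₁.snd d₁.fst) :=
    inner_sideVector_pos (linearIndependent_sub_sub h hne.symm hz.ne' hwz)
  have hψu : ψ d₁.snd = 0 := by simp [hψ]
  have hψw : ψ d₂.snd = 0 := inner_sideVector_left _ _
  let B : Set (chordGraph d₁ d₂).Dart := {a | (M.addChord d₁ d₂ hne hadj).face a =
    (M.addChord d₁ d₂ hne hadj).face (chordDart hne).symm ∧ (a = (chordDart hne).symm ∨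
      ∃ a₀ : G.Dart, a = oldDart a₀ ∧ (a₀.snd = d₂.snd ∨ 0 < ψ a₀.snd))}
  have hB : ∀ a ∈ B, (M.addChord d₁ d₂ hne hadj).next a ∈ B := by
    rintro a ⟨ha, ha'⟩
    refine ⟨by rw [face_next, ha], ?_⟩
    rcases ha' with rfl | ⟨a₀, rfl, ha'⟩
    · rw [next_chordDart_symm]
      exact Or.inr ⟨_, rfl, Or.inr hψz⟩
    · have hMa : M.face a₀ = M.face d₁ := by
        have := congrArg (chordFaceMap M hne hadj hface) ha
        rwa [chordFaceMap_oldDart, chordFaceMap_chordDart_symm] at this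
      rcases ha' with hw' | hpos
      · have : a₀ = d₂ := hs _ _ (hMa.trans hface) hw'
        subst this
        exact Or.inl (next_oldDart_right M hne hadj)
      · have h1u : a₀.snd ≠ d₁.snd := fun h => by rw [h, hψu] at hpos; exact hpos.false
        have h1w : a₀.snd ≠ d₂.snd := fun h => by rw [h, hψw] at hpos; exact hpos.false
        have hnext := next_oldDart M hne hadj (d := a₀) (fun h => h1u (by rw [h]))
          (fun h => h1w (by rw [h]))
        rw [hnext]
        refine Or.inr ⟨_, rfl, ?_⟩
        by_cases h2w : (M.next a₀).snd = d₂.snd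
        · exact Or.inl h2w
        right
        have hMn : M.face (M.next a₀) = M.face d₁ := by rw [face_next, hMa]
        have h2u : (M.next a₀).snd ≠ d₁.snd := by
          intro h2u
          have heq : M.next a₀ = d₁ := hs _ _ hMn h2u
          rw [heq] at hnext
          have e := congrArg (M.addChord d₁ d₂ hne hadj).face hnext
          rw [face_next, ha, face_oldDart_left] at e
          exact face_chordDart_ne M hne hadj hface e.symm
        have := inner_sideVector_mul_pos h hM hT (M.next a₀) (hMn ▸ inc_snd d₁) (hMn ▸ hw)
          (hMn ▸ inc_rot d₁) hne.symm hz.ne' hwz h1u h1w h2u h2w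
        exact pos_of_mul_pos_right this hpos.le
  obtain ⟨b, hb, rfl⟩ := hv.exists_snd
  obtain ⟨-, hbB⟩ := mem_of_face_eq hB hb.symm ⟨rfl, Or.inl rfl⟩
  rcases hbB with rfl | ⟨b₀, rfl, hb₀ | hb₀⟩
  · exact absurd rfl hvu
  · exact absurd hb₀ hvw
  · exact hb₀

/-- From a positive vertex the walk would stay positive forever: it cannot enter `d₁.snd`, which it
reaches only from the negative vertex `d₁.fst`, nor `d₂.snd`, since `d₂` lies on the other face. It
would then never meet the chord, which belongs to this face. -/
theorem inner_sideVector_chord_neg {v : V}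
    (hv : (M.addChord d₁ d₂ hne hadj).inc v ((M.addChord d₁ d₂ hne hadj).face (chordDart hne)))
    (hvu : v ≠ d₁.snd) (hvw : v ≠ d₂.snd) :
    inner ℝ (sideVector (φ d₂.snd - φ d₁.snd) (φ (M.rot d₁.snd d₁.fst) - φ d₁.snd))
      (φ v - φ d₁.snd) < 0 := by
  have hs := h.hasSimpleFaces hM hT
  have hz : G.Adj d₁.snd (M.rot d₁.snd d₁.fst) := adj_rot d₁.adj.symm
  have hwz : d₂.snd ≠ M.rot d₁.snd d₁.fst := fun h => hadj (h ▸ hz)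
  have hwp : d₂.snd ≠ d₁.fst := fun h => hadj (h ▸ d₁.adj.symm)
  have hw : M.inc d₂.snd (M.face d₁) := hface ▸ inc_snd d₂
  have hψp := inner_sideVector_fst_neg h hM hT d₁ hw hne.symm hwz hwp
  have hv' : M.inc v (M.face d₁) := by
    have := inc_chordFaceMap M hne hadj hface hv
    rwa [chordFaceMap_chordDart] at this
  refine lt_of_le_of_ne ?_ (inner_sideVector_ne_zero h hM hT (inc_snd d₁) hw (inc_rot d₁)
    hne.symm hz.ne' hwz hv' hvu hvw)
  by_contra! hpos
  set ψ : V → ℝ := fun x => inner ℝ (sideVector (φ d₂.snd - φ d₁.snd)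
    (φ (M.rot d₁.snd d₁.fst) - φ d₁.snd)) (φ x - φ d₁.snd) with hψ
  let B : Set (chordGraph d₁ d₂).Dart := {a | (M.addChord d₁ d₂ hne hadj).face a =
    (M.addChord d₁ d₂ hne hadj).face (chordDart hne) ∧ ∃ a₀ : G.Dart, a = oldDart a₀ ∧
      a₀.snd ≠ d₁.snd ∧ a₀.snd ≠ d₂.snd ∧ 0 < ψ a₀.snd}
  have hB : ∀ a ∈ B, (M.addChord d₁ d₂ hne hadj).next a ∈ B := by
    rintro _ ⟨ha, a₀, rfl, h1u, h1w, h1⟩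
    refine ⟨by rw [face_next, ha], ?_⟩
    have hMn : M.face (M.next a₀) = M.face d₁ := by
      have := congrArg (chordFaceMap M hne hadj hface) ha
      rwa [chordFaceMap_oldDart, chordFaceMap_chordDart, ← face_next] at this
    have hnext := next_oldDart M hne hadj (d := a₀) (fun h => h1u (by rw [h]))
      (fun h => h1w (by rw [h]))
    have h2u : (M.next a₀).snd ≠ d₁.snd := by
      intro h2u
      have heq : M.next a₀ = d₁ := hs _ _ hMn h2u
      have : a₀.snd = d₁.fst := congrArg (fun d : G.Dart => d.fst) heq
      rw [this] at h1
      exact h1.not_gt hψp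
    have h2w : (M.next a₀).snd ≠ d₂.snd := by
      intro h2w
      have heq : M.next a₀ = d₂ := hs _ _ (hMn.trans hface) h2w
      rw [heq] at hnext
      have e := congrArg (M.addChord d₁ d₂ hne hadj).face hnext
      rw [face_next, ha, face_oldDart_right] at e
      exact face_chordDart_ne M hne hadj hface e
    have := inner_sideVector_mul_pos h hM hT (M.next a₀) (hMn ▸ inc_snd d₁) (hMn ▸ hw)
      (hMn ▸ inc_rot d₁) hne.symm hz.ne' hwz h1u h1w h2u h2w
    exact ⟨_, hnext, h2u, h2w, pos_of_mul_pos_right this h1.le⟩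
  obtain ⟨b, hb, rfl⟩ := hv.exists_snd
  have hbB : b ∈ B := by
    refine ⟨hb, ?_⟩
    rcases dart_cases hne b with ⟨b₀, rfl⟩ | rfl | rfl
    · exact ⟨b₀, rfl, hvu, hvw, hpos⟩
    · exact absurd rfl hvw
    · exact absurd rfl hvu
  obtain ⟨-, a₀, ha₀, -⟩ := mem_of_face_eq hB hb hbB
  have h1 := a₀.adj
  have h2 : (chordDart hne).toProd = a₀.toProd :=
    congrArg (fun d : (chordGraph d₁ d₂).Dart => d.toProd) ha₀
  rw [← h2] at h1
  exact hadj h1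

end Sides

end Finite

section Stress

variable [Fintype V] {T : M.Face → HalfSpace} {φ : V → Space3}
  (h : IsOneSkeleton G (polyhedron T) φ)
  (hM : M.HasMinDegreeThree) (hT : ∀ f, ∀ v ∈ M.faceVerts f, φ v ∈ (T f).boundaryPlane)
include h hM hT

/-- Adding the coefficients on the two sides of the chord gives a stress of the polyhedron without
the chord, hence zero, so the two sides carry opposite coefficients. These live on common vertices
of the sides and on the added incidence, that is, on three vertices, and three vertices are affinely
independent. -/
theorem stressFree_insert :
    StressFree (insert (M.rot d₁.snd d₁.fst, (M.addChord d₁ d₂ hne hadj).face (chordDart hne))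
      (M.addChord d₁ d₂ hne hadj).incidences)
      (halfSpaceCoords (T ∘ chordFaceMap M hne hadj hface)) φ := by
  classical
  intro lam hsupp hv hf hf'
  set f₁ := (M.addChord d₁ d₂ hne hadj).face (chordDart hne) with hf₁
  set f₂ := (M.addChord d₁ d₂ hne hadj).face (chordDart hne).symm with hf₂
  set c := chordFaceMap M hne hadj hface with hc
  have hf₁₂ : f₁ ≠ f₂ := face_chordDart_ne M hne hadj hface
  have hcf₁ : c f₁ = M.face d₁ := chordFaceMap_chordDart M hne hadj hface
  have hcf₂ : c f₂ = M.face d₁ := chordFaceMap_chordDart_symm M hne hadj hface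
  have hmerge : (fun v f' => ∑ f with c f = f', lam v f) = 0 := by
    refine h.stressFree hM hT _ (fun v f' hne' => ?_) (fun v => ?_) (fun f' => ?_) fun f' => ?_
    · obtain ⟨f, hf, hlam⟩ := Finset.exists_ne_zero_of_sum_ne_zero hne'
      rw [Finset.mem_filter] at hf
      obtain rfl := hf.2
      rcases hsupp v f hlam with he | he
      · rw [Prod.mk.injEq] at he
        change M.inc v (c f)
        rw [he.1, he.2, hcf₁]
        exact inc_rot d₁
      · exact inc_chordFaceMap M hne hadj hface he
    · rw [← hv v, ← Finset.sum_fiberwise _ c]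
      refine Finset.sum_congr rfl fun f' _ => ?_
      rw [Finset.sum_smul]
      refine Finset.sum_congr rfl fun f hf => ?_
      rw [← (Finset.mem_filter.1 hf).2]
      rfl
    · rw [Finset.sum_comm]
      exact Finset.sum_eq_zero fun f _ => hf f
    · simp_rw [Finset.sum_smul]
      rw [Finset.sum_comm]
      exact Finset.sum_eq_zero fun f _ => hf' f
  have hfib : ∀ v f', ∑ f with c f = f', lam v f = 0 := fun v f' => congrFun (congrFun hmerge v) f'
  have hpair : ∀ v, lam v f₁ + lam v f₂ = 0 := by
    intro v
    rw [← hfib v (M.face d₁), ← Finset.sum_pair hf₁₂]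
    refine Finset.sum_congr ?_ fun _ _ => rfl
    ext f
    simp only [Finset.mem_insert, Finset.mem_singleton, Finset.mem_filter, Finset.mem_univ,
      true_and]
    constructor
    · rintro (rfl | rfl) <;> assumption
    · intro hf
      rcases eq_or_isChordFace_of_chordFaceMap_eq M hne hadj hface (hf.trans hcf₁.symm) with h' | h'
      · exact Or.inl h'
      · exact h'.1
  -- The coefficient on `f₂` is nonzero as well, and `f₂` has no added incidence. So the vertex is
  -- on both sides of the chord, or the incidence with `f₁` is the added one.
  have hsub : ∀ v, lam v f₁ ≠ 0 → v ∈ ({d₁.snd, d₂.snd, M.rot d₁.snd d₁.fst} : Finset V) := by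
    intro v hv1
    have hv2 : lam v f₂ ≠ 0 := fun h0 => hv1 (by have := hpair v; rwa [h0, add_zero] at this)
    have hi2 : (M.addChord d₁ d₂ hne hadj).inc v f₂ := by
      rcases hsupp v f₂ hv2 with he | he
      · exact absurd (congrArg Prod.snd he) hf₁₂.symm
      · exact he
    rcases hsupp v f₁ hv1 with he | he
    · rw [Prod.mk.injEq] at he
      simp [he.1]
    · rcases eq_or_eq_of_inc_chordFaces M hne hadj hface (h.hasSimpleFaces hM hT) he hi2 with h' | h'
      · exact Finset.mem_insert.2 (Or.inl h')
      · exact Finset.mem_insert_of_mem (Finset.mem_insert.2 (Or.inl h'))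
  have hlam1 : (fun v => lam v f₁) = 0 := by
    refine (convexIndependent_of_bijOn (convex_polyhedron T) h.vertices).eq_zero_of_card_le_three
      (hf f₁) (hf' f₁) ((Finset.card_le_card (t := {d₁.snd, d₂.snd, M.rot d₁.snd d₁.fst})
        fun v hv => ?_).trans Finset.card_le_three)
    exact hsub v (Finset.mem_filter.1 hv).2
  have hlam1' : ∀ v, lam v f₁ = 0 := fun v => congrFun hlam1 v
  have hlam2 : ∀ v, lam v f₂ = 0 := fun v => by
    have := hpair v
    rwa [hlam1' v, zero_add] at this
  funext v f
  by_cases hcf : IsChordFace M hne hadj f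
  · rcases hcf with rfl | rfl
    · exact hlam1' v
    · exact hlam2 v
  · have := hfib v (c f)
    rw [Finset.sum_eq_single f] at this
    · exact this
    · intro g hg hgf
      rcases eq_or_isChordFace_of_chordFaceMap_eq M hne hadj hface (Finset.mem_filter.1 hg).2
        with h' | h'
      · exact absurd h' hgf
      · exact absurd h'.2 hcf
    · simp

end Stress

end RotationSystem

end

/-! ### Slice charts with boundary -/

section

open Filter Topology

namespace RotationSystem

variable {V : Type*} [Fintype V] [DecidableEq V] {G : SimpleGraph V} {M : RotationSystem G}
  {d₁ d₂ : G.Dart} (hne : d₁.snd ≠ d₂.snd) (hadj : ¬ G.Adj d₁.snd d₂.snd)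
  (hface : M.face d₁ = M.face d₂)

include hface in
theorem exists_skeleton_of_mem_weakPolyhedronSpace [Nonempty V] (hM : M.HasMinDegreeThree)
    (hN : (M.addChord d₁ d₂ hne hadj).HasMinDegreeThree)
    {T : (M.addChord d₁ d₂ hne hadj).Face → HalfSpace}
    (hT : T ∈ weakPolyhedronSpace (M.addChord d₁ d₂ hne hadj) d₁.snd d₂.snd) :
    ∃ φ : V → Space3, (∀ v, φ v ∈ polyhedron T) ∧
      (∀ f, ∀ v ∈ (M.addChord d₁ d₂ hne hadj).faceVerts f, φ v ∈ (T f).boundaryPlane) ∧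
      ∀ v p, (∀ f, (v, f) ∈ (M.addChord d₁ d₂ hne hadj).incidences →
        inner ℝ (halfSpaceCoords T f).1 p = 0) → p = 0 := by
  rw [weakPolyhedronSpace_addChord hne hadj hface hM hN] at hT
  rcases hT with ⟨-, φ, h, hT⟩ | ⟨T', ⟨-, φ, h, hT⟩, rfl⟩
  · exact ⟨φ, fun v => (h.mem v).1, hT, h.normals_span hN hT⟩
  · refine ⟨φ, fun v => ?_, fun f v hv => hT _ v (inc_chordFaceMap M hne hadj hface hv),
      fun v p hp => h.normals_span hM hT v p fun f hf => ?_⟩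
    · dsimp only
      rw [polyhedron_comp T' (chordFaceMap_surjective M hne hadj hface)]
      exact (h.mem v).1
    · obtain ⟨f, rfl, hf⟩ := exists_inc_of_inc M hne hadj hface hf
      exact hp f hf

/-- At the families coming from polyhedra without the chord, the weak polyhedron space has slice
charts, in which these families are on the boundary. -/
theorem exists_isSliceChart_of_mem_image [Nonempty V] (hM : M.HasMinDegreeThree)
    (hN : (M.addChord d₁ d₂ hne hadj).HasMinDegreeThree)
    {n k : ℕ} {H : Type*} [TopologicalSpace H]
    (I : ModelWithCorners ℝ (EuclideanSpace ℝ (Fin (n + 1))) H)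
    (hIr : ∀ y, y ∈ Set.range I ↔ 0 ≤ y 0)
    (hdim : 3 * Fintype.card (M.addChord d₁ d₂ hne hadj).Face + 3 * Fintype.card V =
      n + 1 + (M.addChord d₁ d₂ hne hadj).incidences.ncard)
    (hk : 4 * Fintype.card (M.addChord d₁ d₂ hne hadj).Face = n + 1 + k)
    {T : M.Face → HalfSpace} (hT : T ∈ polyhedronSpace M) :
    ∃ Ψ : OpenPartialHomeomorph ((M.addChord d₁ d₂ hne hadj).Face → Space3 × ℝ)
        (EuclideanSpace ℝ (Fin (n + 1)) × EuclideanSpace ℝ (Fin k)),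
      IsSliceChart I (halfSpaceCoords ''
        weakPolyhedronSpace (M.addChord d₁ d₂ hne hadj) d₁.snd d₂.snd) Ψ
        (halfSpaceCoords (T ∘ chordFaceMap M hne hadj hface)) ∧
        (Ψ (halfSpaceCoords (T ∘ chordFaceMap M hne hadj hface))).1 0 = 0 := by
  obtain ⟨-, φ, h, hφ⟩ := hT
  have := Fintype.ofFinite (M.addChord d₁ d₂ hne hadj).incidences
  have hex := h.isExactIncidence hM hφ
  have hp := h.isPolyhedral hM hφ
  have hs := h.hasSimpleFaces hM hφ
  set u := d₁.snd with hu
  set w := d₂.snd with hw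
  set z := M.rot d₁.snd d₁.fst with hz
  set c := chordFaceMap M hne hadj hface with hc
  set f₁ := (M.addChord d₁ d₂ hne hadj).face (chordDart hne) with hf₁
  set f₂ := (M.addChord d₁ d₂ hne hadj).face (chordDart hne).symm with hf₂
  have huf₁ : (M.addChord d₁ d₂ hne hadj).inc u f₁ := inc_fst (chordDart hne)
  have hwf₁ : (M.addChord d₁ d₂ hne hadj).inc w f₁ := inc_snd (chordDart hne)
  have huf₂ : (M.addChord d₁ d₂ hne hadj).inc u f₂ := inc_snd (chordDart hne).symm
  have hwf₂ : (M.addChord d₁ d₂ hne hadj).inc w f₂ := inc_fst (chordDart hne).symm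
  have hzf₂ : (M.addChord d₁ d₂ hne hadj).inc z f₂ := inc_rot_chordDart_symm M hne hadj
  have hzu : z ≠ u := (adj_rot (M := M) d₁.adj.symm).ne'
  have hzw : z ≠ w := fun h => hadj (h ▸ adj_rot (M := M) d₁.adj.symm)
  have hcf₁ : c f₁ = M.face d₁ := chordFaceMap_chordDart M hne hadj hface
  have hcf₂ : c f₂ = M.face d₁ := chordFaceMap_chordDart_symm M hne hadj hface
  have hφN : ∀ f, ∀ v ∈ (M.addChord d₁ d₂ hne hadj).faceVerts f, φ v ∈ ((T ∘ c) f).boundaryPlane :=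
    fun f v hv => hφ _ v (inc_chordFaceMap M hne hadj hface hv)
  have hzin : φ z ∈ (T (c f₁)).boundaryPlane := by
    rw [hcf₁]
    exact hφ _ _ (inc_rot d₁)
  have hstress := stressFree_insert hne hadj hface h hM hφ
  have hspan : ∀ v p, (∀ f, (v, f) ∈ (M.addChord d₁ d₂ hne hadj).incidences →
      inner ℝ (halfSpaceCoords (T ∘ c) f).1 p = 0) → p = 0 := by
    intro v p hvp
    refine h.normals_span hM hφ v p fun f hf => ?_
    obtain ⟨f, rfl, hf⟩ := exists_inc_of_inc M hne hadj hface hf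
    exact hvp f hf
  obtain ⟨A, hA, hA'⟩ := hasFDerivAt_inner_normal_vertex z f₁ (halfSpaceCoords (T ∘ c), φ)
  -- The slack of the vertex `z` of `f₂` with respect to the plane of `f₁`; it measures the fold
  -- along the chord.
  let g : ((M.addChord d₁ d₂ hne hadj).Face → Space3 × ℝ) × (V → Space3) → ℝ :=
    fun y => -(inner ℝ (y.1 f₁).1 (y.2 z) - (y.1 f₁).2)
  have hgc : ContDiff ℝ ∞ g := by
    have h1 : ContDiff ℝ ∞ fun y : ((M.addChord d₁ d₂ hne hadj).Face → Space3 × ℝ) × (V → Space3) =>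
      (y.1 f₁).1 := by fun_prop
    have h2 : ContDiff ℝ ∞ fun y : ((M.addChord d₁ d₂ hne hadj).Face → Space3 × ℝ) × (V → Space3) =>
      y.2 z := by fun_prop
    exact ((h1.inner ℝ h2).sub (by fun_prop)).neg
  have hg0 : g (halfSpaceCoords (T ∘ c), φ) = 0 := by
    have : inner ℝ ((T (c f₁)).1 : Space3) (φ z) = (T (c f₁)).2 := hzin
    simp [g, halfSpaceCoords, this]
  have h0 : incidenceMap (M.addChord d₁ d₂ hne hadj).incidences (halfSpaceCoords (T ∘ c), φ) = 0 :=
    incidenceMap_incidences_eq_zero_iff.2 hφN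
  obtain ⟨D, hD, hD'⟩ := StressFree.exists_fderiv_eq
    (y := (halfSpaceCoords (T ∘ c), φ)) (q := (z, f₁))
    (not_inc_rot_chordDart hne hadj hface hs) hstress (by
      rw [incidenceMap_eq_zero_iff] at h0 ⊢
      refine ⟨h0.1, fun v f hvf => ?_⟩
      rcases hvf with hvf | hvf
      · rw [Prod.mk.injEq] at hvf
        rw [hvf.1, hvf.2]
        exact hzin
      · exact h0.2 v f hvf)
  have hside : ∀ v, Continuous
      fun y : ((M.addChord d₁ d₂ hne hadj).Face → Space3 × ℝ) × (V → Space3) =>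
        inner ℝ (sideVector (y.2 w - y.2 u) (y.2 z - y.2 u)) (y.2 v - y.2 u) := by
    intro v
    unfold sideVector
    fun_prop
  have hE2 : ∀ᶠ y : ((M.addChord d₁ d₂ hne hadj).Face → Space3 × ℝ) × (V → Space3) in
      𝓝 (halfSpaceCoords (T ∘ c), φ), ∀ v, (M.addChord d₁ d₂ hne hadj).inc v f₂ ∧ v ≠ u ∧ v ≠ w →
        0 < inner ℝ (sideVector (y.2 w - y.2 u) (y.2 z - y.2 u)) (y.2 v - y.2 u) := by
    simp only [eventually_all]
    intro v hv
    exact (hside v).continuousAt.eventually_const_lt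
      (inner_sideVector_chord_pos hne hadj hface h hM hφ hv.1 hv.2.1 hv.2.2)
  have hE1 : ∀ᶠ y : ((M.addChord d₁ d₂ hne hadj).Face → Space3 × ℝ) × (V → Space3) in
      𝓝 (halfSpaceCoords (T ∘ c), φ), ∀ v, (M.addChord d₁ d₂ hne hadj).inc v f₁ ∧ v ≠ u ∧ v ≠ w →
        inner ℝ (sideVector (y.2 w - y.2 u) (y.2 z - y.2 u)) (y.2 v - y.2 u) < 0 := by
    simp only [eventually_all]
    intro v hv
    exact (hside v).continuousAt.eventually_lt_const
      (inner_sideVector_chord_neg hne hadj hface h hM hφ hv.1 hv.2.1 hv.2.2)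
  have hE3 : ∀ᶠ y : ((M.addChord d₁ d₂ hne hadj).Face → Space3 × ℝ) × (V → Space3) in
      𝓝 (halfSpaceCoords (T ∘ c), φ), 0 < inner ℝ (y.1 f₁).1 (y.1 f₂).1 := by
    have hcont : Continuous
        fun y : ((M.addChord d₁ d₂ hne hadj).Face → Space3 × ℝ) × (V → Space3) =>
          inner ℝ (y.1 f₁).1 (y.1 f₂).1 := by fun_prop
    refine hcont.continuousAt.eventually_const_lt ?_
    have : inner ℝ (halfSpaceCoords (T ∘ c) f₁).1 (halfSpaceCoords (T ∘ c) f₂).1 = 1 := by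
      change inner ℝ ((T (c f₁)).1 : Space3) ((T (c f₂)).1 : Space3) = 1
      rw [hcf₁, hcf₂, real_inner_self_eq_norm_sq, norm_eq_of_mem_sphere, one_pow]
    change 0 < inner ℝ (halfSpaceCoords (T ∘ c) f₁).1 (halfSpaceCoords (T ∘ c) f₂).1
    rw [this]
    exact one_pos
  have hE4 := eventually_inner_lt (p := fun v f => ¬ M.inc v (c f)) (e := halfSpaceCoords (T ∘ c))
    (φ := φ) fun v f hvf => hex.lt v (c f) hvf
  rw [← hg0]
  refine exists_isSliceChart_of_incidence I {t | 0 ≤ t} hIr hdim hk h0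
    (hstress.mono (Set.subset_insert _ _)) hspan hgc ⟨D, hD, ?_⟩ _ ?_ ?_
  · have hgA : HasFDerivAt g (-A) (halfSpaceCoords (T ∘ c), φ) := hA.neg
    rw [hgA.fderiv, neg_apply, hA']
    simp only [hD']
    norm_num
  · rintro _ ⟨T', hT', rfl⟩
    obtain ⟨ψ, hψ, h'⟩ := weakPolyhedronSpace_subset_planeFamilies hne hadj hT'
    exact ⟨ψ, hψ, incidenceMap_incidences_eq_zero_iff.2 h'⟩
  filter_upwards [hE1, hE2, hE3, hE4, eventually_mem_hyperbolicSpace3 (fun v => (h.mem v).1.1)]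
    with y hy1 hy2 hy3 hy4 hyball hy0
  obtain ⟨e, ψ⟩ := y
  obtain ⟨T₁, rfl⟩ := exists_halfSpaceCoords_eq (incidenceMap_eq_zero_iff.1 hy0).1
  have hinc := incidenceMap_incidences_eq_zero_iff.1 hy0
  rw [halfSpaceCoords_injective.mem_set_image]
  constructor
  · intro hT₁
    obtain ⟨φ', hφ', hinc', hspan'⟩ :=
      exists_skeleton_of_mem_weakPolyhedronSpace hne hadj hface hM hN hT₁
    -- The normals at `z` span, so the solution `ψ` agrees at `z` with the actual vertex, which lies
    -- in the half-space of `f₁`.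
    have hψ : ψ z = φ' z := by
      rw [← sub_eq_zero]
      refine hspan' z _ fun f hf => ?_
      have e1 : inner ℝ ((T₁ f).1 : Space3) (ψ z) = (T₁ f).2 := hinc f z hf
      have e2 : inner ℝ ((T₁ f).1 : Space3) (φ' z) = (T₁ f).2 := hinc' f z hf
      change inner ℝ ((T₁ f).1 : Space3) _ = 0
      rw [inner_sub_right, e1, e2, sub_self]
    have h1 := inner_le_of_mem_polyhedron (hφ' z) f₁
    change 0 ≤ -(inner ℝ ((T₁ f₁).1 : Space3) (ψ z) - (T₁ f₁).2)
    rw [hψ]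
    linarith
  intro hg
  change 0 ≤ -(inner ℝ ((T₁ f₁).1 : Space3) (ψ z) - (T₁ f₁).2) at hg
  replace hy3 : 0 < inner ℝ ((T₁ f₁).1 : Space3) (T₁ f₂).1 := hy3
  replace hy4 : ∀ v f, ¬ M.inc v (c f) → inner ℝ ((T₁ f).1 : Space3) (ψ v) < (T₁ f).2 := hy4
  replace hy1 : ∀ v, (M.addChord d₁ d₂ hne hadj).inc v f₁ ∧ v ≠ u ∧ v ≠ w →
    inner ℝ (sideVector (ψ w - ψ u) (ψ z - ψ u)) (ψ v - ψ u) < 0 := hy1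
  replace hy2 : ∀ v, (M.addChord d₁ d₂ hne hadj).inc v f₂ ∧ v ≠ u ∧ v ≠ w →
    0 < inner ℝ (sideVector (ψ w - ψ u) (ψ z - ψ u)) (ψ v - ψ u) := hy2
  have hd : ∀ f v, (M.addChord d₁ d₂ hne hadj).inc v f → (M.addChord d₁ d₂ hne hadj).inc u f →
      inner ℝ ((T₁ f).1 : Space3) (ψ v - ψ u) = 0 := by
    intro f v hv hu
    have e1 : inner ℝ ((T₁ f).1 : Space3) (ψ v) = (T₁ f).2 := hinc f v hv
    have e2 : inner ℝ ((T₁ f).1 : Space3) (ψ u) = (T₁ f).2 := hinc f u hu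
    rw [inner_sub_right, e1, e2, sub_self]
  have hu1 : inner ℝ ((T₁ f₁).1 : Space3) (ψ u) = (T₁ f₁).2 := hinc f₁ u huf₁
  have hu2 : inner ℝ ((T₁ f₂).1 : Space3) (ψ u) = (T₁ f₂).2 := hinc f₂ u huf₂
  have hzpos := hy2 z ⟨hzf₂, hzu, hzw⟩
  have hnormal := normal_eq_of_orthogonal (norm_eq_of_mem_sphere (T₁ f₂).1)
    (hd f₁ w hwf₁ huf₁) (hd f₂ w hwf₂ huf₂) (hd f₂ z hzf₂ huf₂) hzpos
  have hz1 : inner ℝ ((T₁ f₁).1 : Space3) (ψ z - ψ u) ≤ 0 := by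
    rw [inner_sub_right, hu1]
    linarith
  set m := sideVector (ψ w - ψ u) (ψ z - ψ u) with hm
  -- Without slack the two normals are proportional; being unit vectors with positive inner product,
  -- they are equal, and the family comes from the smaller graph. With positive slack the fold is
  -- convex and the larger graph is realized.
  rcases eq_or_lt_of_le hz1 with hz1 | hz1
  · rw [hz1, zero_div, zero_smul, add_zero] at hnormal
    have hone : inner ℝ ((T₁ f₁).1 : Space3) (T₁ f₂).1 = 1 := by
      have := congrArg norm hnormal
      rw [norm_smul, norm_eq_of_mem_sphere, norm_eq_of_mem_sphere, mul_one, Real.norm_eq_abs,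
        abs_of_pos hy3] at this
      exact this.symm
    rw [hone, one_smul] at hnormal
    have hT12 : T₁ f₁ = T₁ f₂ := Prod.ext (Subtype.ext hnormal) (by rw [← hu1, ← hu2, hnormal])
    obtain ⟨T', rfl⟩ := eq_comp_chordFaceMap hne hadj hface hT12
    refine image_polyhedronSpace_subset hne hadj hface hM ⟨T', ?_, rfl⟩
    have hex' : IsExactIncidence M.inc (halfSpaceCoords T') ψ := by
      refine ⟨fun v f hv => forall_mem_boundaryPlane_of_comp hne hadj hface hinc f v hv,
        fun v f hv => ?_⟩
      obtain ⟨f, rfl⟩ := chordFaceMap_surjective M hne hadj hface f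
      exact hy4 v f hv
    exact hex'.mem_polyhedronSpace hp hM hyball
  · refine polyhedronSpace_addChord_subset hne hadj hface hN ?_
    have hcoef : inner ℝ ((T₁ f₁).1 : Space3) (ψ z - ψ u) / inner ℝ m (ψ z - ψ u) < 0 :=
      div_neg_of_neg_of_pos hz1 hzpos
    -- The decomposition of the normal of `f₁` tested on a vertex; the coefficient of `m` is
    -- negative. On a vertex of `f₂` off the chord the first term vanishes and `m` is positive, so
    -- the vertex is strictly inside `f₁`. On a vertex of `f₁` off the chord the left side vanishes
    -- and `m` is negative, so the normal of `f₂` must be negative.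
    have hval : ∀ v, inner ℝ ((T₁ f₁).1 : Space3) (ψ v - ψ u) =
        inner ℝ ((T₁ f₁).1 : Space3) (T₁ f₂).1 * inner ℝ ((T₁ f₂).1 : Space3) (ψ v - ψ u) +
        inner ℝ ((T₁ f₁).1 : Space3) (ψ z - ψ u) / inner ℝ m (ψ z - ψ u) *
          inner ℝ m (ψ v - ψ u) := by
      intro v
      conv_lhs => rw [hnormal]
      rw [inner_add_left, inner_smul_left, inner_smul_left]
      rfl
    have hex' : IsExactIncidence (M.addChord d₁ d₂ hne hadj).inc (halfSpaceCoords T₁) ψ := by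
      refine ⟨fun v f hv => hinc f v hv, fun v f hv => ?_⟩
      by_cases hvc : M.inc v (c f)
      · obtain ⟨f', hf', hvf'⟩ := exists_inc_of_inc M hne hadj hface hvc
        obtain ⟨h1, h2⟩ := (eq_or_isChordFace_of_chordFaceMap_eq M hne hadj hface hf').resolve_left
          (fun h => hv (h ▸ hvf'))
        have hvf := hval v
        rcases h2 with rfl | rfl
        · rcases h1 with rfl | rfl
          · exact absurd hvf' hv
          · have hvu : v ≠ u := fun h => hv (h ▸ huf₁)
            have hvw : v ≠ w := fun h => hv (h ▸ hwf₁)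
            have := hy2 v ⟨hvf', hvu, hvw⟩
            rw [hd f₂ v hvf' huf₂, mul_zero, zero_add, inner_sub_right, hu1] at hvf
            change inner ℝ ((T₁ f₁).1 : Space3) (ψ v) < (T₁ f₁).2
            have := mul_neg_of_neg_of_pos hcoef this
            linarith
        · rcases h1 with rfl | rfl
          · have hvu : v ≠ u := fun h => hv (h ▸ huf₂)
            have hvw : v ≠ w := fun h => hv (h ▸ hwf₂)
            have := hy1 v ⟨hvf', hvu, hvw⟩
            rw [hd f₁ v hvf' huf₁, inner_sub_right ((T₁ f₂).1 : Space3), hu2] at hvf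
            change inner ℝ ((T₁ f₂).1 : Space3) (ψ v) < (T₁ f₂).2
            have := mul_pos_of_neg_of_neg hcoef this
            by_contra! hge
            have := mul_nonneg hy3.le (sub_nonneg.2 hge)
            linarith
          · exact absurd hvf' hv
      · exact hy4 v f hvc
    exact hex'.mem_polyhedronSpace (hp.addChord M hne hadj hface hs) hN hyball

end RotationSystem

end

/-! ### The dimension, and the conclusion -/

namespace RotationSystem

variable {V : Type*} [Fintype V] [DecidableEq V] {G : SimpleGraph V} {M : RotationSystem G}
  {d₁ d₂ : G.Dart} (hne : d₁.snd ≠ d₂.snd) (hadj : ¬ G.Adj d₁.snd d₂.snd)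
  (hface : M.face d₁ = M.face d₂)

include hface in
/-- The dimension of the space of polyhedra. -/
theorem exists_dimension_addChord [Nonempty V] (hM : M.HasMinDegreeThree)
    (hN : (M.addChord d₁ d₂ hne hadj).HasMinDegreeThree) :
    ∃ n k : ℕ, 4 * Fintype.card (M.addChord d₁ d₂ hne hadj).Face = n + 1 + k ∧
      ∀ T ∈ weakPolyhedronSpace (M.addChord d₁ d₂ hne hadj) d₁.snd d₂.snd,
        3 * Fintype.card (M.addChord d₁ d₂ hne hadj).Face + 3 * Fintype.card V =
          n + 1 + (M.addChord d₁ d₂ hne hadj).incidences.ncard := by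
  have := Fintype.ofFinite (M.addChord d₁ d₂ hne hadj).incidences
  rcases Set.eq_empty_or_nonempty
    (weakPolyhedronSpace (M.addChord d₁ d₂ hne hadj) d₁.snd d₂.snd) with h | ⟨T, hT⟩
  · have hpos : 0 < Fintype.card (M.addChord d₁ d₂ hne hadj).Face :=
      Fintype.card_pos_iff.2 ⟨(M.addChord d₁ d₂ hne hadj).face (chordDart hne)⟩
    -- For an empty space any dimension will do, and the dimension formula is vacuous.
    refine ⟨0, 4 * Fintype.card (M.addChord d₁ d₂ hne hadj).Face - 1, by omega, ?_⟩
    rw [h]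
    exact fun T hT => hT.elim
  · obtain ⟨φ, hs, h0, hspan⟩ : ∃ φ : V → Space3,
        StressFree (M.addChord d₁ d₂ hne hadj).incidences (halfSpaceCoords T) φ ∧
        incidenceMap (M.addChord d₁ d₂ hne hadj).incidences (halfSpaceCoords T, φ) = 0 ∧
        ∀ v p, (∀ f, (v, f) ∈ (M.addChord d₁ d₂ hne hadj).incidences →
          inner ℝ (halfSpaceCoords T f).1 p = 0) → p = 0 := by
      rw [weakPolyhedronSpace_addChord hne hadj hface hM hN] at hT
      rcases hT with ⟨-, φ, h, hT⟩ | ⟨T', ⟨-, φ, h, hT⟩, rfl⟩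
      · exact ⟨φ, h.stressFree hN hT, incidenceMap_incidences_eq_zero_iff.2 hT,
          h.normals_span hN hT⟩
      · refine ⟨φ, (stressFree_insert hne hadj hface h hM hT).mono (Set.subset_insert _ _),
          incidenceMap_incidences_eq_zero_iff.2 fun f v hv =>
            hT _ v (inc_chordFaceMap M hne hadj hface hv), fun v p hp =>
          h.normals_span hM hT v p fun f hf => ?_⟩
        obtain ⟨f, rfl, hf⟩ := exists_inc_of_inc M hne hadj hface hf
        exact hp f hf
    -- The count involves only the incidences of the graph with the chord, so the dimension found at
    -- one point is valid at all points of both strata.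
    obtain ⟨n, k, h1, h2⟩ := StressFree.exists_dimension (y := (halfSpaceCoords T, φ)) hs h0 hspan
    exact ⟨n, k, h2, fun _ _ => h1⟩

end RotationSystem

theorem mainTheorem6 {V : Type*} [Finite V] [DecidableEq V]
    (Γ' : SimpleGraph V) (hconn : Γ'.IsThreeConnected)
    (M' : RotationSystem Γ') (hplanar : M'.IsPlanar)
    (d₁ d₂ : Γ'.Dart) (hface : M'.face d₁ = M'.face d₂)
    (hne : d₁.snd ≠ d₂.snd) (hadj : ¬ Γ'.Adj d₁.snd d₂.snd) :
    ∃ n : ℕ,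
      IsSmoothSubmanifold (n + 1) halfSpaceCoords
        (polyhedronSpace (M'.addChord d₁ d₂ hne hadj)) ∧
      ∃ c : (M'.addChord d₁ d₂ hne hadj).Face → M'.Face,
        (∀ d : Γ'.Dart,
          c ((M'.addChord d₁ d₂ hne hadj).face (RotationSystem.oldDart d)) = M'.face d) ∧
        IsSmoothSubmanifoldWithBoundary (n + 1) halfSpaceCoords
          (weakPolyhedronSpace (M'.addChord d₁ d₂ hne hadj) d₁.snd d₂.snd)
          (polyhedronSpace (M'.addChord d₁ d₂ hne hadj))
          ((fun T' : M'.Face → HalfSpace => T' ∘ c) '' polyhedronSpace M') := by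
  have := Fintype.ofFinite V
  have hV : Nonempty V := ⟨d₁.fst⟩
  have hM : M'.HasMinDegreeThree :=
    M'.hasMinDegreeThree_of_three_le hconn.three_le_ncard_neighborSet
  have hN := M'.hasMinDegreeThree_addChord hne hadj hconn.three_le_ncard_neighborSet
  have hweak := RotationSystem.weakPolyhedronSpace_addChord hne hadj hface hM hN
  have hdisj := RotationSystem.disjoint_polyhedronSpace_image hne hadj hface hN
  obtain ⟨n, k, hk, hdim⟩ := RotationSystem.exists_dimension_addChord hne hadj hface hM hN
  have hL : Nonempty ((EuclideanSpace ℝ (Fin (n + 1)) × EuclideanSpace ℝ (Fin k)) ≃L[ℝ]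
      ((M'.addChord d₁ d₂ hne hadj).Face → Space3 × ℝ)) := by
    refine FiniteDimensional.nonempty_continuousLinearEquiv_of_finrank_eq ?_
    rw [finrank_faceFamily, hk]
    simp
  obtain ⟨L⟩ := hL
  have hsub := RotationSystem.polyhedronSpace_addChord_subset hne hadj hface hN
  refine ⟨n, ?_, M'.chordFaceMap hne hadj hface, M'.chordFaceMap_oldDart hne hadj hface, ?_⟩
  · choose Ψ hΨ _ using fun T : polyhedronSpace (M'.addChord d₁ d₂ hne hadj) =>
      RotationSystem.exists_isSliceChart_of_mem_polyhedronSpace hN (𝓡 (n + 1)) Set.univ (by simp)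
        Filter.univ_mem (hdim _ (hsub T.2)) hk T.2 subset_rfl
        RotationSystem.polyhedronSpace_subset_planeFamilies
    obtain ⟨C, h1, h2, -⟩ :=
      exists_chartedSpace_of_isSliceChart (𝓡 (n + 1)) isEmbedding_halfSpaceCoords _ L Ψ hΨ
    exact ⟨C, h1, h2⟩
  · have hrange : ∀ y, y ∈ Set.range (𝓡∂ (n + 1)) ↔ 0 ≤ y 0 := fun y => by
      rw [range_modelWithCornersEuclideanHalfSpace]
      rfl
    -- The first coordinate of the chart at a point tells the stratum: it is 1 at polyhedra having
    -- the chord as an edge and 0 at those of the smaller graph.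
    have hchart : ∀ T : weakPolyhedronSpace (M'.addChord d₁ d₂ hne hadj) d₁.snd d₂.snd,
        ∃ Ψ : OpenPartialHomeomorph ((M'.addChord d₁ d₂ hne hadj).Face → Space3 × ℝ)
          (EuclideanSpace ℝ (Fin (n + 1)) × EuclideanSpace ℝ (Fin k)),
        IsSliceChart (𝓡∂ (n + 1)) (halfSpaceCoords ''
          weakPolyhedronSpace (M'.addChord d₁ d₂ hne hadj) d₁.snd d₂.snd) Ψ (halfSpaceCoords T.1) ∧
        ((T.1 ∈ polyhedronSpace (M'.addChord d₁ d₂ hne hadj) ∧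
            (Ψ (halfSpaceCoords T.1)).1 0 = 1) ∨
          (T.1 ∈ (fun T' : M'.Face → HalfSpace => T' ∘ M'.chordFaceMap hne hadj hface) ''
              polyhedronSpace M' ∧ (Ψ (halfSpaceCoords T.1)).1 0 = 0)) := by
      rintro ⟨T, hT⟩
      rcases hweak ▸ hT with hT' | ⟨T', hT', rfl⟩
      · obtain ⟨Ψ, h1, h2⟩ := RotationSystem.exists_isSliceChart_of_mem_polyhedronSpace hN
          (𝓡∂ (n + 1)) {t | 0 ≤ t} hrange (Ici_mem_nhds one_pos) (hdim T hT) hk hT' hsub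
          (RotationSystem.weakPolyhedronSpace_subset_planeFamilies hne hadj)
        exact ⟨Ψ, h1, Or.inl ⟨hT', h2⟩⟩
      · obtain ⟨Ψ, h1, h2⟩ := RotationSystem.exists_isSliceChart_of_mem_image hne hadj hface hM hN
          (𝓡∂ (n + 1)) hrange (hdim _ hT) hk hT'
        exact ⟨Ψ, h1, Or.inr ⟨⟨T', hT', rfl⟩, h2⟩⟩
    choose Ψ hΨ hΨ' using hchart
    obtain ⟨C, h1, h2, h3⟩ :=
      exists_chartedSpace_of_isSliceChart (𝓡∂ (n + 1)) isEmbedding_halfSpaceCoords _ L Ψ hΨ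
    have hint : ∀ T : weakPolyhedronSpace (M'.addChord d₁ d₂ hne hadj) d₁.snd d₂.snd,
        T ∈ (𝓡∂ (n + 1)).interior (weakPolyhedronSpace (M'.addChord d₁ d₂ hne hadj) d₁.snd d₂.snd) ↔
          T.1 ∈ polyhedronSpace (M'.addChord d₁ d₂ hne hadj) := by
      intro T
      -- Whether a point is interior is read in the chart chosen at that point, by the sign of the
      -- first coordinate.
      change extChartAt (𝓡∂ (n + 1)) T T ∈ interior (Set.range (𝓡∂ (n + 1))) ↔ _
      rw [h3, interior_range_modelWithCornersEuclideanHalfSpace]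
      change 0 < (Ψ T (halfSpaceCoords T.1)).1 0 ↔ _
      rcases hΨ' T with ⟨h4, h5⟩ | ⟨h4, h5⟩ <;> rw [h5]
      · exact iff_of_true one_pos h4
      · exact iff_of_false (lt_irrefl 0) fun h => Set.disjoint_left.1 hdisj h h4
    refine ⟨C, h1, h2, ?_, ?_⟩
    · ext T
      constructor
      · rintro ⟨T, hT, rfl⟩
        exact (hint T).1 hT
      · exact fun hT => ⟨⟨T, hsub hT⟩, (hint _).2 hT, rfl⟩
    · ext T
      constructor
      · rintro ⟨T, hT, rfl⟩
        refine (hweak.subset T.2).resolve_left fun h => ?_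
        rw [← ModelWithCorners.compl_interior] at hT
        exact hT ((hint T).2 h)
      · intro hT
        refine ⟨⟨T, hweak.superset (Or.inr hT)⟩, ?_, rfl⟩
        rw [← ModelWithCorners.compl_interior]
        exact fun h => Set.disjoint_left.1 hdisj ((hint _).1 h) hT
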